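/- Let $1<\alpha<2$, $T>0$, let $\Omega\subset\mathbb R^d$ ($d=1,2,3$) be (the interior of) a convex $d$-polytope, and let $\{\phi_n\}_{n\in\mathbb N}$ be an orthonormal basis of $L^2(\Omega)$ with $-\Delta\phi_n=\lambda_n\phi_n$ in $\Omega$, $\phi_n=0$ on $\partial\Omega$, where $(\lambda_n)$ is positive, non-decreasing and tends to $\infty$. For $m\in\mathbb N$ let ${}^0\!H^m(0,T)=\{w\in H^m(0,T): w^{(k)}(T)=0,\ 0\le k<m\}$ with norm $\|w^{(m)}\|_{L^2(0,T)}$, and let ${}^0\!H^\alpha(0,T)=[{}^0\!H^1(0,T),{}^0\!H^2(0,T)]_{\alpha-1,2}$ (real interpolation space of the $K$-method, with norm $(\int_0^\infty (s^{1-\alpha}K(s,w))^2\,\frac{ds}{s})^{1/2}$). For $v=\sum_n c_n\phi_n$ with $c_n\in L^2(0,T)$ put $$\|v\|_{{}^0\!H^\alpha(0,T;L^2(\Omega))}=\Big(\sum_n\|c_n\|_{{}^0\!H^\alpha(0,T)}^2\Big)^{1/2},\qquad \|v\|_{L^2(0,T;\dot H^2(\Omega))}=\Big(\sum_n\lambda_n^2\|c_n\|_{L^2(0,T)}^2\Big)^{1/2},$$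 and let $G={}^0\!H^\alpha(0,T;L^2(\Omega))\cap L^2(0,T;\dot H^2(\Omega))$ with $\|v\|_G$ the maximum of these two norms. For $\gamma>0$ let $(\mathrm D_{T-}^{-\gamma}v)(t)=\frac1{\Gamma(\gamma)}\int_t^T(s-t)^{\gamma-1}v(s)\,ds$, let $\mathrm D_{T-}^{0}$ be the identity, and, for $j-1<\gamma\le j$ with $j\in\mathbb N_{>0}$, let $\mathrm D_{T-}^{\gamma}=(-\mathrm D)^j\mathrm D_{T-}^{\gamma-j}$ with $\mathrm D$ the distributional time derivative. Let $G_0=\{(\mathrm D_{T-}^{\alpha-1}v)(0):v\in G\}$ and $G_1=\{(\mathrm D_{T-}^{\alpha-2}v)(0):v\in G\}$, with the norms $$\|v_0\|_{G_0}=\inf\{\|v\|_G: v\in G,\ (\mathrm D_{T-}^{\alpha-1}v)(0)=v_0\},\qquad \|v_1\|_{G_1}=\inf\{\|v\|_G: v\in G,\ (\mathrm D_{T-}^{\alpha-2}v)(0)=v_1\}.$$ Stars denote dual spaces and $\langle\cdot,\cdot\rangle_X$ the duality pairing between $X^*$ and $X$. **Theorem.** For all $f\in G^*$, $u_0\in G_0^*$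 and $u_1\in G_1^*$ there is a unique $u\in L^2(0,T;L^2(\Omega))$ such that $$\int_0^T\!\!\int_\Omega u\,(\mathrm D_{T-}^\alpha v-\Delta v)\,dx\,dt=\langle f,v\rangle_G+\langle u_0,(\mathrm D_{T-}^{\alpha-1}v)(0)\rangle_{G_0}+\langle u_1,(\mathrm D_{T-}^{\alpha-2}v)(0)\rangle_{G_1}\qquad\text{for all } v\in G,$$ and it satisfies $$\|u\|_{L^2(0,T;L^2(\Omega))}\le C_\alpha\big(\|f\|_{G^*}+\|u_0\|_{G_0^*}+\|u_1\|_{G_1^*}\big),$$ where the constant $C_\alpha>0$ depends only on $\alpha$. -/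

import Mathlib

open MeasureTheory Set TopologicalSpace
open scoped ENNReal

noncomputable section

namespace FracWave

/-! ### Extended seminorms

A function space is described by an extended norm on a larger vector space: the space consists of
the vectors of finite extended norm. -/

/-- `N` is subadditive and absolutely homogeneous (see `IsExtSeminorm.smul`). -/
structure IsExtSeminorm {V : Type*} [AddCommGroup V] [Module ℝ V] (N : V → ℝ≥0∞) : Prop where
  add_le : ∀ x y, N (x + y) ≤ N x + N y
  smul_le : ∀ (c : ℝ) (x : V), N (c • x) ≤ ‖c‖ₑ * N x

section Interpolation

variable {V : Type*} [AddCommGroup V]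

/-- The `K`-functional of the couple of spaces with extended norms `N₀` and `N₁`:
`K(t, w) = inf { N₀ w₀ + t N₁ w₁ : w = w₀ + w₁ }`. -/
def kFunctional (N₀ N₁ : V → ℝ≥0∞) (t : ℝ) (w : V) : ℝ≥0∞ :=
  ⨅ (p : V × V) (_ : p.1 + p.2 = w), N₀ p.1 + ENNReal.ofReal t * N₁ p.2

/-- The norm of the real interpolation space `[X₀, X₁]_{θ,2}` of the `K`-method,
`(∫_0^∞ (t^{-θ} K(t, w))^2 dt / t)^{1/2}`. -/
def interpENorm (N₀ N₁ : V → ℝ≥0∞) (θ : ℝ) (w : V) : ℝ≥0∞ :=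
  (∫⁻ t in Ioi (0 : ℝ),
    (ENNReal.ofReal (t ^ (-θ)) * kFunctional N₀ N₁ t w) ^ (2 : ℝ) * ENNReal.ofReal t⁻¹) ^
      (1 / 2 : ℝ)

end Interpolation

/-! ### Function spaces in time -/

/-- `L²(0,T;X)`. -/
abbrev BochnerL2 (T : ℝ) (X : Type*) [NormedAddCommGroup X] : Type _ :=
  Lp X 2 (volume.restrict (Ioo 0 T))

/-- The open time interval `(0,T)`. -/
def timeInterval (T : ℝ) : Opens ℝ := ⟨Ioo 0 T, isOpen_Ioo⟩

section Time

variable {X : Type*} [NormedAddCommGroup X] [NormedSpace ℝ X]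

/-- `g` is the `j`-th derivative of `y` on `(0,T)` in the sense of `X`-valued distributions. -/
def IsWeakDeriv (T : ℝ) (j : ℕ) (y g : ℝ → X) : Prop :=
  IntegrableOn y (Ioo 0 T) ∧ IntegrableOn g (Ioo 0 T) ∧
    ∀ φ : TestFunction (timeInterval T) ℝ ⊤,
      ∫ t in Ioo 0 T, iteratedDeriv j φ t • y t = (-1 : ℝ) ^ j • ∫ t in Ioo 0 T, φ t • g t

/-- `y` vanishes at the right end point: it has a representative which is continuous on `[0,T]`
and vanishes at `T`. -/
def VanishesAtEnd (T : ℝ) (y : ℝ → X) : Prop :=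
  ∃ Y : ℝ → X, ContinuousOn Y (Icc 0 T) ∧ y =ᵐ[volume.restrict (Ioo 0 T)] Y ∧ Y T = 0

/-- The right-sided Riemann–Liouville fractional integral of order `γ ≥ 0`,
`(D_{T-}^{-γ} v)(t) = Γ(γ)⁻¹ ∫_t^T (s - t)^{γ-1} v(s) ds`, the identity for `γ = 0`. -/
def rightRLIntegral (T γ : ℝ) (v : ℝ → X) (t : ℝ) : X :=
  if γ = 0 then v t
  else (Real.Gamma γ)⁻¹ • ∫ s in Ioo t T, (s - t) ^ (γ - 1) • v s

/-- `g = D_{T-}^γ v` on `(0,T)`, for any real order `γ`: for `γ ≤ 0` this is the fractional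
integral of order `-γ`, and for `j - 1 < γ ≤ j` with `j ≥ 1` one has
`D_{T-}^γ v = (-D)^j D_{T-}^{γ-j} v` with `D` the distributional derivative. -/
def IsRightRL (T γ : ℝ) (v g : ℝ → X) : Prop :=
  if γ ≤ 0 then g =ᵐ[volume.restrict (Ioo 0 T)] rightRLIntegral T (-γ) v
  else IsWeakDeriv T ⌈γ⌉₊ (rightRLIntegral T (⌈γ⌉₊ - γ) v) (fun t => (-1 : ℝ) ^ ⌈γ⌉₊ • g t)

/-- `(D_{T-}^γ v)(0) = x`: the function `D_{T-}^γ v` has a representative which is continuous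
on `[0,T]` and takes the value `x` at `0`. -/
def HasRightRLTrace (T γ : ℝ) (v : ℝ → X) (x : X) : Prop :=
  ∃ g : ℝ → X, ContinuousOn g (Icc 0 T) ∧ IsRightRL T γ v g ∧ g 0 = x

end Time

/-- `D 0, …, D m` are the weak derivatives of orders `0, …, m` of `w ∈ L²(0,T)`; they lie in
`L²(0,T)`, and those of orders `k < m` vanish at `T`. -/
def IsRightSobolevChain (T : ℝ) (m : ℕ) (w : BochnerL2 T ℝ) (D : ℕ → BochnerL2 T ℝ) : Prop :=
  D 0 = w ∧ ∀ k < m, IsWeakDeriv T 1 (D k) (D (k + 1)) ∧ VanishesAtEnd T (D k)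

/-- The norm `‖w^{(m)}‖_{L²(0,T)}` of `⁰H^m(0,T)`, with the value `⊤` if `w` is not in this space
(weak derivatives are unique, so the infimum is over a single value or over the empty set). -/
def rightSobolevENorm (T : ℝ) (m : ℕ) (w : BochnerL2 T ℝ) : ℝ≥0∞ :=
  ⨅ (D : ℕ → BochnerL2 T ℝ) (_ : IsRightSobolevChain T m w D), ‖D m‖ₑ

/-- The norm of `⁰H^α(0,T) = [⁰H¹(0,T), ⁰H²(0,T)]_{α-1,2}` for `1 < α < 2`. -/
def rightFracSobolevENorm (T α : ℝ) : BochnerL2 T ℝ → ℝ≥0∞ :=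
  interpENorm (rightSobolevENorm T 1) (rightSobolevENorm T 2) (α - 1)

/-! ### The domain and the Dirichlet eigenbasis -/

/-- `Ω` is (the interior of) a convex polytope with nonempty interior. -/
def IsConvexPolytope {d : ℕ} (Ω : Set (EuclideanSpace ℝ (Fin d))) : Prop :=
  Ω.Nonempty ∧ ∃ s : Set (EuclideanSpace ℝ (Fin d)), s.Finite ∧ Ω = interior (convexHull ℝ s)

/-- `L²(Ω)`. -/
abbrev SpaceL2 {d : ℕ} (Ω : Opens (EuclideanSpace ℝ (Fin d))) : Type :=
  Lp ℝ 2 (volume.restrict (Ω : Set (EuclideanSpace ℝ (Fin d))))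

section Domain

variable {d : ℕ} {Ω : Opens (EuclideanSpace ℝ (Fin d))}

/-- `u ∈ H¹₀(Ω)`, the closure of the test functions in `H¹(Ω)`. -/
def MemH01 (u : SpaceL2 Ω) : Prop :=
  ∃ g : EuclideanSpace ℝ (Fin d) → EuclideanSpace ℝ (Fin d),
    MemLp g 2 (volume.restrict Ω) ∧
    ∀ ε : ℝ≥0∞, 0 < ε → ∃ ψ : TestFunction Ω ℝ ⊤,
      eLpNorm (fun x => u x - ψ x) 2 (volume.restrict Ω) ≤ ε ∧
      eLpNorm (fun x => g x - gradient ψ x) 2 (volume.restrict Ω) ≤ ε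

/-- `Δ u = f` in `Ω` in the sense of distributions. -/
def IsWeakLaplacian (u f : SpaceL2 Ω) : Prop :=
  ∀ ψ : TestFunction Ω ℝ ⊤,
    ∫ x in (Ω : Set (EuclideanSpace ℝ (Fin d))), u x * Laplacian.laplacian (ψ : _ → ℝ) x =
      ∫ x in (Ω : Set (EuclideanSpace ℝ (Fin d))), f x * ψ x

end Domain

/-- An orthonormal basis `φ 0, φ 1, …` of `L²(Ω)` that consists of eigenfunctions of the Dirichlet
Laplacian, `-Δ φₙ = λₙ φₙ` in `Ω` and `φₙ = 0` on `∂Ω`, enumerated so that the (positive)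
eigenvalues do not decrease; they tend to infinity. -/
structure DirichletEigenbasis {d : ℕ} (Ω : Opens (EuclideanSpace ℝ (Fin d))) where
  φ : HilbertBasis ℕ ℝ (SpaceL2 Ω)
  eig : ℕ → ℝ
  eig_pos : ∀ n, 0 < eig n
  eig_mono : Monotone eig
  eig_tendsto : Filter.Tendsto eig Filter.atTop Filter.atTop
  boundary : ∀ n, MemH01 (φ n)
  eigen : ∀ n, IsWeakLaplacian (φ n) (-(eig n • φ n))

/-! ### Mixed spaces -/

section Mixed

variable {d : ℕ} {Ω : Opens (EuclideanSpace ℝ (Fin d))}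

/-- The coefficient function `t ↦ (v(t), φₙ)_{L²(Ω)}` of `v ∈ L²(0,T;L²(Ω))`. -/
def coeff (B : DirichletEigenbasis Ω) (T : ℝ) (n : ℕ) :
    BochnerL2 T (SpaceL2 Ω) →L[ℝ] BochnerL2 T ℝ :=
  (innerSL ℝ (B.φ n)).compLpL 2 (volume.restrict (Ioo 0 T))

/-- For `β ≥ 0` and a space `Y ⊆ L²(0,T)` with extended norm `N`: the norm
`(∑ₙ λₙ^β ‖cₙ‖_Y²)^{1/2}` of `v = ∑ₙ cₙ φₙ` in the space of `Ḣ^β(Ω)`-valued functions of class `Y`;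
recall that `λₙ^{-β/2} φₙ` is the orthonormal basis of `Ḣ^β(Ω)`. -/
def mixedENorm (B : DirichletEigenbasis Ω) (T : ℝ) (N : BochnerL2 T ℝ → ℝ≥0∞) (β : ℝ)
    (v : BochnerL2 T (SpaceL2 Ω)) : ℝ≥0∞ :=
  (∑' n, ENNReal.ofReal (B.eig n ^ β) * N (coeff B T n v) ^ (2 : ℝ)) ^ (1 / 2 : ℝ)

/-- The norm of `G = ⁰H^α(0,T;L²(Ω)) ∩ L²(0,T;Ḣ²(Ω))`, the maximum of the two norms. -/
def gENorm (B : DirichletEigenbasis Ω) (T α : ℝ) (v : BochnerL2 T (SpaceL2 Ω)) : ℝ≥0∞ :=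
  max (mixedENorm B T (rightFracSobolevENorm T α) 0 v) (mixedENorm B T (fun w => ‖w‖ₑ) 2 v)

end Mixed

/-! ### Proofs that the norms are norms -/

namespace IsExtSeminorm

variable {V : Type*} [AddCommGroup V] [Module ℝ V] {N N₀ N₁ : V → ℝ≥0∞}

theorem smul (h : IsExtSeminorm N) (c : ℝ) (x : V) : N (c • x) = ‖c‖ₑ * N x := by
  refine le_antisymm (h.smul_le c x) ?_
  rcases eq_or_ne c 0 with rfl | hc
  · simp
  · have h1 := h.smul_le c⁻¹ (c • x)
    rw [smul_smul, inv_mul_cancel₀ hc, one_smul] at h1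
    calc ‖c‖ₑ * N x ≤ ‖c‖ₑ * (‖c⁻¹‖ₑ * N (c • x)) := by gcongr
      _ = N (c • x) := by
        rw [← mul_assoc, ← enorm_mul, mul_inv_cancel₀ hc]; simp

theorem zero (h : IsExtSeminorm N) : N 0 = 0 := by
  have := h.smul 0 0
  simpa using this

theorem max (h₀ : IsExtSeminorm N₀) (h₁ : IsExtSeminorm N₁) :
    IsExtSeminorm (fun x => max (N₀ x) (N₁ x)) where
  add_le x y := max_le
    ((h₀.add_le x y).trans (add_le_add (le_max_left _ _) (le_max_left _ _)))
    ((h₁.add_le x y).trans (add_le_add (le_max_right _ _) (le_max_right _ _)))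
  smul_le c x := max_le
    ((h₀.smul_le c x).trans (mul_le_mul_right (le_max_left _ _) _))
    ((h₁.smul_le c x).trans (mul_le_mul_right (le_max_right _ _) _))

theorem enorm {W : Type*} [NormedAddCommGroup W] [NormedSpace ℝ W] :
    IsExtSeminorm (fun x : W => ‖x‖ₑ) where
  add_le x y := enorm_add_le x y
  smul_le c x := (enorm_smul c x).le

theorem const_mul (h : IsExtSeminorm N) (a : ℝ≥0∞) : IsExtSeminorm (fun x => a * N x) where
  add_le x y := by rw [← mul_add]; gcongr; exact h.add_le x y
  smul_le c x := by rw [h.smul, mul_left_comm]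

theorem comp {W : Type*} [AddCommGroup W] [Module ℝ W] (h : IsExtSeminorm N) (L : W →ₗ[ℝ] V) :
    IsExtSeminorm (fun x => N (L x)) where
  add_le x y := by rw [map_add]; exact h.add_le _ _
  smul_le c x := by rw [map_smul]; exact h.smul_le _ _

theorem of_ne_zero (h₀ : N 0 = 0) (hadd : ∀ x y, N (x + y) ≤ N x + N y)
    (hsmul : ∀ c : ℝ, c ≠ 0 → ∀ x, N (c • x) ≤ ‖c‖ₑ * N x) : IsExtSeminorm N where
  add_le := hadd
  smul_le c x := by
    rcases eq_or_ne c 0 with rfl | hc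
    · simp [h₀]
    · exact hsmul c hc x

/-- The submodule of vectors of finite extended norm. -/
def finiteSubmodule (h : IsExtSeminorm N) : Submodule ℝ V where
  carrier := {x | N x < ⊤}
  zero_mem' := by simp [h.zero]
  add_mem' {x y} hx hy := (h.add_le x y).trans_lt (ENNReal.add_lt_top.2 ⟨hx, hy⟩)
  smul_mem' c x hx := (h.smul_le c x).trans_lt (ENNReal.mul_lt_top enorm_lt_top hx)

theorem kFunctional (h₀ : IsExtSeminorm N₀) (h₁ : IsExtSeminorm N₁) (t : ℝ) :
    IsExtSeminorm (FracWave.kFunctional N₀ N₁ t) := by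
  refine of_ne_zero ?_ (fun x y => ?_) (fun c hc x => ?_)
  · refine le_antisymm ((iInf₂_le (0 : V × V) (by simp)).trans ?_) bot_le
    simp [h₀.zero, h₁.zero]
  · unfold FracWave.kFunctional
    simp only [ENNReal.iInf_add, ENNReal.add_iInf]
    refine le_iInf₂ fun p hp => le_iInf₂ fun q hq => ?_
    refine (iInf₂_le (p + q) (by
      rw [← hp, ← hq, Prod.fst_add, Prod.snd_add]; abel)).trans ?_
    calc N₀ (p.1 + q.1) + ENNReal.ofReal t * N₁ (p.2 + q.2)
        ≤ (N₀ p.1 + N₀ q.1) + ENNReal.ofReal t * (N₁ p.2 + N₁ q.2) := by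
          gcongr
          · exact h₀.add_le _ _
          · exact h₁.add_le _ _
      _ ≤ _ := le_of_eq (by ring)
  · have hc' : ‖c‖ₑ ≠ 0 := by simpa using hc
    unfold FracWave.kFunctional
    simp only [ENNReal.mul_iInf_of_ne hc' enorm_ne_top]
    refine le_iInf₂ fun p hp => ?_
    refine (iInf₂_le (c • p) (by rw [← hp]; simp)).trans ?_
    rw [Prod.smul_fst, Prod.smul_snd, h₀.smul, h₁.smul]
    exact le_of_eq (by ring)

theorem lintegral_sq {ι : Type*} [MeasurableSpace ι] (μ : Measure ι) {M : ι → V → ℝ≥0∞}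
    (hM : ∀ a, IsExtSeminorm (M a)) (hm : ∀ x, AEMeasurable (fun a => M a x) μ) :
    IsExtSeminorm (fun x => (∫⁻ a, M a x ^ (2 : ℝ) ∂μ) ^ (1 / 2 : ℝ)) where
  add_le x y := by
    refine le_trans ?_ (ENNReal.lintegral_Lp_add_le (hm x) (hm y) one_le_two)
    gcongr with a
    exact (hM a).add_le x y
  smul_le c x := by
    simp only [(hM _).smul, ENNReal.mul_rpow_of_nonneg _ _ (zero_le_two (α := ℝ))]
    rw [lintegral_const_mul' _ _ (by simp), ENNReal.mul_rpow_of_nonneg _ _ (by norm_num),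
      ← ENNReal.rpow_mul]
    norm_num

theorem interpENorm (h₀ : IsExtSeminorm N₀) (h₁ : IsExtSeminorm N₁) (θ : ℝ) :
    IsExtSeminorm (FracWave.interpENorm N₀ N₁ θ) := by
  have hK : ∀ w, Measurable (fun t => FracWave.kFunctional N₀ N₁ t w) := fun w =>
    Monotone.measurable fun s t hst => by unfold FracWave.kFunctional; gcongr
  have key := lintegral_sq (volume.restrict (Ioi (0 : ℝ)))
    (M := fun t w => (ENNReal.ofReal t⁻¹ ^ (1 / 2 : ℝ) * ENNReal.ofReal (t ^ (-θ))) *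
      FracWave.kFunctional N₀ N₁ t w)
    (fun t => (h₀.kFunctional h₁ t).const_mul _)
    (fun w => (Measurable.mul (by fun_prop) (hK w)).aemeasurable)
  convert key using 1
  funext w
  unfold FracWave.interpENorm
  congr 1
  refine lintegral_congr fun t => ?_
  rw [mul_assoc (ENNReal.ofReal t⁻¹ ^ (1 / 2 : ℝ)),
    ENNReal.mul_rpow_of_nonneg (ENNReal.ofReal t⁻¹ ^ (1 / 2 : ℝ)) _ (zero_le_two (α := ℝ)),
    ← ENNReal.rpow_mul, mul_comm]
  norm_num

end IsExtSeminorm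

section WeakDerivLemmas

set_option linter.unusedSectionVars false

variable {X : Type*} [NormedAddCommGroup X] [NormedSpace ℝ X] {T : ℝ} {j : ℕ}
  {y z g h : ℝ → X}

theorem integrable_test_smul (φ : TestFunction (timeInterval T) ℝ ⊤) (k : ℕ)
    (hy : IntegrableOn y (Ioo 0 T)) :
    IntegrableOn (fun t => iteratedDeriv k φ t • y t) (Ioo 0 T) := by
  have hc : Continuous (iteratedDeriv k φ) :=
    φ.contDiff.continuous_iteratedDeriv k (by exact_mod_cast le_top)
  have hs : HasCompactSupport (iteratedDeriv k φ) := by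
    refine (φ.hasCompactSupport.iteratedFDeriv (𝕜 := ℝ) k).mono fun t ht => ?_
    rw [Function.mem_support] at ht ⊢
    intro h0
    exact ht (by rw [iteratedDeriv_eq_iteratedFDeriv, h0]; rfl)
  obtain ⟨C, hC⟩ := hc.bounded_above_of_compact_support hs
  exact Integrable.bdd_smul hy C hc.aestronglyMeasurable (Filter.Eventually.of_forall hC)

theorem IsWeakDeriv.add (h₁ : IsWeakDeriv T j y g) (h₂ : IsWeakDeriv T j z h) :
    IsWeakDeriv T j (y + z) (g + h) := by
  refine ⟨h₁.1.add h₂.1, h₁.2.1.add h₂.2.1, fun φ => ?_⟩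
  have e1 := integrable_test_smul φ 0 h₁.2.1
  have e2 := integrable_test_smul φ 0 h₂.2.1
  simp only [iteratedDeriv_zero] at e1 e2
  simp only [Pi.add_apply, smul_add]
  rw [integral_add (integrable_test_smul φ j h₁.1) (integrable_test_smul φ j h₂.1),
    integral_add e1 e2, smul_add, h₁.2.2 φ, h₂.2.2 φ]

theorem IsWeakDeriv.smul (c : ℝ) (h₁ : IsWeakDeriv T j y g) :
    IsWeakDeriv T j (c • y) (c • g) := by
  refine ⟨h₁.1.smul c, h₁.2.1.smul c, fun φ => ?_⟩
  simp only [Pi.smul_apply, smul_comm _ c]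
  rw [integral_smul, integral_smul, h₁.2.2 φ, smul_comm]

theorem IsWeakDeriv.congr (h₁ : IsWeakDeriv T j y g) (hy : y =ᵐ[volume.restrict (Ioo 0 T)] z)
    (hg : g =ᵐ[volume.restrict (Ioo 0 T)] h) : IsWeakDeriv T j z h := by
  refine ⟨h₁.1.congr hy, h₁.2.1.congr hg, fun φ => ?_⟩
  have e1 := h₁.2.2 φ
  have e2 : ∫ t in Ioo 0 T, iteratedDeriv j φ t • y t =
      ∫ t in Ioo 0 T, iteratedDeriv j φ t • z t :=
    integral_congr_ae (by filter_upwards [hy] with t ht; rw [ht])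
  have e3 : ∫ t in Ioo 0 T, φ t • g t = ∫ t in Ioo 0 T, φ t • h t :=
    integral_congr_ae (by filter_upwards [hg] with t ht; rw [ht])
  rw [← e2, ← e3, e1]

theorem IsWeakDeriv.zero : IsWeakDeriv T j (0 : ℝ → X) 0 := by
  refine ⟨integrableOn_zero, integrableOn_zero, fun φ => by simp⟩

theorem VanishesAtEnd.add (h₁ : VanishesAtEnd T y) (h₂ : VanishesAtEnd T z) :
    VanishesAtEnd T (y + z) := by
  obtain ⟨Y, hY, hyY, hY0⟩ := h₁
  obtain ⟨Z, hZ, hzZ, hZ0⟩ := h₂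
  exact ⟨Y + Z, hY.add hZ, hyY.add hzZ, by simp [hY0, hZ0]⟩

theorem VanishesAtEnd.smul (c : ℝ) (h₁ : VanishesAtEnd T y) : VanishesAtEnd T (c • y) := by
  obtain ⟨Y, hY, hyY, hY0⟩ := h₁
  exact ⟨c • Y, hY.const_smul c, hyY.const_smul c, by simp [hY0]⟩

theorem VanishesAtEnd.congr (h₁ : VanishesAtEnd T y)
    (hyz : y =ᵐ[volume.restrict (Ioo 0 T)] z) : VanishesAtEnd T z := by
  obtain ⟨Y, hY, hyY, hY0⟩ := h₁
  exact ⟨Y, hY, hyz.symm.trans hyY, hY0⟩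

theorem integrableOn_bochnerL2 (v : BochnerL2 T X) : IntegrableOn v (Ioo 0 T) :=
  (Lp.memLp v).integrable one_le_two

theorem rightRLIntegral_congr (γ : ℝ) (hyz : y =ᵐ[volume.restrict (Ioo 0 T)] z) :
    rightRLIntegral T γ y =ᵐ[volume.restrict (Ioo 0 T)] rightRLIntegral T γ z := by
  rcases eq_or_ne γ 0 with rfl | hγ
  · simpa [rightRLIntegral, Filter.EventuallyEq] using hyz
  · filter_upwards [ae_restrict_mem measurableSet_Ioo] with t ht
    simp only [rightRLIntegral, hγ, if_false]
    congr 1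
    refine integral_congr_ae ?_
    filter_upwards [ae_restrict_of_ae_restrict_of_subset (Ioo_subset_Ioo_left ht.1.le) hyz]
      with s hs
    rw [hs]

theorem rightRLIntegral_integrand {γ : ℝ} (hγ : 0 < γ) (hy : IntegrableOn y (Ioo 0 T)) :
    ∀ᵐ t ∂(volume.restrict (Ioo 0 T)),
      IntegrableOn (fun s => (s - t) ^ (γ - 1) • y s) (Ioo t T) := by
  have hk : Integrable ((Ioo (-T) 0).indicator fun x : ℝ => (-x) ^ (γ - 1)) := by
    rw [integrable_indicator_iff measurableSet_Ioo]
    rcases le_or_gt T 0 with hT | hT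
    · rw [Ioo_eq_empty (by linarith)]
      exact integrableOn_empty
    · have h1 : IntervalIntegrable (fun x : ℝ => (-x) ^ (γ - 1)) volume (-T) (-0) :=
        (IntervalIntegrable.iff_comp_neg (by simp)).1
          (intervalIntegral.intervalIntegrable_rpow' (by linarith : -1 < γ - 1))
      rw [neg_zero, intervalIntegrable_iff_integrableOn_Ioo_of_le (by linarith)] at h1
      exact h1
  have hy' : Integrable ((Ioo 0 T).indicator y) := by
    rwa [integrable_indicator_iff measurableSet_Ioo]
  have := hk.ae_convolution_exists (ContinuousLinearMap.lsmul ℝ ℝ) hy'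
  filter_upwards [ae_restrict_of_ae this, ae_restrict_mem measurableSet_Ioo] with t ht htT
  have h2 := ht.integrable_swap.integrableOn (s := Ioo t T)
  refine h2.congr_fun (fun s hs => ?_) measurableSet_Ioo
  have m1 : t - s ∈ Ioo (-T) 0 := ⟨by linarith [hs.2, htT.1], by linarith [hs.1]⟩
  have m2 : s ∈ Ioo 0 T := ⟨htT.1.trans hs.1, hs.2⟩
  simp [indicator_of_mem m1, indicator_of_mem m2]

theorem rightRLIntegral_add {γ : ℝ} (hγ : 0 ≤ γ) (hy : IntegrableOn y (Ioo 0 T))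
    (hz : IntegrableOn z (Ioo 0 T)) :
    rightRLIntegral T γ (y + z) =ᵐ[volume.restrict (Ioo 0 T)]
      rightRLIntegral T γ y + rightRLIntegral T γ z := by
  rcases eq_or_lt_of_le hγ with rfl | hγ
  · refine Filter.Eventually.of_forall fun t => ?_
    simp [rightRLIntegral]
  · filter_upwards [rightRLIntegral_integrand hγ hy, rightRLIntegral_integrand hγ hz]
      with t h1 h2
    simp only [rightRLIntegral, hγ.ne', if_false, Pi.add_apply, smul_add]
    rw [integral_add h1 h2, smul_add]

theorem rightRLIntegral_smul (γ c : ℝ) :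
    rightRLIntegral T γ (c • y) = c • rightRLIntegral T γ y := by
  funext t
  by_cases hγ : γ = 0
  · simp [rightRLIntegral, hγ]
  · simp only [rightRLIntegral, hγ, if_false, Pi.smul_apply, smul_comm _ c, integral_smul]

theorem IsRightRL.congr {γ : ℝ} (h₁ : IsRightRL T γ y g)
    (hyz : y =ᵐ[volume.restrict (Ioo 0 T)] z) : IsRightRL T γ z g := by
  unfold IsRightRL at h₁ ⊢
  split_ifs at h₁ ⊢ with hγ
  · exact h₁.trans (rightRLIntegral_congr _ hyz)
  · exact h₁.congr (rightRLIntegral_congr _ hyz) (Filter.EventuallyEq.refl _ _)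

theorem IsRightRL.add {γ : ℝ} (hy : IntegrableOn y (Ioo 0 T)) (hz : IntegrableOn z (Ioo 0 T))
    (h₁ : IsRightRL T γ y g) (h₂ : IsRightRL T γ z h) : IsRightRL T γ (y + z) (g + h) := by
  unfold IsRightRL at h₁ h₂ ⊢
  split_ifs at h₁ h₂ ⊢ with hγ
  · exact (h₁.add h₂).trans (rightRLIntegral_add (by linarith) hy hz).symm
  · refine (h₁.add h₂).congr
      (rightRLIntegral_add (by linarith [Nat.le_ceil γ]) hy hz).symm ?_
    refine Filter.Eventually.of_forall fun t => ?_
    simp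

theorem IsRightRL.smul {γ : ℝ} (c : ℝ) (h₁ : IsRightRL T γ y g) :
    IsRightRL T γ (c • y) (c • g) := by
  unfold IsRightRL at h₁ ⊢
  rw [rightRLIntegral_smul, rightRLIntegral_smul]
  split_ifs at h₁ ⊢ with hγ
  · exact h₁.const_smul c
  · refine (h₁.smul c).congr (Filter.EventuallyEq.refl _ _) ?_
    refine Filter.Eventually.of_forall fun t => ?_
    simp [smul_comm c]

theorem HasRightRLTrace.zero {γ : ℝ} : HasRightRLTrace T γ (0 : ℝ → X) 0 := by
  refine ⟨0, continuousOn_const, ?_, rfl⟩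
  unfold IsRightRL
  have h0 : ∀ δ : ℝ, rightRLIntegral T δ (0 : ℝ → X) = 0 := fun δ => by
    funext t
    simp [rightRLIntegral]
  simp only [h0]
  split_ifs with hγ
  · exact Filter.EventuallyEq.refl _ _
  · refine IsWeakDeriv.zero.congr (Filter.EventuallyEq.refl _ _) ?_
    refine Filter.Eventually.of_forall fun t => ?_
    simp

theorem HasRightRLTrace.congr {γ : ℝ} {a : X} (h₁ : HasRightRLTrace T γ y a)
    (hyz : y =ᵐ[volume.restrict (Ioo 0 T)] z) : HasRightRLTrace T γ z a := by
  obtain ⟨g, hg, hgy, hg0⟩ := h₁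
  exact ⟨g, hg, hgy.congr hyz, hg0⟩

theorem HasRightRLTrace.add {γ : ℝ} {a b : X} {v w : BochnerL2 T X}
    (h₁ : HasRightRLTrace T γ v a) (h₂ : HasRightRLTrace T γ w b) :
    HasRightRLTrace T γ (v + w : BochnerL2 T X) (a + b) := by
  obtain ⟨g, hg, hgv, hg0⟩ := h₁
  obtain ⟨h, hh, hhw, hh0⟩ := h₂
  refine HasRightRLTrace.congr (y := (v : ℝ → X) + (w : ℝ → X)) ⟨g + h, hg.add hh,
    hgv.add (integrableOn_bochnerL2 v) (integrableOn_bochnerL2 w) hhw, by simp [hg0, hh0]⟩ ?_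
  exact (Lp.coeFn_add v w).symm

theorem HasRightRLTrace.smul {γ : ℝ} (c : ℝ) {a : X} {v : BochnerL2 T X}
    (h₁ : HasRightRLTrace T γ v a) : HasRightRLTrace T γ (c • v : BochnerL2 T X) (c • a) := by
  obtain ⟨g, hg, hgv, hg0⟩ := h₁
  refine HasRightRLTrace.congr (y := c • (v : ℝ → X)) ⟨c • g, hg.const_smul c, hgv.smul c, by simp [hg0]⟩ ?_
  exact (Lp.coeFn_smul c v).symm

end WeakDerivLemmas

theorem isExtSeminorm_rightSobolev (T : ℝ) (m : ℕ) :
    IsExtSeminorm (rightSobolevENorm T m) := by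
  refine IsExtSeminorm.of_ne_zero ?_ (fun x y => ?_) (fun c hc x => ?_)
  · have h0 : IsRightSobolevChain T m 0 (fun _ => 0) := ⟨rfl, fun k _ =>
      ⟨(IsWeakDeriv.zero (X := ℝ)).congr (Lp.coeFn_zero _ _ _).symm (Lp.coeFn_zero _ _ _).symm,
        fun _ => 0, continuousOn_const, Lp.coeFn_zero _ _ _, rfl⟩⟩
    exact le_antisymm ((iInf₂_le _ h0).trans (by simp)) bot_le
  · unfold rightSobolevENorm
    simp only [ENNReal.iInf_add, ENNReal.add_iInf]
    refine le_iInf₂ fun D hD => le_iInf₂ fun F hF => ?_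
    have hFD : IsRightSobolevChain T m (x + y) (F + D) := ⟨by simp [hD.1, hF.1], fun k hk =>
      ⟨((hF.2 k hk).1.add (hD.2 k hk).1).congr (Lp.coeFn_add _ _).symm (Lp.coeFn_add _ _).symm,
        ((hF.2 k hk).2.add (hD.2 k hk).2).congr (Lp.coeFn_add _ _).symm⟩⟩
    exact (iInf₂_le _ hFD).trans (enorm_add_le _ _)
  · have hc' : ‖c‖ₑ ≠ 0 := by simpa using hc
    unfold rightSobolevENorm
    simp only [ENNReal.mul_iInf_of_ne hc' enorm_ne_top]
    refine le_iInf₂ fun D hD => ?_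
    have hcD : IsRightSobolevChain T m (c • x) (c • D) := ⟨by simp [hD.1], fun k hk =>
      ⟨((hD.2 k hk).1.smul c).congr (Lp.coeFn_smul _ _).symm (Lp.coeFn_smul _ _).symm,
        ((hD.2 k hk).2.smul c).congr (Lp.coeFn_smul _ _).symm⟩⟩
    exact (iInf₂_le _ hcD).trans (enorm_smul _ _).le

section Spaces

variable {d : ℕ} {Ω : Opens (EuclideanSpace ℝ (Fin d))} (B : DirichletEigenbasis Ω) (T α : ℝ)

theorem isExtSeminorm_mixed {N : BochnerL2 T ℝ → ℝ≥0∞} (hN : IsExtSeminorm N) (β : ℝ) :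
    IsExtSeminorm (mixedENorm B T N β) := by
  have key := IsExtSeminorm.lintegral_sq (Measure.count : Measure ℕ)
    (M := fun n v => ENNReal.ofReal (B.eig n ^ β) ^ (1 / 2 : ℝ) * N (coeff B T n v))
    (fun n => (hN.comp (coeff B T n).toLinearMap).const_mul _)
    (fun v => (measurable_from_nat).aemeasurable)
  convert key using 1
  funext v
  unfold mixedENorm
  rw [lintegral_count]
  congr 2
  funext n
  rw [ENNReal.mul_rpow_of_nonneg _ _ (zero_le_two (α := ℝ)), ← ENNReal.rpow_mul]
  norm_num

theorem isExtSeminorm_gENorm : IsExtSeminorm (gENorm B T α) :=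
  (isExtSeminorm_mixed B T ((isExtSeminorm_rightSobolev T 1).interpENorm
    (isExtSeminorm_rightSobolev T 2) _) 0).max (isExtSeminorm_mixed B T IsExtSeminorm.enorm 2)

/-- The space `G = ⁰H^α(0,T;L²(Ω)) ∩ L²(0,T;Ḣ²(Ω))`: the functions in `L²(0,T;L²(Ω))` of finite
`gENorm`, with that norm (and not the norm of `L²(0,T;L²(Ω))`). -/
def GSpace : Type := (isExtSeminorm_gENorm B T α).finiteSubmodule

namespace GSpace

instance : AddCommGroup (GSpace B T α) :=
  inferInstanceAs (AddCommGroup (isExtSeminorm_gENorm B T α).finiteSubmodule)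

instance : Module ℝ (GSpace B T α) :=
  inferInstanceAs (Module ℝ (isExtSeminorm_gENorm B T α).finiteSubmodule)

variable {B T α}

/-- The inclusion of `G` in `L²(0,T;L²(Ω))`. -/
def toL2 : GSpace B T α →ₗ[ℝ] BochnerL2 T (SpaceL2 Ω) :=
  (isExtSeminorm_gENorm B T α).finiteSubmodule.subtype

theorem gENorm_toL2_lt_top (v : GSpace B T α) : gENorm B T α v.toL2 < ⊤ := v.2

instance : Norm (GSpace B T α) := ⟨fun v => (gENorm B T α v.toL2).toReal⟩

theorem norm_def (v : GSpace B T α) : ‖v‖ = (gENorm B T α v.toL2).toReal := rfl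

theorem normCore : SeminormedSpace.Core ℝ (GSpace B T α) where
  norm_nonneg v := ENNReal.toReal_nonneg
  norm_smul c v := by
    rw [norm_def, norm_def, map_smul, (isExtSeminorm_gENorm B T α).smul, ENNReal.toReal_mul,
      toReal_enorm]
  norm_triangle v w := by
    rw [norm_def, norm_def, norm_def, map_add,
      ← ENNReal.toReal_add (gENorm_toL2_lt_top v).ne (gENorm_toL2_lt_top w).ne]
    exact ENNReal.toReal_mono
      (ENNReal.add_lt_top.2 ⟨gENorm_toL2_lt_top v, gENorm_toL2_lt_top w⟩).ne
      ((isExtSeminorm_gENorm B T α).add_le _ _)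

instance : SeminormedAddCommGroup (GSpace B T α) := SeminormedAddCommGroup.ofCore normCore

instance : NormedSpace ℝ (GSpace B T α) where
  norm_smul_le c v := (normCore.norm_smul c v).le

end GSpace

/-- The subspace `{ (D_{T-}^γ v)(0) : v ∈ G }` of `L²(Ω)`. -/
def traceSubmodule (γ : ℝ) : Submodule ℝ (SpaceL2 Ω) where
  carrier := {x | ∃ v : GSpace B T α, HasRightRLTrace T γ v.toL2 x}
  zero_mem' := by
    refine ⟨0, ?_⟩
    rw [map_zero]
    exact HasRightRLTrace.zero.congr (Lp.coeFn_zero _ _ _).symm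
  add_mem' := by
    rintro x y ⟨v, hv⟩ ⟨w, hw⟩
    exact ⟨v + w, by rw [map_add]; exact hv.add hw⟩
  smul_mem' := by
    rintro c x ⟨v, hv⟩
    exact ⟨c • v, by rw [map_smul]; exact hv.smul c⟩

/-- The space `{ (D_{T-}^γ v)(0) : v ∈ G }`, with the norm
`‖x‖ = inf { ‖v‖_G : v ∈ G, (D_{T-}^γ v)(0) = x }`. -/
def TraceSpace (γ : ℝ) : Type := traceSubmodule B T α γ

namespace TraceSpace

variable (γ : ℝ)

instance : AddCommGroup (TraceSpace B T α γ) :=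
  inferInstanceAs (AddCommGroup (traceSubmodule B T α γ))

instance : Module ℝ (TraceSpace B T α γ) :=
  inferInstanceAs (Module ℝ (traceSubmodule B T α γ))

variable {B T α γ}

/-- The inclusion in `L²(Ω)`. -/
def toL2 : TraceSpace B T α γ →ₗ[ℝ] SpaceL2 Ω := (traceSubmodule B T α γ).subtype

instance : Norm (TraceSpace B T α γ) :=
  ⟨fun x => ⨅ v : {v : GSpace B T α // HasRightRLTrace T γ v.toL2 x.toL2}, ‖(v : GSpace B T α)‖⟩

theorem norm_def (x : TraceSpace B T α γ) :
    ‖x‖ = ⨅ v : {v : GSpace B T α // HasRightRLTrace T γ v.toL2 x.toL2}, ‖(v : GSpace B T α)‖ :=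
  rfl

theorem nonempty_lift (x : TraceSpace B T α γ) :
    Nonempty {v : GSpace B T α // HasRightRLTrace T γ v.toL2 x.toL2} :=
  let ⟨v, hv⟩ := x.2
  ⟨⟨v, hv⟩⟩

theorem norm_le {x : TraceSpace B T α γ} {v : GSpace B T α}
    (hv : HasRightRLTrace T γ v.toL2 x.toL2) : ‖x‖ ≤ ‖v‖ :=
  ciInf_le (f := fun v : {v : GSpace B T α // HasRightRLTrace T γ v.toL2 x.toL2} =>
    ‖(v : GSpace B T α)‖) ⟨0, by rintro _ ⟨w, rfl⟩; exact norm_nonneg _⟩ ⟨v, hv⟩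

theorem norm_smul_le (c : ℝ) (x : TraceSpace B T α γ) : ‖c • x‖ ≤ ‖c‖ * ‖x‖ := by
  have := nonempty_lift x
  rw [norm_def x, Real.mul_iInf_of_nonneg (_root_.norm_nonneg c)]
  refine le_ciInf fun v => ?_
  refine (norm_le (v := c • v.1) ?_).trans (norm_smul c v.1).le
  rw [map_smul, map_smul]
  exact v.2.smul c

theorem normCore : SeminormedSpace.Core ℝ (TraceSpace B T α γ) where
  norm_nonneg x := Real.iInf_nonneg fun v => norm_nonneg _
  norm_smul c x := by
    refine le_antisymm (norm_smul_le c x) ?_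
    rcases eq_or_ne c 0 with rfl | hc
    · rw [norm_zero, zero_mul]
      exact Real.iInf_nonneg fun v => norm_nonneg _
    · have h1 := norm_smul_le c⁻¹ (c • x)
      rw [smul_smul, inv_mul_cancel₀ hc, one_smul] at h1
      calc ‖c‖ * ‖x‖ ≤ ‖c‖ * (‖c⁻¹‖ * ‖c • x‖) := by gcongr
        _ = ‖c • x‖ := by
          rw [← mul_assoc, ← norm_mul, mul_inv_cancel₀ hc]; simp
  norm_triangle x y := by
    have := nonempty_lift x
    have := nonempty_lift y
    rw [norm_def x, norm_def y]
    refine le_ciInf_add_ciInf fun v w => ?_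
    refine (norm_le (v := v.1 + w.1) ?_).trans (norm_add_le _ _)
    rw [map_add, map_add]
    exact v.2.add w.2

instance : SeminormedAddCommGroup (TraceSpace B T α γ) := SeminormedAddCommGroup.ofCore normCore

instance : NormedSpace ℝ (TraceSpace B T α γ) where
  norm_smul_le c v := (normCore.norm_smul c v).le

end TraceSpace

/-- `G₀`, the space of the values `(D_{T-}^{α-1} v)(0)`, `v ∈ G`. -/
abbrev G0Space : Type := TraceSpace B T α (α - 1)

/-- `G₁`, the space of the values `(D_{T-}^{α-2} v)(0)`, `v ∈ G`. -/
abbrev G1Space : Type := TraceSpace B T α (α - 2)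

variable {B T α}

/-- `u ∈ L²(0,T;L²(Ω))` is a weak solution in the sense of transposition: for all `v ∈ G`,
`⟨u, D_{T-}^α v - Δ v⟩_{Ω × (0,T)} =
  ⟨f, v⟩_G + ⟨u₀, (D_{T-}^{α-1} v)(0)⟩_{G₀} + ⟨u₁, (D_{T-}^{α-2} v)(0)⟩_{G₁}`.
Here `w = D_{T-}^α v`, `z = Δ v`, `x₀ = (D_{T-}^{α-1} v)(0)` and `x₁ = (D_{T-}^{α-2} v)(0)`; each of
them is uniquely determined by `v`, and their existence is part of the assertion. -/
def IsWeakSolution (f : StrongDual ℝ (GSpace B T α)) (u₀ : StrongDual ℝ (G0Space B T α))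
    (u₁ : StrongDual ℝ (G1Space B T α)) (u : BochnerL2 T (SpaceL2 Ω)) : Prop :=
  ∀ v : GSpace B T α, ∃ (w z : BochnerL2 T (SpaceL2 Ω)) (x₀ : G0Space B T α)
    (x₁ : G1Space B T α),
    IsRightRL T α v.toL2 w ∧
    (∀ᵐ t ∂(volume.restrict (Ioo 0 T)), IsWeakLaplacian (v.toL2 t) (z t)) ∧
    HasRightRLTrace T (α - 1) v.toL2 x₀.toL2 ∧
    HasRightRLTrace T (α - 2) v.toL2 x₁.toL2 ∧
    ∫ t in Ioo 0 T, (∫ x in (Ω : Set (EuclideanSpace ℝ (Fin d))), u t x * (w t x - z t x)) =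
      f v + u₀ x₀ + u₁ x₁

end Spaces

end FracWave

end

open MeasureTheory Set TopologicalSpace
open scoped ENNReal

noncomputable section

namespace FracWave

open scoped RealInnerProductSpace ContDiff
open Filter Topology

/-! Write `I^γ` for the right-sided fractional integral on `(0,T)`. The theorem rests on one fact:
the map `v ↦ D_{T-}^α v - Δv` sends `G` onto `L²(0,T;L²(Ω))`, and `‖v‖_G ≤ C_α ‖D_{T-}^α v - Δv‖`.
The right-hand side of the weak equation is at most `(‖f‖ + ‖u₀‖ + ‖u₁‖) ‖v‖_G`, because the trace
norms are quotient norms of `‖·‖_G`. It is therefore a bounded functional of `g = D_{T-}^α v - Δv`,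
and the Riesz theorem gives existence, uniqueness and the estimate at once
(`exists_inner_eq_of_relation`).

In the eigenbasis the fact splits into scalar problems `h + λ I^α h = g` with `λ > 0`, where `I^α h`
is a coefficient of `v`. Two ingredients are needed, with constants independent of `λ` and `T`.

The first is the resolvent estimate `‖h‖ ≤ R ‖h + λ I^α h‖` (`norm_le_norm_add_fracInt`). With `β =
α/2 < 1` the numerical range of `I^β` on the complexified space lies in a sector of half-angle
strictly below `π/2` (`sectorial`). Since `1 + λ I^{2β} = (1 + iμ I^β)(1 - iμ I^β)` with `μ² = λ`,
and the imaginary axis avoids the sector, the estimate follows. The same bound for the adjoint gives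
solvability.

The second is the identification of `⁰H^α(0,T)` with the range of `I^α`. Let `V = I^1`, let `D` here
be its inverse, and put `P_t = (1 + tD)⁻¹`, `Q_t = tD(1 + tD)⁻¹`. As `⁰H¹` and `⁰H²` are the ranges
of `V` and `V²`, the functional `K(t, Vg)` is comparable to `‖Q_t g‖`, so the interpolation norm of
`Vg` is comparable to a square function of `g`. Elements `I^θ h` have finite square function by a
Calderón reproducing formula and a Schur test (`sqFun_fracInt_le`). Conversely, a finite square
function forces `g = I^θ h` by duality (`exists_fracInt_eq_of_sqFun_le`). Only the first direction
enters the final constant.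

All of this uses only that truncated translations form a nilpotent semigroup of contractions whose
adjoints are the opposite translations. The argument is therefore carried out for such abstract
semigroups, and its constants do not involve `T`. -/

/-- Compressions of a strongly continuous unitary group that form a nilpotent semigroup. -/
structure NilpotentShift (H : Type*) [NormedAddCommGroup H] [InnerProductSpace ℝ H] (T : ℝ) where
  S : ℝ → H →L[ℝ] H
  norm_le : ∀ x h, ‖S x h‖ ≤ ‖h‖
  zero : ∀ h, S 0 h = h
  add : ∀ x y, 0 ≤ x → 0 ≤ y → ∀ h, S (x + y) h = S x (S y h)
  eq_zero : ∀ x, T ≤ |x| → ∀ h, S x h = 0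
  continuous : ∀ h, Continuous fun x => S x h
  inner_left : ∀ x h g, ⟪S x h, g⟫ = ⟪h, S (-x) g⟫

/-! ### Convolution kernels as operators -/

namespace NilpotentShift

set_option linter.unusedSectionVars false

variable {H : Type*} [NormedAddCommGroup H] [InnerProductSpace ℝ H] {T : ℝ}

/-- The adjoint semigroup. -/
def dual (𝒮 : NilpotentShift H T) : NilpotentShift H T where
  S x := 𝒮.S (-x)
  norm_le x := 𝒮.norm_le (-x)
  zero h := by rw [neg_zero, 𝒮.zero]
  add x y hx hy h := by
    refine ext_inner_left ℝ fun g => ?_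
    -- Adjoints multiply in reversed order, hence the semigroup law is used for `y + x`.
    rw [← 𝒮.inner_left, ← 𝒮.inner_left, ← 𝒮.inner_left, add_comm, 𝒮.add y x hy hx]
  eq_zero x hx := 𝒮.eq_zero (-x) (by rwa [abs_neg])
  continuous h := (𝒮.continuous h).comp continuous_neg
  inner_left x := 𝒮.inner_left (-x)

theorem abs_inner_le (𝒮 : NilpotentShift H T) (x : ℝ) (h g : H) :
    |⟪𝒮.S x h, g⟫| ≤ ‖h‖ * ‖g‖ :=
  (abs_real_inner_le_norm _ _).trans (by gcongr; exact 𝒮.norm_le x h)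

theorem continuous_inner (𝒮 : NilpotentShift H T) (h g : H) :
    Continuous fun x => ⟪𝒮.S x h, g⟫ := (𝒮.continuous h).inner continuous_const

variable {k l m : ℝ → ℝ}

theorem integrableOn_smul (𝒮 : NilpotentShift H T) (hk : IntegrableOn k (Ioo 0 T)) (h : H) :
    IntegrableOn (fun x => k x • 𝒮.S x h) (Ioo 0 T) :=
  Integrable.smul_bdd hk ‖h‖ (𝒮.continuous h).aestronglyMeasurable
    (Filter.Eventually.of_forall fun x => 𝒮.norm_le x h)

theorem integrableOn_mul_inner (𝒮 : NilpotentShift H T) (hk : IntegrableOn k (Ioo 0 T))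
    (h g : H) : IntegrableOn (fun x => k x * ⟪𝒮.S x h, g⟫) (Ioo 0 T) :=
  Integrable.mul_bdd (c := ‖h‖ * ‖g‖) hk (𝒮.continuous_inner h g).aestronglyMeasurable
    (Filter.Eventually.of_forall fun x => 𝒮.abs_inner_le x h g)

variable [CompleteSpace H]

open Classical in
/-- The operator `∫_0^T k(x) S(x) dx`. -/
def kernelOp (𝒮 : NilpotentShift H T) (k : ℝ → ℝ) : H →L[ℝ] H :=
  if hk : IntegrableOn k (Ioo 0 T) then
    LinearMap.mkContinuous
      { toFun := fun h => ∫ x in Ioo 0 T, k x • 𝒮.S x h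
        map_add' := fun h g => by
          simp only [map_add, smul_add]
          exact integral_add (𝒮.integrableOn_smul hk h) (𝒮.integrableOn_smul hk g)
        map_smul' := fun c h => by
          simp only [map_smul, smul_comm _ c, RingHom.id_apply]
          exact integral_smul c _ }
      (∫ x in Ioo 0 T, ‖k x‖) fun h => by
        refine (norm_integral_le_integral_norm _).trans ?_
        rw [← integral_mul_const]
        refine integral_mono (𝒮.integrableOn_smul hk h).norm (hk.norm.mul_const _) fun x => ?_
        rw [norm_smul]
        gcongr
        exact 𝒮.norm_le x h
  else 0

theorem kernelOp_apply (𝒮 : NilpotentShift H T) (hk : IntegrableOn k (Ioo 0 T)) (h : H) :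
    𝒮.kernelOp k h = ∫ x in Ioo 0 T, k x • 𝒮.S x h := by
  rw [kernelOp, dif_pos hk]
  rfl

theorem inner_kernelOp (𝒮 : NilpotentShift H T) (hk : IntegrableOn k (Ioo 0 T)) (h g : H) :
    ⟪𝒮.kernelOp k h, g⟫ = ∫ x in Ioo 0 T, k x * ⟪𝒮.S x h, g⟫ := by
  rw [𝒮.kernelOp_apply hk, real_inner_comm, ← integral_inner (𝒮.integrableOn_smul hk h)]
  simp only [inner_smul_right, real_inner_comm]

theorem inner_kernelOp_left (𝒮 : NilpotentShift H T) (hk : IntegrableOn k (Ioo 0 T)) (h g : H) :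
    ⟪𝒮.kernelOp k h, g⟫ = ⟪h, 𝒮.dual.kernelOp k g⟫ := by
  rw [𝒮.inner_kernelOp hk, real_inner_comm, 𝒮.dual.inner_kernelOp hk]
  refine integral_congr_ae (Filter.Eventually.of_forall fun x => ?_)
  simp only [dual]
  rw [𝒮.inner_left, real_inner_comm]

theorem kernelOp_add (𝒮 : NilpotentShift H T) (hk : IntegrableOn k (Ioo 0 T))
    (hl : IntegrableOn l (Ioo 0 T)) :
    𝒮.kernelOp (fun x => k x + l x) = 𝒮.kernelOp k + 𝒮.kernelOp l := by
  ext h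
  rw [add_apply, 𝒮.kernelOp_apply hk, 𝒮.kernelOp_apply hl,
    𝒮.kernelOp_apply (k := fun x => k x + l x) (hk.add hl),
    ← integral_add (𝒮.integrableOn_smul hk h) (𝒮.integrableOn_smul hl h)]
  simp only [add_smul]

theorem kernelOp_const_mul (𝒮 : NilpotentShift H T) (c : ℝ) (hk : IntegrableOn k (Ioo 0 T)) :
    𝒮.kernelOp (fun x => c * k x) = c • 𝒮.kernelOp k := by
  ext h
  rw [smul_apply, 𝒮.kernelOp_apply hk, 𝒮.kernelOp_apply (hk.const_mul c),
    ← integral_smul]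
  simp only [smul_smul]

/-- Fubini and `S(x) S(z - x) = S(z)` turn composition of operators into convolution of kernels. The
convolution matters only on `(0,T)`, since `S` vanishes from `T` on. This is the engine behind every
operator identity below. -/
theorem kernelOp_kernelOp (𝒮 : NilpotentShift H T) (hk : IntegrableOn k (Ioo 0 T))
    (hl : IntegrableOn l (Ioo 0 T))
    (hm : ∀ z ∈ Ioo 0 T, m z = ∫ x in Ioo 0 z, k x * l (z - x)) (h : H) :
    𝒮.kernelOp k (𝒮.kernelOp l h) = 𝒮.kernelOp m h := by
  have hk' : Integrable ((Ioo 0 T).indicator k) := (integrable_indicator_iff measurableSet_Ioo).2 hk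
  have hl' : Integrable ((Ioo 0 T).indicator l) := (integrable_indicator_iff measurableSet_Ioo).2 hl
  set K := (Ioo 0 T).indicator k with hK
  set M := (Ioo 0 T).indicator l with hM
  have hint := hk'.convolution_integrand (ContinuousLinearMap.mul ℝ ℝ) hl'
  simp only [ContinuousLinearMap.mul_apply'] at hint
  have hconv : ∀ z ∈ Ioo 0 T, ∫ x, K x * M (z - x) = m z := by
    intro z hz
    rw [hm z hz, ← integral_indicator measurableSet_Ioo]
    refine integral_congr_ae ?_
    filter_upwards [Measure.ae_ne volume z] with x hxz
    by_cases hx : x ∈ Ioo 0 z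
    · have h1 : x ∈ Ioo 0 T := ⟨hx.1, hx.2.trans hz.2⟩
      have h2 : z - x ∈ Ioo 0 T := ⟨by linarith [hx.2], by linarith [hx.1, hz.2]⟩
      simp [K, M, indicator_of_mem, h1, h2, hx]
    · rw [indicator_of_notMem hx]
      rcases not_and_or.1 hx with h1 | h1
      · rw [hK, indicator_of_notMem (fun h => h1 h.1), zero_mul]
      · have : z - x ∉ Ioo 0 T := fun h => h1 (by linarith [h.1])
        rw [hM, indicator_of_notMem this, mul_zero]
  have hmi : IntegrableOn m (Ioo 0 T) := by
    refine (hint.integral_prod_left.integrableOn (s := Ioo 0 T)).congr_fun (fun z hz => ?_)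
      measurableSet_Ioo
    exact hconv z hz
  refine ext_inner_right ℝ fun g => ?_
  set a : ℝ → ℝ := fun x => ⟪𝒮.S x h, g⟫ with ha
  have hac : Continuous a := 𝒮.continuous_inner h g
  have hab : ∀ x, ‖a x‖ ≤ ‖h‖ * ‖g‖ := fun x => 𝒮.abs_inner_le x h g
  -- Nilpotency: the part of the convolution living beyond `T` is multiplied by zero.
  have haT : ∀ x, T ≤ x → a x = 0 := fun x hx => by
    simp only [ha, 𝒮.eq_zero x (hx.trans (le_abs_self x)), inner_zero_left]
  have hint2 : Integrable (fun p : ℝ × ℝ => K p.2 * M (p.1 - p.2) * a p.1)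
      (volume.prod volume) :=
    Integrable.mul_bdd (c := ‖h‖ * ‖g‖) hint (hac.comp continuous_fst).aestronglyMeasurable
      (Filter.Eventually.of_forall fun p => hab p.1)
  have step1 : ⟪𝒮.kernelOp k (𝒮.kernelOp l h), g⟫ =
      ∫ x, ∫ z, K x * M (z - x) * a z := by
    rw [𝒮.inner_kernelOp hk, ← integral_indicator measurableSet_Ioo]
    refine integral_congr_ae (Filter.Eventually.of_forall fun x => ?_)
    by_cases hx : x ∈ Ioo 0 T
    · simp only [indicator_of_mem hx]
      rw [𝒮.inner_left, 𝒮.inner_kernelOp hl, ← integral_indicator measurableSet_Ioo,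
        ← integral_const_mul, ← integral_sub_right_eq_self _ x]
      refine integral_congr_ae (Filter.Eventually.of_forall fun z => ?_)
      by_cases hz : z - x ∈ Ioo 0 T
      · simp only [K, M, indicator_of_mem hx, indicator_of_mem hz]
        rw [← 𝒮.inner_left, ← 𝒮.add x (z - x) hx.1.le hz.1.le, add_sub_cancel, mul_assoc]
      · simp only [K, M, indicator_of_notMem hz]
        ring
    · simp [K, indicator_of_notMem hx]
  rw [step1, 𝒮.inner_kernelOp hmi, integral_integral_swap (f := fun x z => K x * M (z - x) * a z) hint2.swap]
  rw [← integral_indicator measurableSet_Ioo]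
  refine integral_congr_ae ?_
  filter_upwards [Measure.ae_ne volume 0] with z hz0
  rw [integral_mul_const]
  by_cases hz : z ∈ Ioo 0 T
  · rw [indicator_of_mem hz, hconv z hz]
  · rw [indicator_of_notMem hz]
    rcases not_and_or.1 hz with h1 | h1
    · have : ∀ x, K x * M (z - x) = 0 := fun x => by
        by_cases hx : x ∈ Ioo 0 T
        · rw [hM, indicator_of_notMem (fun h => h1 (by linarith [h.1, hx.1])), mul_zero]
        · rw [hK, indicator_of_notMem hx, zero_mul]
      simp [this]
    · rw [haT z (not_lt.1 h1), mul_zero]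

end NilpotentShift

/-! ### The Beta integral and an accretivity criterion -/

theorem integrableOn_rpow_sub_one {a : ℝ} (ha : 0 < a) (T : ℝ) :
    IntegrableOn (fun x : ℝ => x ^ (a - 1)) (Ioo 0 T) := by
  rcases le_or_gt T 0 with hT | hT
  · rw [Ioo_eq_empty (by linarith)]
    exact integrableOn_empty
  · have h1 : IntervalIntegrable (fun x : ℝ => x ^ (a - 1)) volume 0 T :=
      intervalIntegral.intervalIntegrable_rpow' (by linarith)
    rwa [intervalIntegrable_iff_integrableOn_Ioo_of_le hT.le] at h1

theorem integral_rpow_mul_rpow_sub {a b z : ℝ} (ha : 0 < a) (hb : 0 < b) (hz : 0 < z) :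
    ∫ x in Ioo 0 z, x ^ (a - 1) * (z - x) ^ (b - 1) =
      z ^ (a + b - 1) * (Real.Gamma a * Real.Gamma b / Real.Gamma (a + b)) := by
  have h1 := Complex.betaIntegral_scaled (a : ℂ) (b : ℂ) hz
  have h2 := Complex.Gamma_mul_Gamma_eq_betaIntegral (s := (a : ℂ)) (t := (b : ℂ))
    (by simpa using ha) (by simpa using hb)
  have h3 : Complex.Gamma ((a : ℂ) + b) ≠ 0 :=
    Complex.Gamma_ne_zero_of_re_pos (by simpa using add_pos ha hb)
  have h4 : Complex.betaIntegral a b =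
      ((Real.Gamma a * Real.Gamma b / Real.Gamma (a + b) : ℝ) : ℂ) := by
    push_cast [← Complex.Gamma_ofReal]
    rw [eq_div_iff h3, mul_comm, ← h2]
  rw [h4, intervalIntegral.integral_of_le hz.le, integral_Ioc_eq_integral_Ioo] at h1
  apply Complex.ofReal_injective
  rw [← integral_complex_ofReal]
  convert h1 using 1
  · refine setIntegral_congr_fun measurableSet_Ioo fun x hx => ?_
    simp only [Complex.ofReal_mul]
    rw [← Complex.ofReal_sub, ← Complex.ofReal_one, ← Complex.ofReal_sub, ← Complex.ofReal_sub,
      ← Complex.ofReal_cpow hx.1.le, ← Complex.ofReal_cpow (by linarith [hx.2])]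
  · rw [Complex.ofReal_mul, Complex.ofReal_cpow hz.le]
    push_cast
    rfl

theorem integral_Ioi_eq_integral_Ioi_zero {E : Type*} [NormedAddCommGroup E] [NormedSpace ℝ E]
    (f : ℝ → E) (x : ℝ) : ∫ y in Ioi x, f y = ∫ y in Ioi 0, f (x + y) := by
  rw [← integral_indicator measurableSet_Ioi, ← integral_indicator measurableSet_Ioi,
    ← integral_add_left_eq_self _ x]
  refine integral_congr_ae (Eventually.of_forall fun y => ?_)
  by_cases hy : 0 < y
  · simp [indicator, hy]
  · simp [indicator, hy]

/-- The energy of the tails from `x` on is largest at `x = 0`, so its right derivative there is at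
most zero, and that derivative is minus twice the expression in question. Two components are carried
so that the criterion also serves real and imaginary parts in a complexified space. -/
theorem inner_integral_Ioi_nonneg {H : Type*} [NormedAddCommGroup H] [InnerProductSpace ℝ H]
    [CompleteSpace H] {f₁ f₂ : ℝ → H} (h₁ : Continuous f₁) (h₂ : Continuous f₂)
    (i₁ : IntegrableOn f₁ (Ioi 0)) (i₂ : IntegrableOn f₂ (Ioi 0))
    (hle : ∀ x > 0, ‖∫ y in Ioi x, f₁ y‖ ^ 2 + ‖∫ y in Ioi x, f₂ y‖ ^ 2 ≤
      ‖∫ y in Ioi 0, f₁ y‖ ^ 2 + ‖∫ y in Ioi 0, f₂ y‖ ^ 2) :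
    0 ≤ ⟪∫ y in Ioi 0, f₁ y, f₁ 0⟫ + ⟪∫ y in Ioi 0, f₂ y, f₂ 0⟫ := by
  set w₁ := ∫ y in Ioi 0, f₁ y
  set w₂ := ∫ y in Ioi 0, f₂ y
  have key : ∀ f : ℝ → H, Continuous f → IntegrableOn f (Ioi 0) → ∀ x > 0,
      ∫ y in Ioi x, f y = (∫ y in Ioi 0, f y) - ∫ y in (0 : ℝ)..x, f y := by
    intro f hf hi x hx
    rw [intervalIntegral.integral_of_le hx.le, eq_sub_iff_add_eq, add_comm,
      ← setIntegral_union Ioc_disjoint_Ioi_same measurableSet_Ioi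
        (hi.mono_set Ioc_subset_Ioi_self) (hi.mono_set (Ioi_subset_Ioi hx.le)),
      Ioc_union_Ioi_eq_Ioi hx.le]
  have hd : ∀ f : ℝ → H, Continuous f → ∀ w : H,
      HasDerivAt (fun x => ‖w - ∫ y in (0 : ℝ)..x, f y‖ ^ 2) (-(2 * ⟪w, f 0⟫)) 0 := by
    intro f hf w
    have h := ((hf.integral_hasStrictDerivAt 0 0).hasDerivAt.const_sub w).norm_sq
    convert h using 1
    simp
  have hD := (hd f₁ h₁ w₁).add (hd f₂ h₂ w₂)
  rw [hasDerivAt_iff_tendsto_slope] at hD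
  have hD' := hD.mono_left (nhdsWithin_mono 0 (fun x hx => ne_of_gt hx : Ioi (0 : ℝ) ⊆ {0}ᶜ))
  have : -(2 * ⟪w₁, f₁ 0⟫) + -(2 * ⟪w₂, f₂ 0⟫) ≤ 0 := by
    refine le_of_tendsto hD' ?_
    filter_upwards [self_mem_nhdsWithin] with x hx
    have hx' : (0 : ℝ) < x := hx
    have h := hle x hx
    rw [key f₁ h₁ i₁ x hx, key f₂ h₂ i₂ x hx] at h
    rw [slope_def_field]
    refine div_nonpos_of_nonpos_of_nonneg ?_ (by linarith)
    simp only [Pi.add_apply, intervalIntegral.integral_same, sub_zero]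
    linarith
  linarith

/-! ### Fractional integrals and resolvents of the generator -/

namespace NilpotentShift

set_option linter.unusedSectionVars false

variable {H : Type*} [NormedAddCommGroup H] [InnerProductSpace ℝ H] {T : ℝ} [CompleteSpace H]
  (𝒮 : NilpotentShift H T)

theorem kernelOp_comm {k l : ℝ → ℝ} (hk : IntegrableOn k (Ioo 0 T))
    (hl : IntegrableOn l (Ioo 0 T)) (h : H) :
    𝒮.kernelOp k (𝒮.kernelOp l h) = 𝒮.kernelOp l (𝒮.kernelOp k h) := by
  rw [𝒮.kernelOp_kernelOp hk hl (m := fun z => ∫ x in Ioo 0 z, k x * l (z - x))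
    (fun z _ => rfl), 𝒮.kernelOp_kernelOp hl hk]
  intro z hz
  rw [← integral_Ioc_eq_integral_Ioo, ← integral_Ioc_eq_integral_Ioo,
    ← intervalIntegral.integral_of_le hz.1.le, ← intervalIntegral.integral_of_le hz.1.le]
  have := intervalIntegral.integral_comp_sub_left (a := 0) (b := z)
    (fun x => l x * k (z - x)) z
  simp only [sub_sub_cancel, sub_self, sub_zero] at this
  rw [← this]
  exact intervalIntegral.integral_congr fun x _ => mul_comm _ _

/-- The fractional integral `∫_0^T x^{a-1} / Γ(a) S(x) dx` of order `a > 0`. -/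
def fracInt (a : ℝ) : H →L[ℝ] H := 𝒮.kernelOp fun x => x ^ (a - 1) / Real.Gamma a

theorem integrableOn_fracKernel {a : ℝ} (ha : 0 < a) (T : ℝ) :
    IntegrableOn (fun x : ℝ => x ^ (a - 1) / Real.Gamma a) (Ioo 0 T) :=
  (integrableOn_rpow_sub_one ha T).div_const _

/-- The normalised power kernels form a convolution semigroup by the Beta integral. -/
theorem fracInt_fracInt {a b : ℝ} (ha : 0 < a) (hb : 0 < b) (h : H) :
    𝒮.fracInt a (𝒮.fracInt b h) = 𝒮.fracInt (a + b) h := by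
  refine 𝒮.kernelOp_kernelOp (integrableOn_fracKernel ha T) (integrableOn_fracKernel hb T)
    (fun z hz => ?_) h
  have h1 : ∀ x : ℝ, x ^ (a - 1) / Real.Gamma a * ((z - x) ^ (b - 1) / Real.Gamma b) =
      (Real.Gamma a * Real.Gamma b)⁻¹ * (x ^ (a - 1) * (z - x) ^ (b - 1)) := fun x => by
    field_simp
  simp only [h1]
  rw [integral_const_mul, integral_rpow_mul_rpow_sub ha hb hz.1]
  have := (Real.Gamma_pos_of_pos ha).ne'
  have := (Real.Gamma_pos_of_pos hb).ne'
  field_simp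

theorem inner_fracInt_left {a : ℝ} (ha : 0 < a) (h g : H) :
    ⟪𝒮.fracInt a h, g⟫ = ⟪h, 𝒮.dual.fracInt a g⟫ :=
  𝒮.inner_kernelOp_left (integrableOn_fracKernel ha T) h g

/-- `(1 + t D)⁻¹`, where `D` is the inverse of `fracInt 1`. -/
def resP (t : ℝ) : H →L[ℝ] H := 𝒮.kernelOp fun x => t⁻¹ * Real.exp (-x / t)

/-- `t D (1 + t D)⁻¹`, where `D` is the inverse of `fracInt 1`. -/
def resQ (t : ℝ) : H →L[ℝ] H := 1 - 𝒮.resP t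

theorem integrableOn_of_continuous {k : ℝ → ℝ} (hk : Continuous k) (T : ℝ) :
    IntegrableOn k (Ioo 0 T) :=
  hk.integrableOn_Icc.mono_set Ioo_subset_Icc_self

theorem integrableOn_expKernel (t T : ℝ) :
    IntegrableOn (fun x : ℝ => t⁻¹ * Real.exp (-x / t)) (Ioo 0 T) :=
  integrableOn_of_continuous (by fun_prop) T

theorem resP_comm (s t : ℝ) (h : H) : 𝒮.resP s (𝒮.resP t h) = 𝒮.resP t (𝒮.resP s h) :=
  𝒮.kernelOp_comm (integrableOn_expKernel s T) (integrableOn_expKernel t T) h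

theorem resP_fracInt {a : ℝ} (ha : 0 < a) (t : ℝ) (h : H) :
    𝒮.resP t (𝒮.fracInt a h) = 𝒮.fracInt a (𝒮.resP t h) :=
  𝒮.kernelOp_comm (integrableOn_expKernel t T) (integrableOn_fracKernel ha T) h

theorem resQ_apply (t : ℝ) (h : H) : 𝒮.resQ t h = h - 𝒮.resP t h := rfl

theorem resQ_comm (s t : ℝ) (h : H) : 𝒮.resQ s (𝒮.resQ t h) = 𝒮.resQ t (𝒮.resQ s h) := by
  simp only [resQ_apply, map_sub, 𝒮.resP_comm s t]
  abel

theorem resP_resQ (s t : ℝ) (h : H) : 𝒮.resP s (𝒮.resQ t h) = 𝒮.resQ t (𝒮.resP s h) := by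
  simp only [resQ_apply, map_sub, 𝒮.resP_comm s t]

theorem resQ_fracInt {a : ℝ} (ha : 0 < a) (t : ℝ) (h : H) :
    𝒮.resQ t (𝒮.fracInt a h) = 𝒮.fracInt a (𝒮.resQ t h) := by
  simp only [resQ_apply, map_sub, 𝒮.resP_fracInt ha]

/-- Convolving the exponential kernel with the constant kernel `1` gives `1 - exp (-z/t)`. In terms
of the generator this says `V · tD(1 + tD)⁻¹ = t (1 + tD)⁻¹`; it is the only link between `V` and
the resolvents that is used later. -/
theorem fracInt_one_resQ {t : ℝ} (ht : 0 < t) (h : H) :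
    𝒮.fracInt 1 (𝒮.resQ t h) = t • 𝒮.resP t h := by
  have hV : IntegrableOn (fun x : ℝ => x ^ ((1 : ℝ) - 1) / Real.Gamma 1) (Ioo 0 T) :=
    integrableOn_fracKernel one_pos T
  have h1 : 𝒮.fracInt 1 (𝒮.resP t h) =
      𝒮.kernelOp (fun z => z ^ ((1 : ℝ) - 1) / Real.Gamma 1 +
        (-t) * (t⁻¹ * Real.exp (-z / t))) h := by
    refine 𝒮.kernelOp_kernelOp hV (integrableOn_expKernel t T) (fun z hz => ?_) h
    have hd : ∀ x ∈ uIcc 0 z, HasDerivAt (fun x => Real.exp (-(z - x) / t))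
        (t⁻¹ * Real.exp (-(z - x) / t)) x := by
      intro x _
      have : HasDerivAt (fun x : ℝ => -(z - x) / t) t⁻¹ x := by
        have := (((hasDerivAt_id x).const_sub z).neg).div_const t
        simpa using this
      simpa [mul_comm] using this.exp
    have := intervalIntegral.integral_eq_sub_of_hasDerivAt hd
      (Continuous.intervalIntegrable (by fun_prop) _ _)
    rw [intervalIntegral.integral_of_le hz.1.le, integral_Ioc_eq_integral_Ioo] at this
    simp only [sub_self, Real.rpow_zero, Real.Gamma_one, div_one, one_mul]
    rw [this]
    field_simp
    simp
    ring
  rw [resQ_apply, map_sub, h1, 𝒮.kernelOp_add hV ((integrableOn_expKernel t T).const_mul _),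
    𝒮.kernelOp_const_mul _ (integrableOn_expKernel t T)]
  simp [fracInt, resP]

theorem integrableOn_S (h : H) : IntegrableOn (fun x => 𝒮.S x h) (Ioi 0) := by
  have h1 : IntegrableOn (fun x => 𝒮.S x h) (Ioc 0 (max T 0)) :=
    ((𝒮.continuous h).integrableOn_Icc).mono_set Ioc_subset_Icc_self
  have h2 : IntegrableOn (fun x => 𝒮.S x h) (Ioi (max T 0)) := by
    refine integrableOn_zero.congr_fun (fun x hx => ?_) measurableSet_Ioi
    exact (𝒮.eq_zero x (le_trans (le_trans (le_max_left _ _) (le_of_lt hx)) (le_abs_self x)) h).symm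
  have := h1.union h2
  rwa [Ioc_union_Ioi_eq_Ioi (le_max_right _ _)] at this

theorem setIntegral_Ioo_eq_Ioi {k : ℝ → ℝ} (h : H) :
    ∫ x in Ioo 0 T, k x • 𝒮.S x h = ∫ x in Ioi 0, k x • 𝒮.S x h := by
  refine (setIntegral_eq_of_subset_of_forall_sdiff_eq_zero measurableSet_Ioi
    Ioo_subset_Ioi_self fun x hx => ?_).symm
  have : T ≤ x := by
    by_contra hlt
    exact hx.2 ⟨hx.1, not_le.1 hlt⟩
  rw [𝒮.eq_zero x (this.trans (le_abs_self x)), smul_zero]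

theorem fracInt_one_apply (h : H) : 𝒮.fracInt 1 h = ∫ x in Ioi 0, 𝒮.S x h := by
  rw [fracInt, 𝒮.kernelOp_apply (integrableOn_fracKernel one_pos T), 𝒮.setIntegral_Ioo_eq_Ioi]
  simp

/-- The tail of the orbit from `x` on is `S x` applied to the whole integral, so contractivity makes
its norm at most that of the whole. -/
theorem inner_fracInt_one_nonneg (h : H) : 0 ≤ ⟪𝒮.fracInt 1 h, h⟫ := by
  have := inner_integral_Ioi_nonneg (𝒮.continuous h) (continuous_const (y := (0 : H)))
    (𝒮.integrableOn_S h) integrableOn_zero (fun x hx => ?_)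
  · rw [𝒮.zero] at this
    simpa [fracInt_one_apply] using this
  · simp only [integral_zero, norm_zero]
    gcongr
    have : ∫ y in Ioi x, 𝒮.S y h = 𝒮.S x (∫ y in Ioi 0, 𝒮.S y h) := by
      rw [← ContinuousLinearMap.integral_comp_comm _ (𝒮.integrableOn_S h)]
      rw [integral_Ioi_eq_integral_Ioi_zero]
      refine setIntegral_congr_fun measurableSet_Ioi fun y hy => ?_
      exact 𝒮.add x y hx.le (le_of_lt hy) h
    rw [this]
    exact 𝒮.norm_le x _

/-- `h = P_t h + Q_t h` and the cross term is nonnegative, because `t P_t h = V (Q_t h)` and `V` is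
accretive. -/
theorem norm_sq_resP_add_le {t : ℝ} (ht : 0 < t) (h : H) :
    ‖𝒮.resP t h‖ ^ 2 + ‖𝒮.resQ t h‖ ^ 2 ≤ ‖h‖ ^ 2 := by
  have h1 : h = 𝒮.resP t h + 𝒮.resQ t h := by rw [resQ_apply]; abel
  have h2 : 0 ≤ ⟪𝒮.resP t h, 𝒮.resQ t h⟫ := by
    have h3 := 𝒮.inner_fracInt_one_nonneg (𝒮.resQ t h)
    rw [𝒮.fracInt_one_resQ ht, inner_smul_left] at h3
    exact nonneg_of_mul_nonneg_right h3 ht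
  conv_rhs => rw [h1, norm_add_sq_real]
  linarith

theorem norm_resP_le {t : ℝ} (ht : 0 < t) (h : H) : ‖𝒮.resP t h‖ ≤ ‖h‖ := by
  have := 𝒮.norm_sq_resP_add_le ht h
  exact (sq_le_sq₀ (norm_nonneg _) (norm_nonneg _)).1 (by nlinarith [sq_nonneg ‖𝒮.resQ t h‖])

theorem norm_resQ_le {t : ℝ} (ht : 0 < t) (h : H) : ‖𝒮.resQ t h‖ ≤ ‖h‖ := by
  have := 𝒮.norm_sq_resP_add_le ht h
  exact (sq_le_sq₀ (norm_nonneg _) (norm_nonneg _)).1 (by nlinarith [sq_nonneg ‖𝒮.resP t h‖])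

end NilpotentShift

/-! ### Scalar integrals for the reproducing formula -/

theorem lintegral_Ioi_le_of_forall {f : ℝ → ℝ≥0∞} {C : ℝ≥0∞}
    (h : ∀ a b, 0 < a → a < b → ∫⁻ t in Ioc a b, f t ≤ C) : ∫⁻ t in Ioi 0, f t ≤ C := by
  have hU : Ioi (0 : ℝ) = ⋃ n : ℕ, Ioc (1 / ((n : ℝ) + 2)) ((n : ℝ) + 2) := by
    ext t
    simp only [mem_Ioi, mem_iUnion, mem_Ioc]
    constructor
    · intro ht
      obtain ⟨n, hn⟩ := exists_nat_gt (max t (1 / t))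
      refine ⟨n, ?_, by linarith [le_max_left t (1 / t)]⟩
      rw [one_div_lt (by positivity) ht]
      linarith [le_max_right t (1 / t)]
    · rintro ⟨n, h1, -⟩
      exact lt_trans (by positivity) h1
  have hmono : Monotone fun n : ℕ => Ioc (1 / ((n : ℝ) + 2)) ((n : ℝ) + 2) := by
    intro n m hnm
    have : (n : ℝ) ≤ m := by exact_mod_cast hnm
    exact Ioc_subset_Ioc (by gcongr) (by gcongr)
  rw [hU, setLIntegral_iUnion_of_directed _ hmono.directed_le]
  refine iSup_le fun n => h _ _ (by positivity) ?_
  rw [div_lt_iff₀ (by positivity)]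
  nlinarith [(Nat.cast_nonneg n : (0 : ℝ) ≤ n)]

theorem integrableOn_rpow_mul_exp_neg_mul {a r : ℝ} (ha : 0 < a) (hr : 0 < r) :
    IntegrableOn (fun t : ℝ => t ^ (a - 1) * Real.exp (-(r * t))) (Ioi 0) := by
  -- A non-integrable function has Bochner integral `0`, whereas the known value of this integral is
  -- positive.
  by_contra h
  have h1 := Real.integral_rpow_mul_exp_neg_mul_Ioi ha hr
  rw [integral_undef h] at h1
  have := Real.Gamma_pos_of_pos ha
  have : 0 < (1 / r) ^ a * Real.Gamma a := by positivity
  linarith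

/-- The substitution `s ↦ s⁻¹` reduces this to the Gamma integral. -/
theorem integrableOn_rpow_mul_exp_neg_div {a x : ℝ} (ha : 0 < a) (hx : 0 < x) :
    IntegrableOn (fun s : ℝ => s ^ (-a - 1) * Real.exp (-x / s)) (Ioi 0) := by
  have h1 := (integrableOn_Ioi_comp_rpow_iff (fun t : ℝ => t ^ (a - 1) * Real.exp (-(x * t)))
    (p := -1) (by norm_num)).2 (integrableOn_rpow_mul_exp_neg_mul ha hx)
  refine h1.congr_fun (fun s hs => ?_) measurableSet_Ioi
  have hs' : (0 : ℝ) < s := hs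
  simp only [abs_neg, abs_one, one_mul, smul_eq_mul]
  rw [← mul_assoc, ← Real.rpow_mul hs'.le, ← Real.rpow_add hs', Real.rpow_neg_one]
  congr 2
  · ring
  · ring

theorem integral_rpow_mul_exp_neg_div {a x : ℝ} (ha : 0 < a) (hx : 0 < x) :
    ∫ s in Ioi 0, s ^ (-a - 1) * Real.exp (-x / s) = x ^ (-a) * Real.Gamma a := by
  have h1 := integral_comp_rpow_Ioi (fun t : ℝ => t ^ (a - 1) * Real.exp (-(x * t)))
    (p := -1) (by norm_num)
  rw [Real.integral_rpow_mul_exp_neg_mul_Ioi ha hx] at h1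
  rw [Real.rpow_neg hx.le, ← Real.inv_rpow hx.le, ← one_div, ← h1]
  refine setIntegral_congr_fun measurableSet_Ioi fun s hs => ?_
  have hs' : (0 : ℝ) < s := hs
  simp only [abs_neg, abs_one, one_mul, smul_eq_mul]
  rw [← mul_assoc, ← Real.rpow_mul hs'.le, ← Real.rpow_add hs', Real.rpow_neg_one]
  congr 2
  · ring
  · ring

/-- Integrating out `s` first leaves a Gamma integral times `x^{-(n+1-θ)}`; together with `x^n` this
is the kernel `x^{θ-1}` of the fractional integral. The cases `n = 1, 2` are the kernels of the
second and third powers of the resolvent. -/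
theorem integral_rpow_mul_integral_exp_neg_div {θ T M : ℝ} {a : ℝ → ℝ} (hθ : 0 < θ) (hθ1 : θ < 1)
    (ha : Continuous a) (hM : ∀ x, |a x| ≤ M) {n : ℕ} (hn : 1 ≤ n) :
    IntegrableOn (fun s : ℝ => s ^ (θ - n - 2) *
      ∫ x in Ioo 0 T, x ^ n * Real.exp (-x / s) * a x) (Ioi 0) ∧
    ∫ s in Ioi 0, s ^ (θ - n - 2) * (∫ x in Ioo 0 T, x ^ n * Real.exp (-x / s) * a x) =
      Real.Gamma (n + 1 - θ) * ∫ x in Ioo 0 T, x ^ (θ - 1) * a x := by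
  have hn' : (1 : ℝ) ≤ n := by exact_mod_cast hn
  have hp : 0 < (n : ℝ) + 1 - θ := by linarith
  have hexp : θ - n - 2 = -((n : ℝ) + 1 - θ) - 1 := by ring
  set G : ℝ → ℝ → ℝ := fun s x => s ^ (θ - n - 2) * (x ^ n * Real.exp (-x / s) * a x) with hG
  have hpow : ∀ x ∈ Ioo 0 T, x ^ n * (x ^ (-((n : ℝ) + 1 - θ)) * Real.Gamma (n + 1 - θ)) =
      Real.Gamma (n + 1 - θ) * x ^ (θ - 1) := fun x hx => by
    rw [← mul_assoc, ← Real.rpow_natCast x n, ← Real.rpow_add hx.1, mul_comm]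
    congr 2
    ring
  have hint : Integrable (Function.uncurry G)
      ((volume.restrict (Ioi 0)).prod (volume.restrict (Ioo 0 T))) := by
    have hmeas : Measurable (Function.uncurry G) := by
      have := ha.measurable
      simp only [hG, Function.uncurry_def]
      fun_prop
    rw [integrable_prod_iff' hmeas.aestronglyMeasurable]
    constructor
    · filter_upwards [ae_restrict_mem measurableSet_Ioo] with x hx
      have := (integrableOn_rpow_mul_exp_neg_div hp hx.1).mul_const (x ^ n * a x)
      refine this.congr (Eventually.of_forall fun s => ?_)
      simp only [Function.uncurry, hG, hexp]
      ring
    · have h1 : ∀ x ∈ Ioo 0 T, ∫ s in Ioi 0, ‖Function.uncurry G (s, x)‖ =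
          Real.Gamma (n + 1 - θ) * x ^ (θ - 1) * |a x| := by
        intro x hx
        have : ∀ s ∈ Ioi (0 : ℝ), ‖Function.uncurry G (s, x)‖ =
            s ^ (-((n : ℝ) + 1 - θ) - 1) * Real.exp (-x / s) * (x ^ n * |a x|) := by
          intro s hs
          have hs' : (0 : ℝ) < s := hs
          have hx' := hx.1
          simp only [Function.uncurry, hG, hexp, norm_mul, Real.norm_eq_abs]
          rw [abs_of_pos (Real.rpow_pos_of_pos hs' _), abs_of_pos (Real.exp_pos _),
            abs_of_pos (pow_pos hx' n)]
          ring
        rw [setIntegral_congr_fun measurableSet_Ioi this, integral_mul_const,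
          integral_rpow_mul_exp_neg_div hp hx.1, ← hpow x hx]
        ring
      refine IntegrableOn.congr_fun ?_ (fun x hx => (h1 x hx).symm) measurableSet_Ioo
      refine Integrable.mul_bdd (c := M) ((integrableOn_rpow_sub_one hθ T).const_mul _)
        ha.abs.aestronglyMeasurable (Eventually.of_forall fun x => ?_)
      simpa using hM x
  have hG2 : ∀ s, ∫ x in Ioo 0 T, G s x =
      s ^ (θ - n - 2) * ∫ x in Ioo 0 T, x ^ n * Real.exp (-x / s) * a x := fun s => by
    simp only [hG]
    rw [integral_const_mul]
  refine ⟨?_, ?_⟩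
  · exact Integrable.congr hint.integral_prod_left (Eventually.of_forall fun s => hG2 s)
  · simp only [← hG2]
    rw [integral_integral_swap hint, ← integral_const_mul]
    refine setIntegral_congr_fun measurableSet_Ioo fun x hx => ?_
    have : ∀ s, G s x = s ^ (-((n : ℝ) + 1 - θ) - 1) * Real.exp (-x / s) * (x ^ n * a x) := by
      intro s
      simp only [hG, hexp]
      ring
    simp only [this]
    rw [integral_mul_const, integral_rpow_mul_exp_neg_div hp hx.1, ← mul_assoc (Real.Gamma _),
      ← hpow x hx]
    ring

/-! ### Resolvent identities and the Calderón formula -/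

namespace NilpotentShift

set_option linter.unusedSectionVars false

variable {H : Type*} [NormedAddCommGroup H] [InnerProductSpace ℝ H] {T : ℝ} [CompleteSpace H]
  (𝒮 : NilpotentShift H T)

/-- Both sides equal `V Q_t Q_s h`. -/
theorem resQ_resP_smul {s t : ℝ} (hs : 0 < s) (ht : 0 < t) (h : H) :
    s • 𝒮.resQ t (𝒮.resP s h) = t • 𝒮.resP t (𝒮.resQ s h) := by
  rw [← map_smul, ← 𝒮.fracInt_one_resQ hs, 𝒮.resQ_fracInt one_pos, 𝒮.fracInt_one_resQ ht]

/-- Almost orthogonality of the scales `s` and `t`: for `t < s` the exchange identity trades `Q_t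
P_s` for `(t/s) P_t Q_s`, which gains the factor `t/s`. -/
theorem norm_resQ_resP_le {s t : ℝ} (hs : 0 < s) (ht : 0 < t) (h : H) :
    ‖𝒮.resQ t (𝒮.resP s h)‖ ≤ min 1 (t / s) * ‖h‖ := by
  rw [min_mul_of_nonneg _ _ (norm_nonneg h), one_mul]
  refine le_min ((𝒮.norm_resQ_le ht _).trans (𝒮.norm_resP_le hs _)) ?_
  have h1 : 𝒮.resQ t (𝒮.resP s h) = (t / s) • 𝒮.resP t (𝒮.resQ s h) := by
    rw [div_eq_inv_mul, mul_smul, ← 𝒮.resQ_resP_smul hs ht, smul_smul, inv_mul_cancel₀ hs.ne',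
      one_smul]
  rw [h1, norm_smul, Real.norm_of_nonneg (by positivity)]
  gcongr
  exact (𝒮.norm_resP_le ht _).trans (𝒮.norm_resQ_le hs _)

theorem resQ_sub_resQ {s t : ℝ} (hs : 0 < s) (ht : 0 < t) (h : H) :
    𝒮.resQ t h - 𝒮.resQ s h = (t - s) • s⁻¹ • 𝒮.resP t (𝒮.resQ s h) := by
  have h1 := 𝒮.resQ_resP_smul hs ht h
  have h2 : s • (𝒮.resQ t h - 𝒮.resQ s h) = (t - s) • 𝒮.resP t (𝒮.resQ s h) := by
    rw [sub_smul, ← h1, ← smul_sub]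
    congr 1
    simp only [resQ_apply, map_sub]
    abel
  rw [smul_comm, ← h2, smul_smul, inv_mul_cancel₀ hs.ne', one_smul]

theorem continuousAt_resQ {s : ℝ} (hs : 0 < s) (h : H) :
    ContinuousAt (fun t => 𝒮.resQ t h) s := by
  rw [ContinuousAt, tendsto_iff_norm_sub_tendsto_zero]
  have h0 : Tendsto (fun t => ‖t - s‖ * (s⁻¹ * ‖h‖)) (𝓝 s) (𝓝 0) := by
    have : Continuous fun t => ‖t - s‖ * (s⁻¹ * ‖h‖) := by fun_prop
    simpa using this.tendsto s
  refine squeeze_zero' (Eventually.of_forall fun t => norm_nonneg _) ?_ h0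
  filter_upwards [lt_mem_nhds hs] with t ht
  rw [𝒮.resQ_sub_resQ hs ht, norm_smul, norm_smul, Real.norm_of_nonneg (inv_nonneg.2 hs.le)]
  gcongr
  exact (𝒮.norm_resP_le ht _).trans (𝒮.norm_resQ_le hs _)

theorem continuousAt_resP {s : ℝ} (hs : 0 < s) (h : H) :
    ContinuousAt (fun t => 𝒮.resP t h) s := by
  have : (fun t => 𝒮.resP t h) = fun t => h - 𝒮.resQ t h := by
    funext t
    rw [resQ_apply]
    abel
  rw [this]
  exact continuousAt_const.sub (𝒮.continuousAt_resQ hs h)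

theorem hasDerivAt_resQ {s : ℝ} (hs : 0 < s) (h : H) :
    HasDerivAt (fun t => 𝒮.resQ t h) (s⁻¹ • 𝒮.resP s (𝒮.resQ s h)) s := by
  rw [hasDerivAt_iff_tendsto_slope]
  have h1 := ((𝒮.continuousAt_resP hs (𝒮.resQ s h)).const_smul s⁻¹).tendsto.mono_left
    (nhdsWithin_le_nhds (s := {s}ᶜ))
  refine h1.congr' ?_
  filter_upwards [self_mem_nhdsWithin, nhdsWithin_le_nhds (lt_mem_nhds hs)] with t hts ht
  rw [slope_def_module, 𝒮.resQ_sub_resQ hs ht, smul_smul, inv_mul_cancel₀, one_smul]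
  · rfl
  · exact sub_ne_zero.2 hts

theorem hasDerivAt_resP {s : ℝ} (hs : 0 < s) (h : H) :
    HasDerivAt (fun t => 𝒮.resP t h) (-(s⁻¹ • 𝒮.resP s (𝒮.resQ s h))) s := by
  have : (fun t => 𝒮.resP t h) = fun t => h - 𝒮.resQ t h := by
    funext t
    rw [resQ_apply]
    abel
  rw [this]
  exact (𝒮.hasDerivAt_resQ hs h).const_sub h

theorem continuousAt_resP_resQ {s : ℝ} (hs : 0 < s) (h : H) :
    ContinuousAt (fun t => 𝒮.resP t (𝒮.resQ t h)) s := by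
  have h1 : Tendsto (fun t => 𝒮.resP t (𝒮.resQ t h - 𝒮.resQ s h)) (𝓝 s) (𝓝 0) := by
    have h2 := tendsto_iff_norm_sub_tendsto_zero.1 (𝒮.continuousAt_resQ hs h).tendsto
    refine squeeze_zero_norm' ?_ h2
    filter_upwards [lt_mem_nhds hs] with t ht
    exact 𝒮.norm_resP_le ht _
  have h3 := h1.add (𝒮.continuousAt_resP hs (𝒮.resQ s h)).tendsto
  rw [zero_add] at h3
  refine h3.congr fun t => ?_
  rw [map_sub]
  abel

/-- With `w = Q_t h`, the derivative of `‖w‖²/2` in `t` is `t⁻¹⟪w, P_t w⟫`, and this dominates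
`t⁻¹‖P_t w‖²` by accretivity. Integrating over `(a,b)` bounds the left side by `‖Q_b h‖²/2`,
uniformly in `a` and `b`. -/
theorem lintegral_resP_resQ_le (h : H) :
    ∫⁻ t in Ioi 0, ENNReal.ofReal (t⁻¹ * ‖𝒮.resP t (𝒮.resQ t h)‖ ^ 2) ≤
      ENNReal.ofReal (‖h‖ ^ 2 / 2) := by
  refine lintegral_Ioi_le_of_forall fun a b ha hab => ?_
  have hpos : ∀ t ∈ Icc a b, 0 < t := fun t ht => ha.trans_le ht.1
  have hcont : ContinuousOn (fun t => t⁻¹ * ‖𝒮.resP t (𝒮.resQ t h)‖ ^ 2) (Icc a b) :=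
    fun t ht => ContinuousAt.continuousWithinAt
      ((continuousAt_inv₀ (hpos t ht).ne').mul
        ((𝒮.continuousAt_resP_resQ (hpos t ht) h).norm.pow 2))
  have hint := hcont.integrableOn_Icc (μ := volume)
  have hd : ∀ t, 0 < t → HasDerivAt (fun t => ‖𝒮.resQ t h‖ ^ 2 / 2)
      (t⁻¹ * ⟪𝒮.resQ t h, 𝒮.resP t (𝒮.resQ t h)⟫) t := fun t ht => by
    refine ((𝒮.hasDerivAt_resQ ht h).norm_sq.div_const 2).congr_deriv ?_
    rw [inner_smul_right]
    ring
  have hle : ∫ t in a..b, t⁻¹ * ‖𝒮.resP t (𝒮.resQ t h)‖ ^ 2 ≤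
      ‖𝒮.resQ b h‖ ^ 2 / 2 - ‖𝒮.resQ a h‖ ^ 2 / 2 := by
    refine intervalIntegral.integral_le_sub_of_hasDeriv_right_of_le hab.le
      (fun t ht => (hd t (hpos t ht)).continuousAt.continuousWithinAt)
      (fun t ht => (hd t (hpos t (Ioo_subset_Icc_self ht))).hasDerivWithinAt) hint
      fun t ht => ?_
    have ht0 := hpos t (Ioo_subset_Icc_self ht)
    set w := 𝒮.resQ t h
    have h1 : w = 𝒮.resP t w + 𝒮.resQ t w := by rw [resQ_apply]; abel
    have h3 := 𝒮.inner_fracInt_one_nonneg (𝒮.resQ t w)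
    rw [𝒮.fracInt_one_resQ ht0, inner_smul_left] at h3
    have h4 := nonneg_of_mul_nonneg_right h3 ht0
    have h5 : ⟪w, 𝒮.resP t w⟫ = ‖𝒮.resP t w‖ ^ 2 + ⟪𝒮.resP t w, 𝒮.resQ t w⟫ := by
      rw [real_inner_comm, ← real_inner_self_eq_norm_sq, ← inner_add_right, ← h1]
    rw [h5]
    have := inv_pos.2 ht0
    gcongr
    linarith
  rw [intervalIntegral.integral_of_le hab.le] at hle
  rw [← ofReal_integral_eq_lintegral_ofReal (hint.mono_set Ioc_subset_Icc_self)]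
  · refine ENNReal.ofReal_le_ofReal (hle.trans ?_)
    have h1 := 𝒮.norm_resQ_le (ha.trans hab) h
    have : ‖𝒮.resQ b h‖ ^ 2 ≤ ‖h‖ ^ 2 := by gcongr
    linarith [sq_nonneg ‖𝒮.resQ a h‖]
  · filter_upwards [ae_restrict_mem measurableSet_Ioc] with t ht
    have := inv_pos.2 (hpos t (Ioc_subset_Icc_self ht))
    simp only [Pi.zero_apply]
    positivity

theorem resP_resP (t : ℝ) (h : H) :
    𝒮.resP t (𝒮.resP t h) = 𝒮.kernelOp (fun x => t⁻¹ ^ 2 * (x * Real.exp (-x / t))) h := by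
  refine 𝒮.kernelOp_kernelOp (integrableOn_expKernel t T) (integrableOn_expKernel t T)
    (fun z hz => ?_) h
  have : ∀ x, t⁻¹ * Real.exp (-x / t) * (t⁻¹ * Real.exp (-(z - x) / t)) =
      t⁻¹ ^ 2 * Real.exp (-z / t) := fun x => by
    rw [mul_mul_mul_comm, ← Real.exp_add]
    ring_nf
  simp only [this]
  rw [setIntegral_const]
  simp [hz.1.le]
  ring

theorem resP_resP_resP (t : ℝ) (h : H) :
    𝒮.resP t (𝒮.resP t (𝒮.resP t h)) =
      𝒮.kernelOp (fun x => t⁻¹ ^ 3 / 2 * (x ^ 2 * Real.exp (-x / t))) h := by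
  rw [𝒮.resP_resP t (𝒮.resP t h)]
  refine 𝒮.kernelOp_kernelOp (integrableOn_of_continuous (by fun_prop) T)
    (integrableOn_expKernel t T) (fun z hz => ?_) h
  have : ∀ x, t⁻¹ ^ 2 * (x * Real.exp (-x / t)) * (t⁻¹ * Real.exp (-(z - x) / t)) =
      t⁻¹ ^ 3 * Real.exp (-z / t) * x := fun x => by
    have : Real.exp (-z / t) = Real.exp (-x / t) * Real.exp (-(z - x) / t) := by
      rw [← Real.exp_add]
      ring_nf
    rw [this]
    ring
  simp only [this]
  rw [integral_const_mul, ← integral_Ioc_eq_integral_Ioo,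
    ← intervalIntegral.integral_of_le hz.1.le, integral_id]
  ring

/-- The constant in the Calderón type representation of the fractional integral. -/
def calderonConst (θ : ℝ) : ℝ :=
  Real.Gamma θ * (Real.Gamma (1 + 1 - θ) - Real.Gamma (2 + 1 - θ) / 2)

theorem calderonConst_pos {θ : ℝ} (hθ : 0 < θ) (hθ1 : θ < 1) : 0 < calderonConst θ := by
  have h1 : Real.Gamma (2 + 1 - θ) = (1 + 1 - θ) * Real.Gamma (1 + 1 - θ) := by
    rw [← Real.Gamma_add_one (by linarith)]
    congr 1
    ring
  have h2 : 0 < Real.Gamma (1 + 1 - θ) := Real.Gamma_pos_of_pos (by linarith)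
  refine mul_pos (Real.Gamma_pos_of_pos hθ) ?_
  have h3 : Real.Gamma (1 + 1 - θ) - (1 + 1 - θ) * Real.Gamma (1 + 1 - θ) / 2 =
      θ / 2 * Real.Gamma (1 + 1 - θ) := by ring
  rw [h1, h3]
  positivity

/-- Since `P_s² Q_s = P_s² - P_s³` has an explicit kernel, integrating in `s` against `s^{θ-1}`
yields a multiple of `x^{θ-1}`. The extra factor `P_s` is there to be paired with a further `Q_t`,
the remaining `P_s Q_s` being square integrable. -/
theorem integral_resP_resP_resQ {θ : ℝ} (hθ : 0 < θ) (hθ1 : θ < 1) (h g : H) :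
    ∫ s in Ioi 0, s ^ (θ - 1) * ⟪𝒮.resP s (𝒮.resP s (𝒮.resQ s h)), g⟫ =
      calderonConst θ * ⟪𝒮.fracInt θ h, g⟫ := by
  have hM : ∀ x, |⟪𝒮.S x h, g⟫| ≤ ‖h‖ * ‖g‖ := fun x => 𝒮.abs_inner_le x h g
  have hc := 𝒮.continuous_inner h g
  obtain ⟨i1, e1⟩ := integral_rpow_mul_integral_exp_neg_div (T := T) hθ hθ1 hc hM (n := 1) le_rfl
  obtain ⟨i2, e2⟩ := integral_rpow_mul_integral_exp_neg_div (T := T) hθ hθ1 hc hM (n := 2)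
    one_le_two
  have hs : ∀ s ∈ Ioi (0 : ℝ), s ^ (θ - 1) * ⟪𝒮.resP s (𝒮.resP s (𝒮.resQ s h)), g⟫ =
      s ^ (θ - (1 : ℕ) - 2) * (∫ x in Ioo 0 T, x ^ 1 * Real.exp (-x / s) * ⟪𝒮.S x h, g⟫) -
      2⁻¹ * (s ^ (θ - (2 : ℕ) - 2) *
        (∫ x in Ioo 0 T, x ^ 2 * Real.exp (-x / s) * ⟪𝒮.S x h, g⟫)) := by
    intro s hs
    have hs' : (0 : ℝ) < s := hs
    rw [resQ_apply, map_sub, map_sub, inner_sub_left, resP_resP_resP, resP_resP,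
      𝒮.inner_kernelOp (integrableOn_of_continuous (by fun_prop) T),
      𝒮.inner_kernelOp (integrableOn_of_continuous (by fun_prop) T), mul_sub]
    -- The powers `s⁻²` and `s⁻³` normalise the kernels of `P_s²` and `P_s³`.
    have p1 : s ^ (θ - (1 : ℕ) - 2) = s ^ (θ - 1) * s⁻¹ ^ 2 := by
      rw [inv_pow, ← div_eq_mul_inv, ← Real.rpow_sub_natCast hs'.ne']
      norm_num
    have p2 : s ^ (θ - (2 : ℕ) - 2) = s ^ (θ - 1) * s⁻¹ ^ 3 := by
      rw [inv_pow, ← div_eq_mul_inv, ← Real.rpow_sub_natCast hs'.ne']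
      congr 1
      push_cast
      ring
    simp only [mul_assoc, integral_const_mul, p1, p2, pow_one]
    ring
  rw [setIntegral_congr_fun measurableSet_Ioi hs, integral_sub i1 (i2.const_mul _),
    integral_const_mul, e1, e2, fracInt, 𝒮.inner_kernelOp (integrableOn_fracKernel hθ T)]
  have : ∀ x : ℝ, x ^ (θ - 1) / Real.Gamma θ * ⟪𝒮.S x h, g⟫ =
    (Real.Gamma θ)⁻¹ * (x ^ (θ - 1) * ⟪𝒮.S x h, g⟫) := fun x => by ring
  simp only [this]
  rw [integral_const_mul, calderonConst]
  have := (Real.Gamma_pos_of_pos hθ).ne'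
  field_simp
  push_cast
  ring

end NilpotentShift

/-! ### A Schur test and a surjectivity criterion -/

theorem lintegral_mul_mul_sq_le {ι : Type*} [MeasurableSpace ι] {μ : Measure ι} {f g w : ι → ℝ≥0∞}
    (hf : AEMeasurable f μ) (hg : AEMeasurable g μ) (hw : AEMeasurable w μ) :
    (∫⁻ a, f a * g a * w a ∂μ) ^ 2 ≤ (∫⁻ a, f a ^ 2 * w a ∂μ) * ∫⁻ a, g a ^ 2 * w a ∂μ := by
  have hw2 : ∀ a, w a ^ (1 / 2 : ℝ) * w a ^ (1 / 2 : ℝ) = w a := fun a => by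
    rw [← ENNReal.rpow_add_of_nonneg _ _ (by norm_num) (by norm_num)]
    norm_num
  have h := ENNReal.lintegral_mul_le_Lp_mul_Lq μ (p := 2) (q := 2)
    (by constructor <;> norm_num) (hf.mul (hw.pow_const (1 / 2 : ℝ)))
    (hg.mul (hw.pow_const (1 / 2 : ℝ)))
  have e1 : ∀ a, ((f * fun a => w a ^ (1 / 2 : ℝ)) * (g * fun a => w a ^ (1 / 2 : ℝ))) a =
      f a * g a * w a := fun a => by
    simp only [Pi.mul_apply]
    rw [mul_mul_mul_comm, hw2]
  have e2 : ∀ (f : ι → ℝ≥0∞) a, (f * fun a => w a ^ (1 / 2 : ℝ)) a ^ (2 : ℝ) = f a ^ 2 * w a :=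
    fun f a => by
      simp only [Pi.mul_apply, ENNReal.rpow_two]
      rw [mul_pow, pow_two (w a ^ (1 / 2 : ℝ)), hw2]
  simp only [e1, e2] at h
  calc (∫⁻ a, f a * g a * w a ∂μ) ^ 2
      ≤ ((∫⁻ a, f a ^ 2 * w a ∂μ) ^ (1 / 2 : ℝ) * (∫⁻ a, g a ^ 2 * w a ∂μ) ^ (1 / 2 : ℝ)) ^ 2 := by
        gcongr
    _ = _ := by
        rw [mul_pow, ← ENNReal.rpow_two, ← ENNReal.rpow_two, ← ENNReal.rpow_mul,
          ← ENNReal.rpow_mul]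
        norm_num

/-- The two power bounds, on either side of `t`, integrate to exactly `1/p` and `1/q`; scale
invariance removes `t`. -/
theorem lintegral_Ioi_le_of_le_rpow {f : ℝ → ℝ} {p q t : ℝ} (hp : 0 < p) (hq : 0 < q) (ht : 0 < t)
    (h1 : ∀ s, 0 < s → s ≤ t → f s ≤ t ^ (-p) * s ^ (p - 1))
    (h2 : ∀ s, t < s → f s ≤ t ^ q * s ^ (-q - 1)) :
    ∫⁻ s in Ioi 0, ENNReal.ofReal (f s) ≤ ENNReal.ofReal (1 / p + 1 / q) := by
  rw [← Ioc_union_Ioi_eq_Ioi ht.le, lintegral_union measurableSet_Ioi Ioc_disjoint_Ioi_same,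
    ENNReal.ofReal_add (by positivity) (by positivity)]
  gcongr
  · have hint : IntegrableOn (fun s : ℝ => t ^ (-p) * s ^ (p - 1)) (Ioc 0 t) := by
      have : IntervalIntegrable (fun s : ℝ => s ^ (p - 1)) volume 0 t :=
        intervalIntegral.intervalIntegrable_rpow' (by linarith)
      exact ((intervalIntegrable_iff_integrableOn_Ioc_of_le ht.le).1 this).const_mul _
    calc ∫⁻ s in Ioc 0 t, ENNReal.ofReal (f s)
        ≤ ∫⁻ s in Ioc 0 t, ENNReal.ofReal (t ^ (-p) * s ^ (p - 1)) :=
          setLIntegral_mono' measurableSet_Ioc fun s hs =>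
            ENNReal.ofReal_le_ofReal (h1 s hs.1 hs.2)
      _ = ENNReal.ofReal (∫ s in Ioc 0 t, t ^ (-p) * s ^ (p - 1)) := by
          rw [ofReal_integral_eq_lintegral_ofReal hint]
          filter_upwards [ae_restrict_mem measurableSet_Ioc] with s hs
          have := hs.1
          simp only [Pi.zero_apply]
          positivity
      _ ≤ _ := by
          refine ENNReal.ofReal_le_ofReal (le_of_eq ?_)
          rw [integral_const_mul, ← intervalIntegral.integral_of_le ht.le,
            integral_rpow (Or.inl (by linarith)), sub_add_cancel, Real.zero_rpow hp.ne', sub_zero,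
            Real.rpow_neg ht.le]
          have := (Real.rpow_pos_of_pos ht p).ne'
          field_simp
  · have hint : IntegrableOn (fun s : ℝ => t ^ q * s ^ (-q - 1)) (Ioi t) :=
      (integrableOn_Ioi_rpow_of_lt (by linarith) ht).const_mul _
    calc ∫⁻ s in Ioi t, ENNReal.ofReal (f s)
        ≤ ∫⁻ s in Ioi t, ENNReal.ofReal (t ^ q * s ^ (-q - 1)) :=
          setLIntegral_mono' measurableSet_Ioi fun s hs =>
            ENNReal.ofReal_le_ofReal (h2 s hs)
      _ = ENNReal.ofReal (∫ s in Ioi t, t ^ q * s ^ (-q - 1)) := by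
          rw [ofReal_integral_eq_lintegral_ofReal hint]
          filter_upwards [ae_restrict_mem measurableSet_Ioi] with s hs
          have : 0 < s := ht.trans hs
          simp only [Pi.zero_apply]
          positivity
      _ ≤ _ := by
          refine ENNReal.ofReal_le_ofReal (le_of_eq ?_)
          rw [integral_const_mul, integral_Ioi_rpow_of_lt (by linarith) ht, sub_add_cancel,
            Real.rpow_neg ht.le]
          have := (Real.rpow_pos_of_pos ht q).ne'
          field_simp

/-- A Hardy type inequality (Schur test for the kernel `(s/t)^θ min (1, t/s)`). -/
theorem lintegral_sq_lintegral_min_le {θ : ℝ} (hθ : 0 < θ) (hθ1 : θ < 1) {F : ℝ → ℝ≥0∞}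
    (hF : AEMeasurable F (volume.restrict (Ioi 0))) :
    ∫⁻ t in Ioi 0, (ENNReal.ofReal (t ^ (-θ)) *
        ∫⁻ s in Ioi 0, ENNReal.ofReal (s ^ (θ - 1) * min 1 (t / s)) * F s) ^ 2 *
          ENNReal.ofReal t⁻¹ ≤
      ENNReal.ofReal (1 / θ + 1 / (1 - θ)) ^ 2 * ∫⁻ s in Ioi 0, F s ^ 2 * ENNReal.ofReal s⁻¹ := by
  set A := ENNReal.ofReal (1 / θ + 1 / (1 - θ)) with hA
  set K : ℝ → ℝ → ℝ≥0∞ := fun t s => ENNReal.ofReal (t ^ (-θ) * (s ^ (θ - 1) * min 1 (t / s)))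
    with hK
  have hKm : Measurable (Function.uncurry K) := by
    simp only [hK, Function.uncurry_def]
    fun_prop
  have hKt : ∀ t, Measurable (K t) := fun t => hKm.comp measurable_prodMk_left
  have hAs : ∀ t, 0 < t → ∫⁻ s in Ioi 0, K t s ≤ A := fun t ht => by
    refine lintegral_Ioi_le_of_le_rpow hθ (by linarith) ht (fun s hs hst => ?_) fun s hs => ?_
    · gcongr
      exact mul_le_of_le_one_right (by positivity) (min_le_left _ _)
    · have hs0 := ht.trans hs
      calc t ^ (-θ) * (s ^ (θ - 1) * min 1 (t / s)) ≤ t ^ (-θ) * (s ^ (θ - 1) * (t / s)) := by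
            gcongr
            exact min_le_right _ _
        _ = _ := by
            rw [show -(1 - θ) - 1 = θ - 1 - 1 by ring, Real.rpow_sub_one hs0.ne' (θ - 1),
              show 1 - θ = -θ + 1 by ring, Real.rpow_add_one ht.ne']
            ring
  have hAt : ∀ s, 0 < s → ∫⁻ t in Ioi 0, K t s * ENNReal.ofReal t⁻¹ ≤
      A * ENNReal.ofReal s⁻¹ := fun s hs => by
    have hle : ∫⁻ t in Ioi 0, ENNReal.ofReal (s * (t ^ (-θ) * (s ^ (θ - 1) * min 1 (t / s)) * t⁻¹))
        ≤ A := by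
      -- Integrating in the other variable exchanges the exponents `θ` and `1 - θ`, which leaves the
      -- bound `A` unchanged.
      rw [hA, add_comm]
      refine lintegral_Ioi_le_of_le_rpow (by linarith) hθ hs (fun t ht hts => ?_) fun t ht => ?_
      · calc s * (t ^ (-θ) * (s ^ (θ - 1) * min 1 (t / s)) * t⁻¹)
            ≤ s * (t ^ (-θ) * (s ^ (θ - 1) * (t / s)) * t⁻¹) := by
              gcongr
              exact min_le_right _ _
          _ = _ := by
              rw [show 1 - θ - 1 = -θ by ring, show -(1 - θ) = θ - 1 by ring]
              field_simp
      · have ht0 := hs.trans ht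
        calc s * (t ^ (-θ) * (s ^ (θ - 1) * min 1 (t / s)) * t⁻¹)
            ≤ s * (t ^ (-θ) * (s ^ (θ - 1) * 1) * t⁻¹) := by
              gcongr
              exact min_le_left _ _
          _ = _ := by
              rw [Real.rpow_sub_one ht0.ne', Real.rpow_sub_one hs.ne']
              field_simp
    have hs' : ENNReal.ofReal s * ENNReal.ofReal s⁻¹ = 1 := by
      rw [← ENNReal.ofReal_mul hs.le, mul_inv_cancel₀ hs.ne', ENNReal.ofReal_one]
    calc ∫⁻ t in Ioi 0, K t s * ENNReal.ofReal t⁻¹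
        = ∫⁻ t in Ioi 0, ENNReal.ofReal s⁻¹ *
            ENNReal.ofReal (s * (t ^ (-θ) * (s ^ (θ - 1) * min 1 (t / s)) * t⁻¹)) := by
          refine setLIntegral_congr_fun measurableSet_Ioi fun t ht => ?_
          have ht0 : (0 : ℝ) < t := ht
          simp only [hK]
          rw [← ENNReal.ofReal_mul (by positivity), ← ENNReal.ofReal_mul (by positivity)]
          congr 1
          field_simp
      _ = ENNReal.ofReal s⁻¹ * ∫⁻ t in Ioi 0,
            ENNReal.ofReal (s * (t ^ (-θ) * (s ^ (θ - 1) * min 1 (t / s)) * t⁻¹)) :=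
          lintegral_const_mul' _ _ ENNReal.ofReal_ne_top
      _ ≤ _ := by
          rw [mul_comm]
          gcongr
  calc ∫⁻ t in Ioi 0, (ENNReal.ofReal (t ^ (-θ)) *
        ∫⁻ s in Ioi 0, ENNReal.ofReal (s ^ (θ - 1) * min 1 (t / s)) * F s) ^ 2 *
          ENNReal.ofReal t⁻¹
      ≤ ∫⁻ t in Ioi 0, (A * ∫⁻ s in Ioi 0, F s ^ 2 * K t s) * ENNReal.ofReal t⁻¹ := by
        refine setLIntegral_mono' measurableSet_Ioi fun t ht => ?_
        have ht0 : (0 : ℝ) < t := ht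
        gcongr
        rw [← lintegral_const_mul' _ _ ENNReal.ofReal_ne_top]
        -- Cauchy–Schwarz for the measure with density `K t`, with the constant `1` as one factor,
        -- so that its mass, at most `A`, splits off.
        have h1 := lintegral_mul_mul_sq_le (μ := volume.restrict (Ioi 0))
          (aemeasurable_const (b := (1 : ℝ≥0∞))) hF (hKt t).aemeasurable
        simp only [one_mul, one_pow] at h1
        calc _ = (∫⁻ s in Ioi 0, F s * K t s) ^ 2 := by
              congr 1
              refine lintegral_congr fun s => ?_
              rw [← mul_assoc, ← ENNReal.ofReal_mul (by positivity), mul_comm]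
          _ ≤ _ := h1.trans (by gcongr; exact hAs t ht0)
    _ = ∫⁻ t in Ioi 0, ∫⁻ s in Ioi 0, A * (F s ^ 2 * (K t s * ENNReal.ofReal t⁻¹)) := by
        refine lintegral_congr fun t => ?_
        rw [lintegral_const_mul' _ _ ENNReal.ofReal_ne_top, mul_assoc,
          ← lintegral_mul_const' _ _ ENNReal.ofReal_ne_top]
        simp only [mul_assoc]
        rfl
    _ = ∫⁻ s in Ioi 0, ∫⁻ t in Ioi 0, A * (F s ^ 2 * (K t s * ENNReal.ofReal t⁻¹)) := by
        refine lintegral_lintegral_swap ?_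
        refine AEMeasurable.const_mul ?_ _
        refine ((hF.pow_const 2).comp_snd).mul (Measurable.aemeasurable ?_)
        exact hKm.mul (by fun_prop)
    _ ≤ ∫⁻ s in Ioi 0, A * (F s ^ 2 * (A * ENNReal.ofReal s⁻¹)) := by
        refine setLIntegral_mono' measurableSet_Ioi fun s hs => ?_
        rw [lintegral_const_mul' _ _ ENNReal.ofReal_ne_top, lintegral_const_mul'']
        · gcongr
          exact hAt s hs
        · exact ((hKm.comp measurable_prodMk_right).mul (by fun_prop)).aemeasurable
    _ = _ := by
        rw [pow_two A, ← lintegral_const_mul' _ _ (ENNReal.mul_ne_top ENNReal.ofReal_ne_top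
          ENNReal.ofReal_ne_top)]
        refine lintegral_congr fun s => ?_
        ring

/-- The hypothesis makes `B n ↦ ⟪g, n⟫` a well-defined functional of norm at most `M` on the range
of `B`. A Hahn–Banach extension is represented by a vector `h`, and adjointness turns this into `A h
= g`. -/
theorem exists_eq_of_abs_inner_le {H : Type*} [NormedAddCommGroup H] [InnerProductSpace ℝ H]
    [CompleteSpace H] {A B : H →L[ℝ] H} (hAB : ∀ h n, ⟪A h, n⟫ = ⟪h, B n⟫) {g : H} {M : ℝ}
    (hM0 : 0 ≤ M) (hM : ∀ n, |⟪g, n⟫| ≤ M * ‖B n‖) : ∃ h, A h = g ∧ ‖h‖ ≤ M := by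
  have hker : ∀ n₁ n₂, B n₁ = B n₂ → ⟪g, n₁⟫ = ⟪g, n₂⟫ := fun n₁ n₂ h => by
    have h1 := hM (n₁ - n₂)
    rw [map_sub, h, sub_self, norm_zero, mul_zero, inner_sub_right] at h1
    exact sub_eq_zero.1 (abs_nonpos_iff.1 h1)
  have hch : ∀ y : LinearMap.range (B : H →ₗ[ℝ] H), ∃ n, B n = y := fun y => y.2
  choose c hc using hch
  let ℓ : LinearMap.range (B : H →ₗ[ℝ] H) →ₗ[ℝ] ℝ :=
    { toFun := fun y => ⟪g, c y⟫
      map_add' := fun y z => by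
        rw [← inner_add_right]
        exact hker _ _ (by rw [hc, map_add, hc, hc]; rfl)
      map_smul' := fun a y => by
        rw [RingHom.id_apply, smul_eq_mul, ← real_inner_smul_right]
        exact hker _ _ (by rw [hc, map_smul, hc]; rfl) }
  have hℓ : ∀ y, ‖ℓ y‖ ≤ M * ‖y‖ := fun y => by
    have := hM (c y)
    rwa [hc] at this
  obtain ⟨L, hL1, hL2⟩ := exists_extension_norm_eq _ (ℓ.mkContinuous M hℓ)
  refine ⟨(InnerProductSpace.toDual ℝ H).symm L, ?_, ?_⟩
  · refine ext_inner_right ℝ fun n => ?_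
    rw [hAB, InnerProductSpace.toDual_symm_apply]
    have := hL1 ⟨B n, n, rfl⟩
    rw [this]
    exact hker _ _ (hc _)
  · rw [LinearIsometryEquiv.norm_map, hL2]
    exact LinearMap.mkContinuous_norm_le _ hM0 _

/-! ### Square functions and the range of fractional integrals -/

namespace NilpotentShift

set_option linter.unusedSectionVars false

variable {H : Type*} [NormedAddCommGroup H] [InnerProductSpace ℝ H] {T : ℝ} [CompleteSpace H]
  (𝒮 : NilpotentShift H T)

/-- The norm `(∫_0^∞ (t^{-θ} ‖tD(1+tD)⁻¹ g‖)² dt/t)^{1/2}`, squared. -/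
def sqFun (θ : ℝ) (g : H) : ℝ≥0∞ :=
  ∫⁻ t in Ioi 0, (ENNReal.ofReal (t ^ (-θ)) * ‖𝒮.resQ t g‖ₑ) ^ 2 * ENNReal.ofReal t⁻¹

/-- The square of the constant in the square function estimate for fractional integrals. -/
def sqFunConst (θ : ℝ) : ℝ := ((1 / θ + 1 / (1 - θ)) / calderonConst θ) ^ 2 / 2

theorem sqFunConst_nonneg (θ : ℝ) : 0 ≤ sqFunConst θ := by unfold sqFunConst; positivity

theorem aemeasurable_of_continuousAt {E : Type*} [NormedAddCommGroup E] {f : ℝ → E}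
    (hf : ∀ t, 0 < t → ContinuousAt f t) :
    AEMeasurable (fun t => ‖f t‖ₑ) (volume.restrict (Ioi 0)) :=
  ContinuousOn.aemeasurable (fun t ht => (hf t ht).enorm.continuousWithinAt) measurableSet_Ioi

theorem resQ_resP_resP_resQ (s t : ℝ) (h : H) :
    𝒮.resP s (𝒮.resP s (𝒮.resQ s (𝒮.resQ t h))) =
      𝒮.resQ t (𝒮.resP s (𝒮.resP s (𝒮.resQ s h))) := by
  rw [𝒮.resQ_comm, 𝒮.resP_resQ, 𝒮.resP_resQ]

theorem enorm_resQ_fracInt_le {θ : ℝ} (hθ : 0 < θ) (hθ1 : θ < 1) {t : ℝ} (ht : 0 < t) (h : H) :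
    ENNReal.ofReal (calderonConst θ) * ‖𝒮.resQ t (𝒮.fracInt θ h)‖ₑ ≤
      ∫⁻ s in Ioi 0, ENNReal.ofReal (s ^ (θ - 1) * min 1 (t / s)) *
        ‖𝒮.resP s (𝒮.resQ s h)‖ₑ := by
  -- The reproducing formula, applied to `Q_t h`, is tested against this vector itself, and one
  -- factor `‖g‖` is cancelled at the end.
  set g := 𝒮.resQ t (𝒮.fracInt θ h) with hg
  rcases eq_or_ne g 0 with h0 | h0
  · simp [h0]
  have h1 := 𝒮.integral_resP_resP_resQ hθ hθ1 (𝒮.resQ t h) g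
  rw [← 𝒮.resQ_fracInt hθ, ← hg, real_inner_self_eq_norm_sq] at h1
  have hc := (calderonConst_pos hθ hθ1).le
  have h2 : ENNReal.ofReal (calderonConst θ) * ‖g‖ₑ * ‖g‖ₑ ≤
      (∫⁻ s in Ioi 0, ENNReal.ofReal (s ^ (θ - 1) * min 1 (t / s)) *
        ‖𝒮.resP s (𝒮.resQ s h)‖ₑ) * ‖g‖ₑ := by
    calc ENNReal.ofReal (calderonConst θ) * ‖g‖ₑ * ‖g‖ₑ
        = ‖calderonConst θ * ‖g‖ ^ 2‖ₑ := by
          rw [enorm_mul, ← ofReal_norm (calderonConst θ), Real.norm_of_nonneg hc, enorm_pow,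
            enorm_norm, mul_assoc, pow_two]
      _ ≤ ∫⁻ s in Ioi 0, ‖s ^ (θ - 1) *
            ⟪𝒮.resP s (𝒮.resP s (𝒮.resQ s (𝒮.resQ t h))), g⟫‖ₑ := by
          rw [← h1]
          exact enorm_integral_le_lintegral_enorm _
      _ ≤ ∫⁻ s in Ioi 0, ENNReal.ofReal (s ^ (θ - 1) * min 1 (t / s)) *
            ‖𝒮.resP s (𝒮.resQ s h)‖ₑ * ‖g‖ₑ := by
          refine setLIntegral_mono' measurableSet_Ioi fun s hs => ?_
          have hs0 : (0 : ℝ) < s := hs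
          rw [← ofReal_norm, ← ofReal_norm, ← ofReal_norm,
            ← ENNReal.ofReal_mul (by positivity), ← ENNReal.ofReal_mul (by positivity), norm_mul,
            Real.norm_of_nonneg (Real.rpow_nonneg hs0.le _), mul_assoc, mul_assoc]
          refine ENNReal.ofReal_le_ofReal ?_
          gcongr
          refine (norm_inner_le_norm _ _).trans ?_
          rw [← mul_assoc]
          gcongr
          rw [𝒮.resQ_resP_resP_resQ]
          exact 𝒮.norm_resQ_resP_le hs0 ht _
      _ = _ := lintegral_mul_const' _ _ enorm_ne_top
  exact (ENNReal.mul_le_mul_iff_left (by simpa using h0) enorm_ne_top).1 h2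

/-- Three bounds combine: the reproducing formula with almost orthogonality controls `‖Q_t I^θ h‖`
by an average of `‖P_s Q_s h‖`, the Schur test bounds that average, and the quadratic estimate for
`P_s Q_s` finishes. -/
theorem sqFun_fracInt_le {θ : ℝ} (hθ : 0 < θ) (hθ1 : θ < 1) (h : H) :
    𝒮.sqFun θ (𝒮.fracInt θ h) ≤ ENNReal.ofReal (sqFunConst θ * ‖h‖ ^ 2) := by
  have hc := calderonConst_pos hθ hθ1
  have hm := aemeasurable_of_continuousAt (fun t ht => 𝒮.continuousAt_resP_resQ ht h)
  set c := ENNReal.ofReal (calderonConst θ) with hcdef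
  have hc0 : c ≠ 0 := by simpa [hcdef] using hc
  have hct : c ≠ ⊤ := ENNReal.ofReal_ne_top
  have h1 : c ^ 2 * 𝒮.sqFun θ (𝒮.fracInt θ h) ≤
      c ^ 2 * ENNReal.ofReal (sqFunConst θ * ‖h‖ ^ 2) := by
    calc c ^ 2 * 𝒮.sqFun θ (𝒮.fracInt θ h)
        = ∫⁻ t in Ioi 0, c ^ 2 * ((ENNReal.ofReal (t ^ (-θ)) * ‖𝒮.resQ t (𝒮.fracInt θ h)‖ₑ) ^ 2 *
            ENNReal.ofReal t⁻¹) := by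
          rw [sqFun, lintegral_const_mul' _ _ (ENNReal.pow_ne_top hct)]
      _ ≤ ∫⁻ t in Ioi 0, (ENNReal.ofReal (t ^ (-θ)) *
            ∫⁻ s in Ioi 0, ENNReal.ofReal (s ^ (θ - 1) * min 1 (t / s)) *
              ‖𝒮.resP s (𝒮.resQ s h)‖ₑ) ^ 2 * ENNReal.ofReal t⁻¹ := by
          refine setLIntegral_mono' measurableSet_Ioi fun t ht => ?_
          rw [← mul_assoc, ← mul_pow, mul_left_comm]
          gcongr
          exact 𝒮.enorm_resQ_fracInt_le hθ hθ1 ht h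
      _ ≤ ENNReal.ofReal (1 / θ + 1 / (1 - θ)) ^ 2 *
            ∫⁻ s in Ioi 0, ‖𝒮.resP s (𝒮.resQ s h)‖ₑ ^ 2 * ENNReal.ofReal s⁻¹ :=
          lintegral_sq_lintegral_min_le hθ hθ1 hm
      _ ≤ ENNReal.ofReal (1 / θ + 1 / (1 - θ)) ^ 2 * ENNReal.ofReal (‖h‖ ^ 2 / 2) := by
          gcongr
          refine le_trans (le_of_eq ?_) (𝒮.lintegral_resP_resQ_le h)
          refine setLIntegral_congr_fun measurableSet_Ioi fun s hs => ?_
          have hs0 : (0 : ℝ) < s := hs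
          rw [ENNReal.ofReal_mul (by positivity), ENNReal.ofReal_pow (norm_nonneg _),
            ofReal_norm, mul_comm]
      _ = _ := by
          have : 0 < 1 - θ := by linarith
          rw [hcdef, ← ENNReal.ofReal_pow (by positivity), ← ENNReal.ofReal_pow hc.le,
            ← ENNReal.ofReal_mul (by positivity), ← ENNReal.ofReal_mul (by positivity), sqFunConst]
          congr 1
          field_simp
  exact (ENNReal.mul_le_mul_iff_right (pow_ne_zero 2 hc0) (ENNReal.pow_ne_top hct)).1 h1

theorem tendsto_resP_atTop (h : H) : Tendsto (fun t => 𝒮.resP t h) atTop (𝓝 0) := by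
  have h1 : Tendsto (fun t : ℝ => t⁻¹ * (‖𝒮.fracInt 1‖ * ‖h‖)) atTop (𝓝 0) := by
    simpa using tendsto_inv_atTop_zero.mul_const (‖𝒮.fracInt 1‖ * ‖h‖)
  refine squeeze_zero_norm' ?_ h1
  filter_upwards [eventually_gt_atTop 0] with t ht
  have h2 : 𝒮.resP t h = t⁻¹ • 𝒮.fracInt 1 (𝒮.resQ t h) := by
    rw [𝒮.fracInt_one_resQ ht, smul_smul, inv_mul_cancel₀ ht.ne', one_smul]
  rw [h2, norm_smul, Real.norm_of_nonneg (by positivity)]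
  gcongr
  exact (ContinuousLinearMap.le_opNorm _ _).trans (by gcongr; exact 𝒮.norm_resQ_le ht h)

/-- After rescaling, `P_t h` is the average of `S(ty) h` against `e^{-y} dy`, so strong continuity
at `0` and dominated convergence apply. -/
theorem tendsto_resP_zero (h : H) : Tendsto (fun t => 𝒮.resP t h) (𝓝[>] 0) (𝓝 h) := by
  have h1 : ∀ t > 0, 𝒮.resP t h = ∫ y in Ioi 0, Real.exp (-y) • 𝒮.S (t * y) h := by
    intro t ht
    rw [resP, 𝒮.kernelOp_apply (integrableOn_expKernel t T), 𝒮.setIntegral_Ioo_eq_Ioi]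
    have h2 := integral_comp_mul_left_Ioi (fun x => (Real.exp (-x / t)) • 𝒮.S x h) 0 ht
    rw [mul_zero] at h2
    have h3 : ∀ y, Real.exp (-y) = Real.exp (-(t * y) / t) := fun y => by
      congr 1
      field_simp
    simp only [h3, h2, mul_smul]
    rw [integral_smul]
  have hexp : IntegrableOn (fun y : ℝ => Real.exp (-y)) (Ioi 0) := integrableOn_exp_neg_Ioi 0
  have h4 : Tendsto (fun t => ∫ y in Ioi 0, Real.exp (-y) • 𝒮.S (t * y) h) (𝓝[>] 0)
      (𝓝 (∫ y in Ioi 0, Real.exp (-y) • h)) := by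
    refine tendsto_integral_filter_of_dominated_convergence (fun y => Real.exp (-y) * ‖h‖) ?_ ?_
      (hexp.mul_const _) ?_
    · refine Eventually.of_forall fun t => Continuous.aestronglyMeasurable ?_
      have := (𝒮.continuous h).comp (continuous_const_mul t)
      exact (Real.continuous_exp.comp continuous_neg).smul this
    · refine Eventually.of_forall fun t => Eventually.of_forall fun y => ?_
      rw [norm_smul, Real.norm_of_nonneg (Real.exp_pos _).le]
      gcongr
      exact 𝒮.norm_le _ _
    · refine Eventually.of_forall fun y => ?_
      have h5 : Continuous fun t => 𝒮.S (t * y) h :=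
        (𝒮.continuous h).comp (continuous_mul_const y)
      have := (h5.tendsto 0).const_smul (Real.exp (-y))
      rw [zero_mul, 𝒮.zero] at this
      exact this.mono_left nhdsWithin_le_nhds
  rw [integral_smul_const, integral_exp_neg_Ioi_zero, one_smul] at h4
  refine h4.congr' ?_
  filter_upwards [self_mem_nhdsWithin] with t ht
  exact (h1 t ht).symm

/-- If `V h = 0`, then `t P_t h = V Q_t h = Q_t V h = 0` for all `t > 0`, while `P_t h → h` as `t →
0`. -/
theorem fracInt_one_injective : Function.Injective (𝒮.fracInt 1) := by
  refine (injective_iff_map_eq_zero _).2 fun h hh => ?_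
  have : ∀ t > 0, 𝒮.resP t h = 0 := fun t ht => by
    have h1 := 𝒮.fracInt_one_resQ ht h
    rw [← 𝒮.resQ_fracInt one_pos, hh, map_zero] at h1
    exact (smul_eq_zero.1 h1.symm).resolve_left ht.ne'
  refine tendsto_nhds_unique (𝒮.tendsto_resP_zero h) (tendsto_const_nhds.congr' ?_)
  filter_upwards [self_mem_nhdsWithin] with t ht
  exact (this t ht).symm

theorem inner_resP_left {t : ℝ} (h g : H) : ⟪𝒮.resP t h, g⟫ = ⟪h, 𝒮.dual.resP t g⟫ :=
  𝒮.inner_kernelOp_left (integrableOn_expKernel t T) h g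

/-- The function `Φ(t) = ⟪P_t g, P_t* n⟫` runs from `⟪g, n⟫` at `0` to `0` at infinity, so the
pairing is controlled by the integral of `|Φ'|`. With `m = V* n` one has `P_t* n = t⁻¹ Q_t* m`,
hence `|Φ'| ≤ 2 t⁻² ‖Q_t g‖ ‖Q_t* m‖`. Cauchy–Schwarz separates this into the square functions of
`g` and of `m = (I^{1-θ})* (I^θ)* n`, and the second is bounded by the direct estimate of order `1 -
θ`. -/
theorem abs_inner_le_of_sqFun_le {θ M : ℝ} (hθ : 0 < θ) (hθ1 : θ < 1) (hM0 : 0 ≤ M) {g : H}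
    (hM : 𝒮.sqFun θ g ≤ ENNReal.ofReal (M ^ 2)) (n : H) :
    |⟪g, n⟫| ≤ 2 * √(sqFunConst (1 - θ)) * M * ‖𝒮.dual.fracInt θ n‖ := by
  set m := 𝒮.dual.fracInt 1 n with hm
  set D := 2 * √(sqFunConst (1 - θ)) * M * ‖𝒮.dual.fracInt θ n‖ with hD
  have hD0 : 0 ≤ D := by positivity
  have hm' : m = 𝒮.dual.fracInt (1 - θ) (𝒮.dual.fracInt θ n) := by
    rw [𝒮.dual.fracInt_fracInt (by linarith) hθ, hm, sub_add_cancel]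
  have hsq : 𝒮.dual.sqFun (1 - θ) m ≤
      ENNReal.ofReal (sqFunConst (1 - θ) * ‖𝒮.dual.fracInt θ n‖ ^ 2) := by
    rw [hm']
    exact 𝒮.dual.sqFun_fracInt_le (by linarith) (by linarith) _
  set J : ℝ≥0∞ := ∫⁻ t in Ioi 0, (ENNReal.ofReal (t ^ (-θ)) * ‖𝒮.resQ t g‖ₑ) *
    (ENNReal.ofReal (t ^ (-(1 - θ))) * ‖𝒮.dual.resQ t m‖ₑ) * ENNReal.ofReal t⁻¹ with hJ
  have hJ2 : 2 * J ≤ ENNReal.ofReal D := by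
    have h1 : J ^ 2 ≤ 𝒮.sqFun θ g * 𝒮.dual.sqFun (1 - θ) m :=
      lintegral_mul_mul_sq_le
        ((by fun_prop : Measurable fun t : ℝ => ENNReal.ofReal (t ^ (-θ))).aemeasurable.mul
          (aemeasurable_of_continuousAt fun t ht => 𝒮.continuousAt_resQ ht g))
        ((by fun_prop : Measurable fun t : ℝ => ENNReal.ofReal (t ^ (-(1 - θ)))).aemeasurable.mul
          (aemeasurable_of_continuousAt fun t ht => 𝒮.dual.continuousAt_resQ ht m))
        (by fun_prop)
    -- Squares are compared to keep square roots out of the extended reals.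
    have h2 : (2 * J) ^ 2 ≤ ENNReal.ofReal D ^ 2 := by
      calc (2 * J) ^ 2 = 4 * J ^ 2 := by ring
        _ ≤ 4 * (ENNReal.ofReal (M ^ 2) *
            ENNReal.ofReal (sqFunConst (1 - θ) * ‖𝒮.dual.fracInt θ n‖ ^ 2)) := by
          gcongr
          exact h1.trans (by gcongr)
        _ = _ := by
          rw [← ENNReal.ofReal_pow hD0, ← ENNReal.ofReal_mul (by positivity),
            show (4 : ℝ≥0∞) = ENNReal.ofReal 4 by simp, ← ENNReal.ofReal_mul (by norm_num), hD]
          congr 1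
          rw [mul_pow, mul_pow, mul_pow, Real.sq_sqrt (sqFunConst_nonneg _)]
          ring
    exact le_of_not_gt fun hlt => h2.not_gt (ENNReal.pow_lt_pow_left two_ne_zero hlt)
  set Φ : ℝ → ℝ := fun t => ⟪𝒮.resP t g, 𝒮.dual.resP t n⟫ with hΦ
  have hderiv : ∀ t, 0 < t → HasDerivAt Φ
      (-(2 * t⁻¹ * ⟪𝒮.resP t (𝒮.resQ t g), t⁻¹ • 𝒮.dual.resQ t m⟫)) t := fun t ht => by
    refine ((𝒮.hasDerivAt_resP ht g).inner ℝ (𝒮.dual.hasDerivAt_resP ht n)).congr_deriv ?_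
    -- This trades a resolvent of `n` for a `Q` of the smoother vector `m`.
    have h1 : t⁻¹ • 𝒮.dual.resQ t m = 𝒮.dual.resP t n := by
      rw [hm, 𝒮.dual.resQ_fracInt one_pos, 𝒮.dual.fracInt_one_resQ ht, smul_smul,
        inv_mul_cancel₀ ht.ne', one_smul]
    have h2 : ∀ h k : H, ⟪h, 𝒮.dual.resQ t k⟫ = ⟪𝒮.resQ t h, k⟫ := fun h k => by
      rw [resQ_apply, resQ_apply, inner_sub_left, inner_sub_right, 𝒮.inner_resP_left]
    rw [h1, inner_neg_right, inner_neg_left, inner_smul_left, inner_smul_right,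
      𝒮.dual.resP_resQ, h2, ← 𝒮.resP_resQ, 𝒮.resP_resQ, ← 𝒮.resP_resQ]
    simp only [conj_trivial]
    ring
  have hdiff : ∀ a b, 0 < a → a < b → |Φ b - Φ a| ≤ D := by
    intro a b ha hab
    have hpos : ∀ t ∈ Icc a b, 0 < t := fun t ht => ha.trans_le ht.1
    have hcont : ContinuousOn
        (fun t => -(2 * t⁻¹ * ⟪𝒮.resP t (𝒮.resQ t g), t⁻¹ • 𝒮.dual.resQ t m⟫)) (Icc a b) := by
      intro t ht
      have ht0 := hpos t ht
      have c1 : ContinuousAt (fun t : ℝ => t⁻¹) t := continuousAt_inv₀ ht0.ne'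
      refine ContinuousAt.continuousWithinAt ?_
      exact ((continuousAt_const.mul c1).mul ((𝒮.continuousAt_resP_resQ ht0 g).inner (𝕜 := ℝ)
        (c1.smul (𝒮.dual.continuousAt_resQ ht0 m)))).neg
    have hint := hcont.intervalIntegrable_of_Icc (μ := volume) hab.le
    have hftc := intervalIntegral.integral_eq_sub_of_hasDerivAt
      (fun t ht => hderiv t (hpos t (by rwa [uIcc_of_le hab.le] at ht))) hint
    rw [← hftc, intervalIntegral.integral_of_le hab.le, ← Real.norm_eq_abs]
    have h1 : ‖∫ t in Ioc a b,
        -(2 * t⁻¹ * ⟪𝒮.resP t (𝒮.resQ t g), t⁻¹ • 𝒮.dual.resQ t m⟫)‖ₑ ≤ ENNReal.ofReal D := by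
      refine (enorm_integral_le_lintegral_enorm _).trans (le_trans ?_ hJ2)
      rw [hJ, ← lintegral_const_mul' _ _ (by norm_num)]
      refine le_trans ?_ (lintegral_mono_set (fun t ht => ha.trans ht.1 : Ioc a b ⊆ Ioi 0))
      refine setLIntegral_mono' measurableSet_Ioc fun t ht => ?_
      have ht0 : 0 < t := ha.trans ht.1
      have h3 : t ^ (-θ) * t ^ (-(1 - θ)) = t⁻¹ := by
        rw [← Real.rpow_add ht0, ← Real.rpow_neg_one]
        congr 1
        ring
      calc ‖-(2 * t⁻¹ * ⟪𝒮.resP t (𝒮.resQ t g), t⁻¹ • 𝒮.dual.resQ t m⟫)‖ₑ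
          ≤ ENNReal.ofReal (2 * (t⁻¹ * (‖𝒮.resQ t g‖ * (t⁻¹ * ‖𝒮.dual.resQ t m‖)))) := by
            rw [← ofReal_norm, norm_neg, norm_mul, norm_mul, Real.norm_ofNat,
              Real.norm_of_nonneg (inv_pos.2 ht0).le, mul_assoc]
            refine ENNReal.ofReal_le_ofReal ?_
            gcongr
            refine (norm_inner_le_norm _ _).trans ?_
            rw [norm_smul, Real.norm_of_nonneg (inv_pos.2 ht0).le]
            gcongr
            exact 𝒮.norm_resP_le ht0 _
        _ = ENNReal.ofReal (2 * ((t ^ (-θ) * ‖𝒮.resQ t g‖) *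
              (t ^ (-(1 - θ)) * ‖𝒮.dual.resQ t m‖) * t⁻¹)) := by
            congr 1
            rw [mul_mul_mul_comm, h3]
            ring
        _ = _ := by
            rw [ENNReal.ofReal_mul (by norm_num), ENNReal.ofReal_mul (by positivity),
              ENNReal.ofReal_mul (by positivity), ENNReal.ofReal_mul (by positivity),
              ENNReal.ofReal_mul (by positivity), ofReal_norm, ofReal_norm]
            simp
    rw [← ofReal_norm] at h1
    exact (ENNReal.ofReal_le_ofReal_iff hD0).1 h1
  have hlim0 : Tendsto Φ (𝓝[>] 0) (𝓝 ⟪g, n⟫) :=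
    (𝒮.tendsto_resP_zero g).inner (𝒮.dual.tendsto_resP_zero n)
  have hlimT : Tendsto Φ atTop (𝓝 0) := by
    have := (𝒮.tendsto_resP_atTop g).inner (𝕜 := ℝ) (𝒮.dual.tendsto_resP_atTop n)
    rwa [inner_zero_left] at this
  have h1 : ∀ a, 0 < a → |Φ a| ≤ D := fun a ha => by
    have h2 : Tendsto (fun b => |Φ b - Φ a|) atTop (𝓝 |0 - Φ a|) := (hlimT.sub_const _).abs
    rw [zero_sub, abs_neg] at h2
    refine le_of_tendsto h2 ?_
    filter_upwards [eventually_gt_atTop a] with b hb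
    exact hdiff a b ha hb
  refine le_of_tendsto hlim0.abs ?_
  filter_upwards [self_mem_nhdsWithin] with a ha
  exact h1 a ha

/-- An element with finite square function is a fractional integral. -/
theorem exists_fracInt_eq_of_sqFun_le {θ M : ℝ} (hθ : 0 < θ) (hθ1 : θ < 1) (hM0 : 0 ≤ M) {g : H}
    (hM : 𝒮.sqFun θ g ≤ ENNReal.ofReal (M ^ 2)) :
    ∃ h, 𝒮.fracInt θ h = g ∧ ‖h‖ ≤ 2 * √(sqFunConst (1 - θ)) * M :=
  exists_eq_of_abs_inner_le (fun h n => 𝒮.inner_fracInt_left hθ h n) (by positivity)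
    (𝒮.abs_inner_le_of_sqFun_le hθ hθ1 hM0 hM)

end NilpotentShift

/-! ### The constants that measure the sector -/

/-- `∫_0^∞ r^{-β} e^{-r} cos (r/2) dr` -/
def cosConst (β : ℝ) : ℝ := ∫ r in Ioi 0, r ^ (-β) * Real.exp (-r) * Real.cos (r / 2)

/-- `∫_0^∞ r^{-β} e^{-r} sin (r/2) dr` -/
def sinConst (β : ℝ) : ℝ := ∫ r in Ioi 0, r ^ (-β) * Real.exp (-r) * Real.sin (r / 2)

theorem integrableOn_rpow_mul_exp_mul {β x : ℝ} (hβ1 : β < 1) (hx : 0 < x) {f : ℝ → ℝ}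
    (hf : Continuous f) (hf1 : ∀ r, |f r| ≤ 1) :
    IntegrableOn (fun r : ℝ => r ^ (-β) * Real.exp (-(x * r)) * f r) (Ioi 0) := by
  have h1 := integrableOn_rpow_mul_exp_neg_mul (a := 1 - β) (by linarith) hx
  rw [show (1 : ℝ) - β - 1 = -β by ring] at h1
  exact Integrable.mul_bdd (c := 1) h1 hf.aestronglyMeasurable (Eventually.of_forall hf1)

theorem sub_sq_le_sin {y : ℝ} (hy : 0 ≤ y) : y - y ^ 2 ≤ Real.sin y := by
  rcases le_or_gt y 1 with h1 | h1
  · rcases hy.eq_or_lt with rfl | h0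
    · simp
    · have := Real.sin_gt_sub_cube h0
      nlinarith [mul_nonneg (sq_nonneg y) (by linarith : (0 : ℝ) ≤ 1 - y / 6)]
  · rcases le_or_gt y 2 with h2 | h2
    · have := Real.sin_nonneg_of_nonneg_of_le_pi hy (h2.trans Real.two_le_pi)
      nlinarith
    · have := Real.neg_one_le_sin y
      nlinarith

/-- Inserting `sin y ≥ y - y²` at `y = r/2` leaves `Γ(2-β)/2 - Γ(3-β)/4 = (β/4) Γ(2-β) > 0`. -/
theorem sinConst_pos {β : ℝ} (hβ : 0 < β) (hβ1 : β < 1) : 0 < sinConst β := by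
  have i1 := integrableOn_rpow_mul_exp_neg_mul (a := 2 - β) (by linarith) one_pos
  have i2 := integrableOn_rpow_mul_exp_neg_mul (a := 3 - β) (by linarith) one_pos
  have e1 := Real.integral_rpow_mul_exp_neg_mul_Ioi (a := 2 - β) (by linarith) one_pos
  have e2 := Real.integral_rpow_mul_exp_neg_mul_Ioi (a := 3 - β) (by linarith) one_pos
  simp only [div_one, Real.one_rpow, one_mul] at i1 i2 e1 e2
  have h3 : Real.Gamma (3 - β) = (2 - β) * Real.Gamma (2 - β) := by
    rw [← Real.Gamma_add_one (by linarith)]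
    congr 1
    ring
  have hle : ∫ r in Ioi 0, (2⁻¹ * (r ^ (2 - β - 1) * Real.exp (-r)) -
      4⁻¹ * (r ^ (3 - β - 1) * Real.exp (-r))) ≤ sinConst β := by
    refine setIntegral_mono_on ((i1.const_mul _).sub (i2.const_mul _)) ?_ measurableSet_Ioi ?_
    · have := integrableOn_rpow_mul_exp_mul hβ1 one_pos
        (f := fun r => Real.sin (r / 2)) (by fun_prop) (fun r => Real.abs_sin_le_one _)
      simpa using this
    · intro r hr
      have hr0 : (0 : ℝ) < r := hr
      have p1 : r ^ (2 - β - 1) = r ^ (-β) * r := by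
        rw [← Real.rpow_add_one hr0.ne']
        congr 1
        ring
      have p2 : r ^ (3 - β - 1) = r ^ (-β) * r ^ 2 := by
        rw [← Real.rpow_add_natCast hr0.ne']
        congr 1
        push_cast
        ring
      rw [p1, p2]
      calc 2⁻¹ * (r ^ (-β) * r * Real.exp (-r)) - 4⁻¹ * (r ^ (-β) * r ^ 2 * Real.exp (-r))
          = r ^ (-β) * Real.exp (-r) * (r / 2 - (r / 2) ^ 2) := by ring
        _ ≤ _ := by
          gcongr
          exact sub_sq_le_sin (by positivity)
  rw [integral_sub (i1.const_mul _) (i2.const_mul _), integral_const_mul, integral_const_mul,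
    e1, e2, h3] at hle
  refine lt_of_lt_of_le ?_ hle
  have : 0 < Real.Gamma (2 - β) := Real.Gamma_pos_of_pos (by linarith)
  have h4 : 2⁻¹ * Real.Gamma (2 - β) - 4⁻¹ * ((2 - β) * Real.Gamma (2 - β)) =
      β / 4 * Real.Gamma (2 - β) := by ring
  rw [h4]
  positivity

theorem integral_rpow_mul_exp_mul_comp {β x : ℝ} (hx : 0 < x) (f : ℝ → ℝ) :
    ∫ r in Ioi 0, r ^ (-β) * Real.exp (-(x * r)) * f (x * r) =
      x ^ (β - 1) * ∫ r in Ioi 0, r ^ (-β) * Real.exp (-r) * f r := by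
  have h1 := integral_comp_mul_left_Ioi (fun r => r ^ (-β) * Real.exp (-r) * f r) 0 hx
  rw [mul_zero, smul_eq_mul] at h1
  have h2 : x ^ (β - 1) = x ^ β * x⁻¹ := by
    rw [Real.rpow_sub_one hx.ne', div_eq_mul_inv]
  rw [h2, mul_assoc, ← h1, ← integral_const_mul]
  refine setIntegral_congr_fun measurableSet_Ioi fun r hr => ?_
  have hr0 : (0 : ℝ) < r := hr
  rw [Real.mul_rpow hx.le hr0.le, Real.rpow_neg hx.le]
  have := (Real.rpow_pos_of_pos hx β).ne'
  field_simp

/-! ### Sectoriality and the resolvent estimate -/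

namespace NilpotentShift

set_option linter.unusedSectionVars false

variable {H : Type*} [NormedAddCommGroup H] [InnerProductSpace ℝ H] {T : ℝ} [CompleteSpace H]
  (𝒮 : NilpotentShift H T)

theorem integrableOn_smul_S {k : ℝ → ℝ} (hk : Continuous k) (h : H) :
    IntegrableOn (fun x => k x • 𝒮.S x h) (Ioi 0) := by
  have h1 : IntegrableOn (fun x => k x • 𝒮.S x h) (Ioc 0 (max T 0)) :=
    ((hk.smul (𝒮.continuous h)).integrableOn_Icc).mono_set Ioc_subset_Icc_self
  have h2 : IntegrableOn (fun x => k x • 𝒮.S x h) (Ioi (max T 0)) := by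
    refine integrableOn_zero.congr_fun (fun x hx => ?_) measurableSet_Ioi
    simp only
    rw [𝒮.eq_zero x (le_trans (le_trans (le_max_left _ _) (le_of_lt hx)) (le_abs_self x)),
      smul_zero]
  have := h1.union h2
  rwa [Ioc_union_Ioi_eq_Ioi (le_max_right _ _)] at this

/-- Put `ζ = p + iq`. The operators `e^{-(a+ib)x} S(x)`, `x ≥ 0`, form a contraction semigroup on
the complexification, so the real part of `⟪∫ e^{-(a+ib)x} S(x) ζ dx, ζ⟫` is nonnegative. The
functions `f₁` and `f₂` below are the real and imaginary parts of the orbit of `ζ`. -/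
theorem rotation_nonneg {a : ℝ} (ha : 0 ≤ a) (b : ℝ) (p q : H) :
    0 ≤ ∫ x in Ioo 0 T, Real.exp (-(a * x)) *
      (Real.cos (b * x) * (⟪𝒮.S x p, p⟫ + ⟪𝒮.S x q, q⟫) +
        Real.sin (b * x) * (⟪𝒮.S x q, p⟫ - ⟪𝒮.S x p, q⟫)) := by
  set c : ℝ → ℝ := fun x => Real.exp (-(a * x)) * Real.cos (b * x) with hc
  set s : ℝ → ℝ := fun x => Real.exp (-(a * x)) * Real.sin (b * x) with hs
  have hcc : Continuous c := by fun_prop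
  have hsc : Continuous s := by fun_prop
  set f₁ : ℝ → H := fun x => c x • 𝒮.S x p + s x • 𝒮.S x q with hf₁
  set f₂ : ℝ → H := fun x => c x • 𝒮.S x q - s x • 𝒮.S x p with hf₂
  have h₁ : Continuous f₁ := (hcc.smul (𝒮.continuous p)).add (hsc.smul (𝒮.continuous q))
  have h₂ : Continuous f₂ := (hcc.smul (𝒮.continuous q)).sub (hsc.smul (𝒮.continuous p))
  have i₁ : IntegrableOn f₁ (Ioi 0) :=
    (𝒮.integrableOn_smul_S hcc p).add (𝒮.integrableOn_smul_S hsc q)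
  have i₂ : IntegrableOn f₂ (Ioi 0) :=
    (𝒮.integrableOn_smul_S hcc q).sub (𝒮.integrableOn_smul_S hsc p)
  have hcadd : ∀ x y, c (x + y) = c x * c y - s x * s y := fun x y => by
    simp only [hc, hs]
    rw [mul_add, mul_add, Real.cos_add, neg_add, Real.exp_add]
    ring
  have hsadd : ∀ x y, s (x + y) = s x * c y + c x * s y := fun x y => by
    simp only [hc, hs]
    rw [mul_add, mul_add, Real.sin_add, neg_add, Real.exp_add]
    ring
  have key := inner_integral_Ioi_nonneg h₁ h₂ i₁ i₂ (fun x hx => ?_)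
  · have e0 : f₁ 0 = p ∧ f₂ 0 = q := by simp [hf₁, hf₂, hc, hs, 𝒮.zero]
    rw [e0.1, e0.2, real_inner_comm, ← integral_inner i₁, real_inner_comm, ← integral_inner i₂,
      ← integral_add (i₁.const_inner p) (i₂.const_inner q)] at key
    refine key.trans_eq ?_
    symm
    refine (setIntegral_eq_of_subset_of_forall_sdiff_eq_zero measurableSet_Ioi
      Ioo_subset_Ioi_self fun x hx => ?_).symm.trans ?_
    · have : T ≤ x := by
        by_contra hlt
        exact hx.2 ⟨hx.1, not_le.1 hlt⟩
      simp [𝒮.eq_zero x (this.trans (le_abs_self x))]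
    · refine integral_congr_ae (Eventually.of_forall fun x => ?_)
      simp only [hf₁, hf₂, hc, hs, inner_add_right, inner_sub_right, real_inner_smul_right,
        real_inner_comm p, real_inner_comm q]
      ring
  · set W₁ := ∫ y in Ioi 0, f₁ y with hW₁
    set W₂ := ∫ y in Ioi 0, f₂ y with hW₂
    have hx0 : 0 ≤ x := hx.le
    have j : ∀ (k : ℝ) (f : ℝ → H), IntegrableOn f (Ioi 0) →
        IntegrableOn (fun y => k • 𝒮.S x (f y)) (Ioi 0) :=
      fun k f hf => ((𝒮.S x).integrable_comp hf).smul k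
    have r₁ : ∫ y in Ioi x, f₁ y = c x • 𝒮.S x W₁ + s x • 𝒮.S x W₂ := by
      rw [hW₁, hW₂, ← ContinuousLinearMap.integral_comp_comm _ i₁,
        ← ContinuousLinearMap.integral_comp_comm _ i₂, ← integral_smul, ← integral_smul,
        ← integral_add (j _ _ i₁) (j _ _ i₂),
        integral_Ioi_eq_integral_Ioi_zero]
      refine setIntegral_congr_fun measurableSet_Ioi fun y hy => ?_
      simp only [hf₁, hf₂, map_add, map_sub, map_smul, ← 𝒮.add x y hx0 (le_of_lt hy), hcadd, hsadd]
      module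
    have r₂ : ∫ y in Ioi x, f₂ y = c x • 𝒮.S x W₂ - s x • 𝒮.S x W₁ := by
      rw [hW₁, hW₂, ← ContinuousLinearMap.integral_comp_comm _ i₁,
        ← ContinuousLinearMap.integral_comp_comm _ i₂, ← integral_smul, ← integral_smul,
        ← integral_sub (j _ _ i₂) (j _ _ i₁),
        integral_Ioi_eq_integral_Ioi_zero]
      refine setIntegral_congr_fun measurableSet_Ioi fun y hy => ?_
      simp only [hf₁, hf₂, map_add, map_sub, map_smul, ← 𝒮.add x y hx0 (le_of_lt hy), hcadd, hsadd]
      module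
    have hn₁ := 𝒮.norm_le x W₁
    have hn₂ := 𝒮.norm_le x W₂
    have hcs : c x ^ 2 + s x ^ 2 ≤ 1 := by
      have h1 : c x ^ 2 + s x ^ 2 = Real.exp (-(a * x)) ^ 2 := by
        simp only [hc, hs, mul_pow]
        rw [← mul_add, Real.cos_sq_add_sin_sq, mul_one]
      rw [h1]
      have h2 : Real.exp (-(a * x)) ≤ 1 := Real.exp_le_one_iff.2 (by nlinarith)
      exact pow_le_one₀ (Real.exp_pos _).le h2
    have e : ‖c x • 𝒮.S x W₁ + s x • 𝒮.S x W₂‖ ^ 2 + ‖c x • 𝒮.S x W₂ - s x • 𝒮.S x W₁‖ ^ 2 =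
        (c x ^ 2 + s x ^ 2) * (‖𝒮.S x W₁‖ ^ 2 + ‖𝒮.S x W₂‖ ^ 2) := by
      rw [norm_add_sq_real, norm_sub_sq_real, norm_smul, norm_smul, norm_smul, norm_smul,
        real_inner_smul_left, real_inner_smul_right, real_inner_smul_left, real_inner_smul_right,
        real_inner_comm (𝒮.S x W₁)]
      simp only [mul_pow, Real.norm_eq_abs, sq_abs]
      ring
    rw [r₁, r₂, e]
    calc _ ≤ 1 * (‖𝒮.S x W₁‖ ^ 2 + ‖𝒮.S x W₂‖ ^ 2) := by gcongr
      _ ≤ _ := by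
        rw [one_mul]
        gcongr

/-- The kernel `x^{β-1}` is a superposition of exponentials: `∫ r^{-β} e^{-(1+i/2)rx} dr =
x^{β-1}(cosConst β - i sinConst β)`. Averaging the accretivity of the rotated semigroups with `a =
r`, `b = r/2` therefore says that the numerical range of `I^β`, multiplied by this constant, stays
in the right half-plane. As `sinConst β > 0` this is strictly stronger than accretivity, conjugation
supplying the opposite rotation. -/
theorem sectorial {β : ℝ} (hβ : 0 < β) (hβ1 : β < 1) (p q : H) :
    0 ≤ cosConst β * (⟪𝒮.fracInt β p, p⟫ + ⟪𝒮.fracInt β q, q⟫) +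
      sinConst β * (⟪𝒮.fracInt β q, p⟫ - ⟪𝒮.fracInt β p, q⟫) := by
  set A : ℝ → ℝ := fun x => ⟪𝒮.S x p, p⟫ + ⟪𝒮.S x q, q⟫ with hA
  set C : ℝ → ℝ := fun x => ⟪𝒮.S x q, p⟫ - ⟪𝒮.S x p, q⟫ with hC
  have hAc : Continuous A := (𝒮.continuous_inner p p).add (𝒮.continuous_inner q q)
  have hCc : Continuous C := (𝒮.continuous_inner q p).sub (𝒮.continuous_inner p q)
  set M := (‖p‖ * ‖p‖ + ‖q‖ * ‖q‖) + (‖q‖ * ‖p‖ + ‖p‖ * ‖q‖) with hM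
  have hAM : ∀ x, |A x| ≤ ‖p‖ * ‖p‖ + ‖q‖ * ‖q‖ := fun x =>
    (abs_add_le _ _).trans (add_le_add (𝒮.abs_inner_le x p p) (𝒮.abs_inner_le x q q))
  have hCM : ∀ x, |C x| ≤ ‖q‖ * ‖p‖ + ‖p‖ * ‖q‖ := fun x =>
    (abs_sub _ _).trans (add_le_add (𝒮.abs_inner_le x q p) (𝒮.abs_inner_le x p q))
  set E : ℝ → ℝ → ℝ := fun r x =>
    Real.cos (2⁻¹ * r * x) * A x + Real.sin (2⁻¹ * r * x) * C x with hE
  have hEM : ∀ r x, |E r x| ≤ M := fun r x => by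
    refine (abs_add_le _ _).trans ?_
    rw [abs_mul, abs_mul, hM]
    refine add_le_add ?_ ?_
    · exact (mul_le_of_le_one_left (abs_nonneg _) (Real.abs_cos_le_one _)).trans (hAM x)
    · exact (mul_le_of_le_one_left (abs_nonneg _) (Real.abs_sin_le_one _)).trans (hCM x)
  set G : ℝ → ℝ → ℝ := fun r x => r ^ (-β) * (Real.exp (-(r * x)) * E r x) with hG
  have hEc : Continuous (Function.uncurry E) := by
    simp only [hE, Function.uncurry_def]
    fun_prop
  have hGm : Measurable (Function.uncurry G) := by
    have := hEc.measurable
    simp only [Function.uncurry_def] at this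
    simp only [hG, Function.uncurry_def]
    fun_prop
  have hval : ∀ x ∈ Ioo 0 T, ∫ r in Ioi 0, G r x =
      cosConst β * (x ^ (β - 1) * A x) + sinConst β * (x ^ (β - 1) * C x) := by
    intro x hx
    have e1 : ∀ r, G r x = r ^ (-β) * Real.exp (-(x * r)) * Real.cos (x * r / 2) * A x +
        r ^ (-β) * Real.exp (-(x * r)) * Real.sin (x * r / 2) * C x := fun r => by
      simp only [hG, hE]
      rw [show 2⁻¹ * r * x = x * r / 2 by ring, mul_comm r x]
      ring
    have j1 := integrableOn_rpow_mul_exp_mul hβ1 hx.1 (f := fun r => Real.cos (x * r / 2))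
      (by fun_prop) (fun r => Real.abs_cos_le_one _)
    have j2 := integrableOn_rpow_mul_exp_mul hβ1 hx.1 (f := fun r => Real.sin (x * r / 2))
      (by fun_prop) (fun r => Real.abs_sin_le_one _)
    simp only [e1]
    rw [integral_add (j1.mul_const _) (j2.mul_const _), integral_mul_const, integral_mul_const,
      integral_rpow_mul_exp_mul_comp hx.1 (fun r => Real.cos (r / 2)),
      integral_rpow_mul_exp_mul_comp hx.1 (fun r => Real.sin (r / 2)), cosConst, sinConst]
    ring
  have hint : Integrable (Function.uncurry G)
      ((volume.restrict (Ioi 0)).prod (volume.restrict (Ioo 0 T))) := by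
    have hdom : ∀ r ∈ Ioi (0 : ℝ), ∀ x, ‖G r x‖ ≤ r ^ (-β) * Real.exp (-(x * r)) * M := by
      intro r hr x
      have hr0 : (0 : ℝ) < r := hr
      simp only [hG, norm_mul, Real.norm_eq_abs]
      rw [abs_of_pos (Real.rpow_pos_of_pos hr0 _), abs_of_pos (Real.exp_pos _), ← mul_assoc,
        mul_comm r x]
      gcongr
      exact hEM r x
    have hi : ∀ x ∈ Ioo 0 T,
        IntegrableOn (fun r : ℝ => r ^ (-β) * Real.exp (-(x * r)) * M) (Ioi 0) := fun x hx => by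
      have := integrableOn_rpow_mul_exp_neg_mul (a := 1 - β) (by linarith) hx.1
      rw [show (1 : ℝ) - β - 1 = -β by ring] at this
      exact this.mul_const M
    rw [integrable_prod_iff' hGm.aestronglyMeasurable]
    constructor
    · filter_upwards [ae_restrict_mem measurableSet_Ioo] with x hx
      refine (hi x hx).mono' (hGm.comp measurable_prodMk_right).aestronglyMeasurable ?_
      filter_upwards [ae_restrict_mem measurableSet_Ioi] with r hr
      exact hdom r hr x
    · have hb : IntegrableOn (fun x : ℝ => x ^ (β - 1) * (Real.Gamma (1 - β) * M)) (Ioo 0 T) :=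
        (integrableOn_rpow_sub_one hβ T).mul_const _
      refine hb.mono' ?_ ?_
      · exact hGm.aestronglyMeasurable.norm.prod_swap.integral_prod_right'
      · filter_upwards [ae_restrict_mem measurableSet_Ioo] with x hx
        rw [Real.norm_of_nonneg (integral_nonneg fun r => norm_nonneg _)]
        refine (integral_mono_of_nonneg (Eventually.of_forall fun r => norm_nonneg _) (hi x hx)
          ?_).trans_eq ?_
        · filter_upwards [ae_restrict_mem measurableSet_Ioi] with r hr
          exact hdom r hr x
        · have := Real.integral_rpow_mul_exp_neg_mul_Ioi (a := 1 - β) (by linarith) hx.1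
          rw [show (1 : ℝ) - β - 1 = -β by ring, one_div, Real.inv_rpow hx.1.le,
            ← Real.rpow_neg hx.1.le, neg_sub] at this
          rw [integral_mul_const, this]
          ring
  have hnn : 0 ≤ ∫ r in Ioi 0, ∫ x in Ioo 0 T, G r x := by
    refine setIntegral_nonneg measurableSet_Ioi fun r hr => ?_
    have hr0 : (0 : ℝ) < r := hr
    simp only [hG]
    rw [integral_const_mul]
    exact mul_nonneg (Real.rpow_nonneg hr0.le _) (𝒮.rotation_nonneg hr0.le (2⁻¹ * r) p q)
  rw [integral_integral_swap hint, setIntegral_congr_fun measurableSet_Ioo hval] at hnn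
  have hk := integrableOn_fracKernel hβ T
  have hx := integrableOn_rpow_sub_one hβ T
  have jA : IntegrableOn (fun x => x ^ (β - 1) * A x) (Ioo 0 T) :=
    hx.mul_bdd (c := ‖p‖ * ‖p‖ + ‖q‖ * ‖q‖) hAc.aestronglyMeasurable (Eventually.of_forall hAM)
  have jC : IntegrableOn (fun x => x ^ (β - 1) * C x) (Ioo 0 T) :=
    hx.mul_bdd (c := ‖q‖ * ‖p‖ + ‖p‖ * ‖q‖) hCc.aestronglyMeasurable (Eventually.of_forall hCM)
  rw [integral_add (jA.const_mul _) (jC.const_mul _), integral_const_mul, integral_const_mul] at hnn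
  have eA : ⟪𝒮.fracInt β p, p⟫ + ⟪𝒮.fracInt β q, q⟫ =
      (Real.Gamma β)⁻¹ * ∫ x in Ioo 0 T, x ^ (β - 1) * A x := by
    rw [fracInt, 𝒮.inner_kernelOp hk, 𝒮.inner_kernelOp hk, ← integral_const_mul,
      ← integral_add (𝒮.integrableOn_mul_inner hk p p) (𝒮.integrableOn_mul_inner hk q q)]
    refine integral_congr_ae (Eventually.of_forall fun x => ?_)
    simp only [hA]
    ring
  have eC : ⟪𝒮.fracInt β q, p⟫ - ⟪𝒮.fracInt β p, q⟫ =
      (Real.Gamma β)⁻¹ * ∫ x in Ioo 0 T, x ^ (β - 1) * C x := by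
    rw [fracInt, 𝒮.inner_kernelOp hk, 𝒮.inner_kernelOp hk, ← integral_const_mul,
      ← integral_sub (𝒮.integrableOn_mul_inner hk q p) (𝒮.integrableOn_mul_inner hk p q)]
    refine integral_congr_ae (Eventually.of_forall fun x => ?_)
    simp only [hC]
    ring
  rw [eA, eC]
  have := Real.Gamma_pos_of_pos hβ
  calc 0 ≤ (Real.Gamma β)⁻¹ * _ := mul_nonneg (inv_pos.2 this).le hnn
    _ = _ := by ring

/-- The constant in the resolvent estimate for the fractional integral of order `2β`. -/
def resolventConst (β : ℝ) : ℝ := (|cosConst β| + sinConst β) / sinConst β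

/-- With `μ² = l` and `ζ = (1 + iμ I^β) h = h + iq`, the vector `g = h + l I^{2β} h` equals `(1 - iμ
I^β) ζ`. Sectoriality at `ζ` bounds `‖ζ‖` by `‖g‖`, and `‖h‖ ≤ ‖ζ‖`. -/
theorem norm_le_norm_add_fracInt {β l : ℝ} (hβ : 0 < β) (hβ1 : β < 1) (hl : 0 ≤ l) (h : H) :
    ‖h‖ ≤ resolventConst β * ‖h + l • 𝒮.fracInt (2 * β) h‖ := by
  set μ := √l
  have hμ : μ * μ = l := Real.mul_self_sqrt hl
  have hs := sinConst_pos hβ hβ1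
  set B := 𝒮.fracInt β
  have hBB : 𝒮.fracInt (2 * β) h = B (B h) := by rw [𝒮.fracInt_fracInt hβ hβ, two_mul]
  set q := μ • B h with hq
  set g := h + l • 𝒮.fracInt (2 * β) h with hg
  have hg' : μ • B q = g - h := by
    rw [hg, hBB, hq, map_smul, smul_smul, hμ]
    abel
  have h1 := mul_nonneg (Real.sqrt_nonneg l) (𝒮.sectorial hβ hβ1 h q)
  have h2 : μ * (cosConst β * (⟪B h, h⟫ + ⟪B q, q⟫) + sinConst β * (⟪B q, h⟫ - ⟪B h, q⟫)) =
      cosConst β * ⟪g, q⟫ + sinConst β * (⟪g, h⟫ - (‖h‖ ^ 2 + ‖q‖ ^ 2)) := by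
    have a1 : μ * ⟪B q, q⟫ = ⟪g, q⟫ - ⟪h, q⟫ := by
      rw [← real_inner_smul_left, hg', inner_sub_left]
    have a2 : μ * ⟪B q, h⟫ = ⟪g, h⟫ - ‖h‖ ^ 2 := by
      rw [← real_inner_smul_left, hg', inner_sub_left, real_inner_self_eq_norm_sq]
    have a3 : μ * ⟪B h, h⟫ = ⟪h, q⟫ := by
      rw [← real_inner_smul_left, real_inner_comm]
    have a4 : μ * ⟪B h, q⟫ = ‖q‖ ^ 2 := by
      rw [← real_inner_smul_left, real_inner_self_eq_norm_sq]
    linear_combination cosConst β * (a1 + a3) + sinConst β * (a2 - a4)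
  rw [h2] at h1
  -- The norm of `ζ` in the complexification.
  set N := √(‖h‖ ^ 2 + ‖q‖ ^ 2) with hN
  have hN2 : N ^ 2 = ‖h‖ ^ 2 + ‖q‖ ^ 2 := Real.sq_sqrt (by positivity)
  have hhN : ‖h‖ ≤ N := Real.le_sqrt_of_sq_le (by nlinarith [sq_nonneg ‖q‖])
  have hqN : ‖q‖ ≤ N := Real.le_sqrt_of_sq_le (by nlinarith [sq_nonneg ‖h‖])
  have b1 : cosConst β * ⟪g, q⟫ ≤ |cosConst β| * (‖g‖ * N) := by
    refine (le_abs_self _).trans ?_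
    rw [abs_mul]
    gcongr
    exact (abs_real_inner_le_norm _ _).trans (by gcongr)
  have b2 : sinConst β * ⟪g, h⟫ ≤ sinConst β * (‖g‖ * N) := by
    gcongr
    exact (real_inner_le_norm _ _).trans (by gcongr)
  have b3 : sinConst β * (N * N) ≤ (|cosConst β| + sinConst β) * ‖g‖ * N := by
    nlinarith
  have b4 : sinConst β * N ≤ (|cosConst β| + sinConst β) * ‖g‖ := by
    rcases (Real.sqrt_nonneg (‖h‖ ^ 2 + ‖q‖ ^ 2)).eq_or_lt with h0 | h0
    · rw [hN, ← h0, mul_zero]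
      positivity
    · exact le_of_mul_le_mul_right (by rw [mul_assoc]; exact b3) h0
  rw [resolventConst, div_mul_eq_mul_div, le_div_iff₀ hs, mul_comm]
  exact (by gcongr : sinConst β * ‖h‖ ≤ sinConst β * N).trans b4

theorem resolventConst_nonneg {β : ℝ} (hβ : 0 < β) (hβ1 : β < 1) : 0 ≤ resolventConst β := by
  have := sinConst_pos hβ hβ1
  unfold resolventConst
  positivity

/-- The a priori estimate for the adjoint semigroup is the lower bound that the surjectivity
criterion asks for, with the same constant. -/
theorem exists_add_fracInt_eq {β l : ℝ} (hβ : 0 < β) (hβ1 : β < 1) (hl : 0 ≤ l) (g : H) :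
    ∃ h, h + l • 𝒮.fracInt (2 * β) h = g ∧ ‖h‖ ≤ resolventConst β * ‖g‖ := by
  have hC := resolventConst_nonneg hβ hβ1
  refine exists_eq_of_abs_inner_le (M := resolventConst β * ‖g‖) (A := 1 + l • 𝒮.fracInt (2 * β))
    (B := 1 + l • 𝒮.dual.fracInt (2 * β)) (fun h n => ?_)
    (mul_nonneg hC (norm_nonneg g)) fun n => ?_
  · simp [inner_add_left, inner_add_right, real_inner_smul_left, real_inner_smul_right,
      𝒮.inner_fracInt_left (by linarith : 0 < 2 * β)]
  · calc |⟪g, n⟫| ≤ ‖g‖ * ‖n‖ := abs_real_inner_le_norm _ _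
      _ ≤ ‖g‖ * (resolventConst β * ‖n + l • 𝒮.dual.fracInt (2 * β) n‖) := by
        gcongr
        exact 𝒮.dual.norm_le_norm_add_fracInt hβ hβ1 hl n
      _ = _ := by
        rw [← mul_assoc, mul_comm ‖g‖]
        rfl

end NilpotentShift

/-! ### Truncated translations on `L²(0,T)` -/

/-- Extension by zero. -/
def extendZero (T : ℝ) (h : BochnerL2 T ℝ) : Lp ℝ 2 (volume : Measure ℝ) :=
  MemLp.toLp ((Ioo 0 T).indicator h) ((memLp_indicator_iff_restrict measurableSet_Ioo).2 (Lp.memLp h))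

theorem extendZero_coe (T : ℝ) (h : BochnerL2 T ℝ) :
    extendZero T h =ᵐ[volume] (Ioo 0 T).indicator h := MemLp.coeFn_toLp _

theorem norm_extendZero (T : ℝ) (h : BochnerL2 T ℝ) : ‖extendZero T h‖ = ‖h‖ := by
  rw [extendZero, Lp.norm_toLp, eLpNorm_indicator_eq_eLpNorm_restrict measurableSet_Ioo, Lp.norm_def]

/-- The truncated translate `t ↦ h (x + t)`. -/
def shiftFun (T x : ℝ) (h : BochnerL2 T ℝ) : BochnerL2 T ℝ :=
  LpToLpRestrictCLM ℝ ℝ ℝ volume 2 (Ioo 0 T) (DomAddAct.mk x +ᵥ extendZero T h)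

theorem shiftFun_coe (T x : ℝ) (h : BochnerL2 T ℝ) :
    shiftFun T x h =ᵐ[volume.restrict (Ioo 0 T)] fun t => (Ioo 0 T).indicator h (x + t) := by
  have h1 := LpToLpRestrictCLM_coeFn (p := 2) (μ := volume) ℝ (Ioo 0 T)
    (DomAddAct.mk x +ᵥ extendZero T h)
  have h2 : ↑↑(DomAddAct.mk x +ᵥ extendZero T h) =ᵐ[volume]
      fun t => extendZero T h (x + t) := DomAddAct.vadd_Lp_ae_eq _ _
  have h3 := (measurePreserving_add_left volume x).quasiMeasurePreserving.ae_eq_comp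
    (extendZero_coe T h)
  exact h1.trans (ae_restrict_of_ae (h2.trans h3))

theorem norm_shiftFun_le (T x : ℝ) (h : BochnerL2 T ℝ) : ‖shiftFun T x h‖ ≤ ‖h‖ := by
  rw [← norm_extendZero T h, ← DomAddAct.norm_vadd_Lp (DomAddAct.mk x) (extendZero T h)]
  exact norm_Lp_toLp_restrict_le (Ioo 0 T) _

theorem continuous_shiftFun (T : ℝ) (h : BochnerL2 T ℝ) : Continuous fun x => shiftFun T x h := by
  have h1 : Continuous (fun x : ℝ => DomAddAct.mk x) := DomAddAct.mkHomeomorph.continuous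
  have h2 : Fact ((2 : ℝ≥0∞) ≠ ⊤) := ⟨by norm_num⟩
  exact (LpToLpRestrictCLM ℝ ℝ ℝ volume 2 (Ioo 0 T)).continuous.comp (h1.vadd continuous_const)

/-- `shiftFun` as a continuous linear map. -/
def shiftCLM (T x : ℝ) : BochnerL2 T ℝ →L[ℝ] BochnerL2 T ℝ :=
  LinearMap.mkContinuous
    { toFun := shiftFun T x
      map_add' := fun h g => by
        have ext_add : extendZero T (h + g) = extendZero T h + extendZero T g := by
          refine Lp.ext ?_
          have h1 := (ae_restrict_iff' measurableSet_Ioo).1 (Lp.coeFn_add h g)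
          filter_upwards [extendZero_coe T (h + g), extendZero_coe T h, extendZero_coe T g,
            Lp.coeFn_add (extendZero T h) (extendZero T g), h1] with t h2 h3 h4 h5 h6
          rw [h2, h5, Pi.add_apply, h3, h4]
          by_cases ht : t ∈ Ioo 0 T
          · simp only [indicator_of_mem ht]
            exact h6 ht
          · simp [indicator_of_notMem ht]
        rw [shiftFun, ext_add, DomAddAct.vadd_Lp_add, map_add]
        rfl
      map_smul' := fun c h => by
        refine Lp.ext ?_
        have h1 := (ae_restrict_iff' measurableSet_Ioo).1 (Lp.coeFn_smul c h)
        have h2 := (measurePreserving_add_left volume x).quasiMeasurePreserving.ae h1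
        filter_upwards [shiftFun_coe T x (c • h), shiftFun_coe T x h,
          Lp.coeFn_smul c (shiftFun T x h), ae_restrict_of_ae h2] with t h3 h4 h5 h6
        rw [RingHom.id_apply, h3, h5, Pi.smul_apply, h4]
        by_cases ht : x + t ∈ Ioo 0 T
        · simp [indicator_of_mem ht, h6 ht]
        · simp [indicator_of_notMem ht] } 1
    fun h => (norm_shiftFun_le T x h).trans_eq (one_mul _).symm

theorem shiftCLM_coe (T x : ℝ) (h : BochnerL2 T ℝ) :
    shiftCLM T x h =ᵐ[volume.restrict (Ioo 0 T)] fun t => (Ioo 0 T).indicator h (x + t) :=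
  shiftFun_coe T x h

theorem inner_shiftCLM (T x : ℝ) (h g : BochnerL2 T ℝ) :
    ⟪shiftCLM T x h, g⟫ =
      ∫ s, (Ioo 0 T).indicator h s * (Ioo 0 T).indicator g (s - x) := by
  have h1 : ⟪shiftCLM T x h, g⟫ =
      ∫ t, (Ioo 0 T).indicator h (x + t) * (Ioo 0 T).indicator g t := by
    rw [L2.inner_def, ← integral_indicator measurableSet_Ioo]
    have h2 := (ae_restrict_iff' measurableSet_Ioo).1 (shiftCLM_coe T x h)
    refine integral_congr_ae ?_
    filter_upwards [h2] with t ht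
    by_cases h3 : t ∈ Ioo 0 T
    · simp only [indicator_of_mem h3, ht h3]
      exact mul_comm _ _
    · simp [indicator_of_notMem h3]
  rw [h1, ← integral_add_left_eq_self (fun s => (Ioo 0 T).indicator h s *
    (Ioo 0 T).indicator g (s - x)) x]
  simp only [add_sub_cancel_left]

/-- The semigroup of truncated translations on `L²(0,T)`. -/
def shiftSemigroup (T : ℝ) : NilpotentShift (BochnerL2 T ℝ) T where
  S := shiftCLM T
  norm_le x h := norm_shiftFun_le T x h
  zero h := by
    refine Lp.ext ?_
    filter_upwards [shiftCLM_coe T 0 h, ae_restrict_mem measurableSet_Ioo] with t h1 h2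
    rw [h1, zero_add, indicator_of_mem h2]
  add x y hx hy h := by
    refine Lp.ext ?_
    have h1 := (ae_restrict_iff' measurableSet_Ioo).1 (shiftCLM_coe T y h)
    have h2 := (measurePreserving_add_left volume x).quasiMeasurePreserving.ae h1
    filter_upwards [shiftCLM_coe T (x + y) h, shiftCLM_coe T x (shiftCLM T y h),
      ae_restrict_of_ae h2, ae_restrict_mem measurableSet_Ioo] with t h3 h4 h5 ht
    rw [h3, h4]
    by_cases hxt : x + t ∈ Ioo 0 T
    · rw [indicator_of_mem hxt, h5 hxt]
      congr 1
      ring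
    · rw [indicator_of_notMem hxt, indicator_of_notMem]
      intro h6
      -- For nonnegative shifts, truncating between two translations loses nothing: a point that
      -- ends in `(0,T)` was in it at the intermediate stage.
      exact hxt ⟨by linarith [ht.1], by linarith [h6.2]⟩
  eq_zero x hx h := by
    refine Lp.ext ?_
    filter_upwards [shiftCLM_coe T x h, Lp.coeFn_zero ℝ 2 (volume.restrict (Ioo 0 T)),
      ae_restrict_mem measurableSet_Ioo] with t h1 h2 ht
    rw [h1, h2, indicator_of_notMem]
    · rfl
    · intro h3
      rcases abs_cases x with h4 | h4
      · linarith [h3.2, ht.1]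
      · linarith [h3.1, ht.2]
  continuous h := continuous_shiftFun T h
  inner_left x h g := by
    rw [inner_shiftCLM, real_inner_comm, inner_shiftCLM,
      ← integral_sub_right_eq_self (fun s => (Ioo 0 T).indicator g s *
        (Ioo 0 T).indicator h (s - -x)) x]
    refine integral_congr_ae (Eventually.of_forall fun s => ?_)
    simp only [sub_neg_eq_add, sub_add_cancel]
    ring

theorem setIntegral_Ioo_eq_integral_indicator_mul {T t : ℝ} (ht : t ∈ Ioo 0 T) (k h : ℝ → ℝ) :
    ∫ s in Ioo t T, k (s - t) * h s =
      ∫ s, (Ioo 0 T).indicator h s * (Ioo 0 T).indicator k (s - t) := by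
  rw [← integral_indicator measurableSet_Ioo]
  refine integral_congr_ae (Eventually.of_forall fun s => ?_)
  by_cases hs : s ∈ Ioo t T
  · have h1 : s ∈ Ioo 0 T := ⟨ht.1.trans hs.1, hs.2⟩
    have h2 : s - t ∈ Ioo 0 T := ⟨by linarith [hs.1], by linarith [hs.2, ht.1]⟩
    simp only [indicator_of_mem hs, indicator_of_mem h1, indicator_of_mem h2]
    ring
  · simp only [indicator_of_notMem hs]
    by_cases h1 : s ∈ Ioo 0 T
    · have h2 : s - t ∉ Ioo 0 T := fun h => hs ⟨by linarith [h.1], h1.2⟩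
      rw [indicator_of_notMem h2, mul_zero]
    · rw [indicator_of_notMem h1, zero_mul]

/-- The operator is a Bochner integral in `L²`, which has no pointwise meaning a priori. Both sides
are therefore integrated over an arbitrary measurable set, and Fubini with the change of variable `x
= s - t` compares the results. -/
theorem kernelOp_shiftSemigroup_coe {T : ℝ} {k : ℝ → ℝ} (hk : IntegrableOn k (Ioo 0 T))
    (h : BochnerL2 T ℝ) :
    (shiftSemigroup T).kernelOp k h =ᵐ[volume.restrict (Ioo 0 T)]
      fun t => ∫ s in Ioo t T, k (s - t) * h s := by
  set K := (Ioo 0 T).indicator k with hK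
  set hh := (Ioo 0 T).indicator h with hhh
  have hKi : Integrable K := (integrable_indicator_iff measurableSet_Ioo).2 hk
  have hhi : Integrable hh :=
    (integrable_indicator_iff measurableSet_Ioo).2 (integrableOn_bochnerL2 h)
  have hint : Integrable (fun p : ℝ × ℝ => hh p.2 * K (p.2 - p.1)) (volume.prod volume) := by
    have := hhi.convolution_integrand (ContinuousLinearMap.mul ℝ ℝ) hKi.comp_neg
    simpa using this
  have hY : ∀ t ∈ Ioo 0 T, ∫ s, hh s * K (s - t) = ∫ s in Ioo t T, k (s - t) * h s :=
    fun t ht => (setIntegral_Ioo_eq_integral_indicator_mul ht k h).symm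
  have hYi : IntegrableOn (fun t => ∫ s, hh s * K (s - t)) (Ioo 0 T) :=
    hint.integral_prod_left.integrableOn
  refine EventuallyEq.trans ?_ (ae_restrict_of_forall_mem measurableSet_Ioo hY)
  refine Integrable.ae_eq_of_forall_setIntegral_eq _ _ (integrableOn_bochnerL2 _) hYi
    fun A hA hAfin => ?_
  set g : BochnerL2 T ℝ := indicatorConstLp 2 hA hAfin.ne (1 : ℝ) with hg
  rw [← L2.inner_indicatorConstLp_one hA hAfin.ne, real_inner_comm,
    (shiftSemigroup T).inner_kernelOp hk]
  -- A genuinely measurable representative of the test indicator, needed for joint measurability of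
  -- its translates.
  set gg := (Ioo 0 T ∩ A).indicator (fun _ => (1 : ℝ)) with hgg
  have hggm : Measurable gg := measurable_const.indicator (measurableSet_Ioo.inter hA)
  have hgg1 : ∀ s, ‖gg s‖ ≤ 1 := fun s => by
    by_cases hs : s ∈ Ioo 0 T ∩ A
    · simp [hgg, indicator_of_mem hs]
    · simp [hgg, indicator_of_notMem hs]
  have hggae : (Ioo 0 T).indicator g =ᵐ[volume] gg := by
    have h1 : g =ᵐ[volume.restrict (Ioo 0 T)] A.indicator fun _ => (1 : ℝ) :=
      indicatorConstLp_coeFn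
    filter_upwards [(ae_restrict_iff' measurableSet_Ioo).1 h1] with s hs
    by_cases hs1 : s ∈ Ioo 0 T
    · rw [indicator_of_mem hs1, hs hs1]
      rw [hgg, ← indicator_indicator, indicator_of_mem hs1]
    · rw [indicator_of_notMem hs1, hgg, indicator_of_notMem (fun h => hs1 h.1)]
  have hS : ∀ x, ⟪(shiftSemigroup T).S x h, g⟫ = ∫ s, hh s * gg (s - x) := fun x => by
    have e1 : ⟪(shiftSemigroup T).S x h, g⟫ =
      ∫ s, hh s * (Ioo 0 T).indicator g (s - x) := inner_shiftCLM T x h g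
    rw [e1]
    have h1 := (measurePreserving_sub_right volume x).quasiMeasurePreserving.ae_eq_comp hggae
    refine integral_congr_ae ?_
    filter_upwards [h1] with s hs
    simp only [Function.comp] at hs
    rw [hs]
  have i1 : Integrable (Function.uncurry fun x s => K x * (hh s * gg (s - x)))
      (volume.prod volume) := by
    have : Integrable (fun p : ℝ × ℝ => K p.1 * hh p.2 * gg (p.2 - p.1)) (volume.prod volume) :=
      Integrable.mul_bdd (c := 1) (hKi.mul_prod hhi)
        (hggm.comp (measurable_snd.sub measurable_fst)).aestronglyMeasurable
        (Eventually.of_forall fun p => hgg1 _)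
    refine this.congr (Eventually.of_forall fun p => ?_)
    simp only [Function.uncurry]
    ring
  have i2 : Integrable (Function.uncurry fun t s => gg t * (hh s * K (s - t)))
      (volume.prod volume) :=
    Integrable.bdd_mul (c := 1) hint (hggm.comp measurable_fst).aestronglyMeasurable
      (Eventually.of_forall fun p => hgg1 _)
  calc ∫ x in Ioo 0 T, k x * ⟪(shiftSemigroup T).S x h, g⟫
      = ∫ x, ∫ s, K x * (hh s * gg (s - x)) := by
        rw [← integral_indicator measurableSet_Ioo]
        refine integral_congr_ae (Eventually.of_forall fun x => ?_)
        simp only [integral_const_mul, ← hS]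
        by_cases hx : x ∈ Ioo 0 T
        · simp [hK, indicator_of_mem hx]
        · simp [hK, indicator_of_notMem hx]
    _ = ∫ s, ∫ x, K x * (hh s * gg (s - x)) := integral_integral_swap i1
    _ = ∫ s, ∫ t, gg t * (hh s * K (s - t)) := by
        refine integral_congr_ae (Eventually.of_forall fun s => ?_)
        simp only
        rw [← integral_sub_left_eq_self (fun x => K x * (hh s * gg (s - x))) volume s]
        refine integral_congr_ae (Eventually.of_forall fun t => ?_)
        simp only [sub_sub_cancel]
        ring
    _ = ∫ t, ∫ s, gg t * (hh s * K (s - t)) := (integral_integral_swap i2).symm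
    _ = _ := by
        rw [Measure.restrict_restrict hA, inter_comm,
          ← integral_indicator (measurableSet_Ioo.inter hA)]
        refine integral_congr_ae (Eventually.of_forall fun t => ?_)
        simp only [integral_const_mul]
        by_cases ht : t ∈ Ioo 0 T ∩ A
        · simp [hgg, indicator_of_mem ht]
        · simp [hgg, indicator_of_notMem ht]

theorem fracInt_shiftSemigroup_coe {T γ : ℝ} (hγ : 0 < γ) (h : BochnerL2 T ℝ) :
    (shiftSemigroup T).fracInt γ h =ᵐ[volume.restrict (Ioo 0 T)] rightRLIntegral T γ h := by
  refine (kernelOp_shiftSemigroup_coe (NilpotentShift.integrableOn_fracKernel hγ T) h).trans ?_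
  refine Eventually.of_forall fun t => ?_
  simp only [rightRLIntegral, hγ.ne', if_false]
  rw [← integral_smul]
  refine integral_congr_ae (Eventually.of_forall fun s => ?_)
  simp only [smul_eq_mul]
  ring

/-! ### Primitives from the right and weak derivatives -/

section TailIntegral

variable {X : Type*} [NormedAddCommGroup X] [NormedSpace ℝ X] {T : ℝ} {w : ℝ → X}

/-- The primitive `t ↦ ∫_t^T w`. -/
def tailIntegral (T : ℝ) (w : ℝ → X) (t : ℝ) : X := ∫ s in Ioo t T, w s

theorem tailIntegral_end : tailIntegral T w T = 0 := by simp [tailIntegral]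

theorem continuousOn_tailIntegral (hw : IntegrableOn w (Ioo 0 T)) :
    ContinuousOn (tailIntegral T w) (Icc 0 T) := by
  have hw' : IntegrableOn w (Icc 0 T) := (integrableOn_Icc_iff_integrableOn_Ioo (by simp) (by simp)).2 hw
  have h1 := intervalIntegral.continuousOn_primitive hw'
  refine ((continuousOn_const (c := ∫ s in Ioc 0 T, w s)).sub h1).congr fun t ht => ?_
  rw [tailIntegral, ← integral_Ioc_eq_integral_Ioo, Pi.sub_apply, eq_sub_iff_add_eq',
    ← setIntegral_union (Ioc_disjoint_Ioc_of_le le_rfl) measurableSet_Ioc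
      (hw'.mono_set ((Ioc_subset_Ioc_right ht.2).trans Ioc_subset_Icc_self))
      (hw'.mono_set ((Ioc_subset_Ioc_left ht.1).trans Ioc_subset_Icc_self)),
    Ioc_union_Ioc_eq_Ioc ht.1 ht.2]

theorem integrableOn_tailIntegral (hw : IntegrableOn w (Ioo 0 T)) :
    IntegrableOn (tailIntegral T w) (Ioo 0 T) :=
  (continuousOn_tailIntegral hw).integrableOn_Icc.mono_set Ioo_subset_Icc_self

theorem tailIntegral_congr {z : ℝ → X} (h : w =ᵐ[volume.restrict (Ioo 0 T)] z) {t : ℝ}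
    (ht : 0 ≤ t) : tailIntegral T w t = tailIntegral T z t :=
  integral_congr_ae (ae_restrict_of_ae_restrict_of_subset (Ioo_subset_Ioo_left ht) h)

variable [CompleteSpace X]

/-- Fubini on the triangle `t < s`. Only `φ 0 = 0` is needed, because the primitive vanishes at `T`.
-/
theorem integral_deriv_smul_tailIntegral {φ : ℝ → ℝ} (hφ : ContDiff ℝ 1 φ) (hφ0 : φ 0 = 0)
    (hw : IntegrableOn w (Ioo 0 T)) :
    ∫ t in Ioo 0 T, deriv φ t • tailIntegral T w t = ∫ t in Ioo 0 T, φ t • w t := by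
  have hφ' : Continuous (deriv φ) := hφ.continuous_deriv le_rfl
  set F : ℝ → ℝ → X := fun t s => (Ioi t).indicator (fun _ => deriv φ t) s • w s with hF
  have hset : MeasurableSet {p : ℝ × ℝ | p.1 < p.2} := measurableSet_lt measurable_fst measurable_snd
  have hi : Integrable (Function.uncurry F)
      ((volume.restrict (Ioo 0 T)).prod (volume.restrict (Ioo 0 T))) := by
    have h1 : Integrable (fun p : ℝ × ℝ => deriv φ p.1 • w p.2)
        ((volume.restrict (Ioo 0 T)).prod (volume.restrict (Ioo 0 T))) :=
      Integrable.smul_prod (hφ'.integrableOn_Icc.mono_set Ioo_subset_Icc_self) hw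
    refine (h1.indicator hset).congr (Eventually.of_forall fun p => ?_)
    simp only [Function.uncurry, hF]
    by_cases hp : p.1 < p.2
    · rw [indicator_of_mem (by exact hp), indicator_of_mem (by exact hp)]
    · rw [indicator_of_notMem (by exact hp), indicator_of_notMem (by exact hp), zero_smul]
  have e1 : ∀ t ∈ Ioo 0 T, ∫ s in Ioo 0 T, F t s = deriv φ t • tailIntegral T w t := by
    intro t ht
    have : ∀ s, F t s = (Ioi t).indicator (fun s => deriv φ t • w s) s := fun s => by
      simp only [hF]
      by_cases hs : s ∈ Ioi t
      · simp [indicator_of_mem hs]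
      · simp [indicator_of_notMem hs]
    simp only [this]
    rw [setIntegral_indicator measurableSet_Ioi, integral_smul, tailIntegral]
    congr 3
    ext s
    simp only [mem_inter_iff, mem_Ioo, mem_Ioi]
    exact ⟨fun h => ⟨h.2, h.1.2⟩, fun h => ⟨⟨ht.1.trans h.1, h.2⟩, h.1⟩⟩
  have e2 : ∀ s ∈ Ioo 0 T, ∫ t in Ioo 0 T, F t s = φ s • w s := by
    intro s hs
    have : ∀ t, F t s = (Iio s).indicator (deriv φ) t • w s := fun t => by
      simp only [hF]
      by_cases hts : t < s
      · rw [indicator_of_mem (by exact hts), indicator_of_mem (by exact hts)]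
      · rw [indicator_of_notMem (by exact hts), indicator_of_notMem (by exact hts)]
    simp only [this]
    rw [integral_smul_const, setIntegral_indicator measurableSet_Iio]
    have h2 : Ioo 0 T ∩ Iio s = Ioo 0 s := by
      ext t
      simp only [mem_inter_iff, mem_Ioo, mem_Iio]
      exact ⟨fun h => ⟨h.1.1, h.2⟩, fun h => ⟨⟨h.1, h.2.trans hs.2⟩, h.2⟩⟩
    rw [h2, ← integral_Ioc_eq_integral_Ioo, ← intervalIntegral.integral_of_le hs.1.le,
      intervalIntegral.integral_deriv_eq_sub (fun t _ => (hφ.differentiable one_ne_zero).differentiableAt)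
        (hφ'.intervalIntegrable _ _), hφ0, sub_zero]
  rw [← setIntegral_congr_fun measurableSet_Ioo e1, integral_integral_swap hi]
  exact setIntegral_congr_fun measurableSet_Ioo e2

theorem testFunction_eq_zero {t : ℝ} (φ : TestFunction (timeInterval T) ℝ ⊤) (ht : t ∉ Ioo 0 T) :
    φ t = 0 := by
  by_contra h
  exact ht (φ.tsupport_subset (subset_tsupport _ h))

theorem contDiff_testFunction (φ : TestFunction (timeInterval T) ℝ ⊤) : ContDiff ℝ ∞ φ :=
  φ.contDiff

theorem isWeakDeriv_tailIntegral (hw : IntegrableOn w (Ioo 0 T)) :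
    IsWeakDeriv T 1 (tailIntegral T w) (fun t => -w t) := by
  refine ⟨integrableOn_tailIntegral hw, hw.neg, fun φ => ?_⟩
  simp only [iteratedDeriv_one, smul_neg, integral_neg, pow_one, neg_smul, one_smul, neg_neg]
  exact integral_deriv_smul_tailIntegral ((contDiff_testFunction φ).of_le (by exact_mod_cast le_top))
    (testFunction_eq_zero φ (by simp)) hw

theorem isWeakDeriv_two_tailIntegral (hw : IntegrableOn w (Ioo 0 T)) :
    IsWeakDeriv T 2 (tailIntegral T (tailIntegral T w)) w := by
  refine ⟨integrableOn_tailIntegral (integrableOn_tailIntegral hw), hw, fun φ => ?_⟩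
  have h1 : ContDiff ℝ 1 (deriv φ) := by
    have := (contDiff_infty_iff_deriv.1 (contDiff_testFunction φ)).2
    exact this.of_le (by exact_mod_cast le_top)
  have h0 : deriv φ 0 = 0 := by
    have h2 : (0 : ℝ) ∉ tsupport (deriv φ) := fun h => by
      have := φ.tsupport_subset (tsupport_deriv_subset h)
      exact lt_irrefl _ this.1
    exact image_eq_zero_of_notMem_tsupport h2
  simp only [iteratedDeriv_succ, iteratedDeriv_zero]
  rw [integral_deriv_smul_tailIntegral h1 h0 (integrableOn_tailIntegral hw),
    integral_deriv_smul_tailIntegral ((contDiff_testFunction φ).of_le (by exact_mod_cast le_top))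
    (testFunction_eq_zero φ (by simp)) hw]
  simp

theorem ae_eq_of_forall_integral_testFunction {f g : ℝ → X} (hf : IntegrableOn f (Ioo 0 T))
    (hg : IntegrableOn g (Ioo 0 T))
    (h : ∀ φ : TestFunction (timeInterval T) ℝ ⊤,
      ∫ t in Ioo 0 T, φ t • f t = ∫ t in Ioo 0 T, φ t • g t) :
    f =ᵐ[volume.restrict (Ioo 0 T)] g := by
  have key := (isOpen_Ioo (a := (0 : ℝ)) (b := T)).ae_eq_zero_of_integral_contDiff_smul_eq_zero
    (μ := volume) (f := f - g) ((hf.sub hg).locallyIntegrableOn) fun φ h1 h2 h3 => by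
      have h4 := h ⟨φ, h1, h2, h3⟩
      have i1 := integrable_test_smul (T := T) ⟨φ, h1, h2, h3⟩ 0 hf
      have i2 := integrable_test_smul (T := T) ⟨φ, h1, h2, h3⟩ 0 hg
      simp only [iteratedDeriv_zero] at i1 i2
      have h5 : ∫ x, φ x • (f - g) x = ∫ x in Ioo 0 T, φ x • (f - g) x := by
        refine (setIntegral_eq_integral_of_forall_compl_eq_zero fun x hx => ?_).symm
        have : φ x = 0 := image_eq_zero_of_notMem_tsupport fun h => hx (h3 h)
        rw [this, zero_smul]
      rw [h5]
      simp only [Pi.sub_apply, smul_sub]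
      exact (integral_sub i1 i2).trans (sub_eq_zero.2 h4)
  rw [Filter.EventuallyEq, ae_restrict_iff' measurableSet_Ioo]
  filter_upwards [key] with t ht htT
  exact sub_eq_zero.1 (ht htT)

theorem IsWeakDeriv.unique {j : ℕ} {y g h : ℝ → X} (hg : IsWeakDeriv T j y g)
    (hh : IsWeakDeriv T j y h) : g =ᵐ[volume.restrict (Ioo 0 T)] h := by
  refine ae_eq_of_forall_integral_testFunction hg.2.1 hh.2.1 fun φ => ?_
  have := (hg.2.2 φ).symm.trans (hh.2.2 φ)
  exact smul_right_injective _ (pow_ne_zero j (by norm_num : (-1 : ℝ) ≠ 0)) this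

end TailIntegral

theorem eqOn_Icc_of_ae_eq {X : Type*} [NormedAddCommGroup X] {T : ℝ} (hT : 0 < T) {f g : ℝ → X}
    (hf : ContinuousOn f (Icc 0 T)) (hg : ContinuousOn g (Icc 0 T))
    (h : f =ᵐ[volume.restrict (Ioo 0 T)] g) : EqOn f g (Icc 0 T) := by
  refine Measure.eqOn_Icc_of_ae_eq volume hT.ne ?_ hf hg
  rwa [Measure.restrict_congr_set Ioo_ae_eq_Icc] at h

/-- A function with vanishing weak derivative is constant. -/
theorem ae_eq_const_of_isWeakDeriv_zero {T : ℝ} (hT : 0 < T) {f : ℝ → ℝ}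
    (hf : IsWeakDeriv T 1 f 0) : ∃ c : ℝ, f =ᵐ[volume.restrict (Ioo 0 T)] fun _ => c := by
  -- The du Bois-Reymond argument: a fixed bump of integral one, supported inside `(0,T)`, is
  -- subtracted from a test function to make its mean zero.
  let χ₀ : ContDiffBump (T / 2) := ⟨T / 8, T / 4, by positivity, by linarith⟩
  set χ : ℝ → ℝ := χ₀.normed volume with hχ
  have hχ1 : ContDiff ℝ ∞ χ := χ₀.contDiff_normed
  have hχ2 : HasCompactSupport χ := χ₀.hasCompactSupport_normed
  have hχ3 : tsupport χ ⊆ Ioo 0 T := by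
    rw [hχ, χ₀.tsupport_normed_eq, Real.closedBall_eq_Icc]
    intro t ht
    have h1 : T / 2 - T / 4 ≤ t := ht.1
    have h2 : t ≤ T / 2 + T / 4 := ht.2
    exact ⟨by linarith, by linarith⟩
  have hχ4 : ∫ t, χ t = 1 := χ₀.integral_normed
  set c := ∫ t in Ioo 0 T, χ t * f t with hc
  refine ⟨c, ae_eq_of_forall_integral_testFunction hf.1
    (integrableOn_const (by simp)) fun φ => ?_⟩
  have hφ1 := contDiff_testFunction φ
  set b := ∫ t, φ t with hb
  set η : ℝ → ℝ := fun t => φ t - b * χ t with hη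
  have hη1 : ContDiff ℝ ∞ η := hφ1.sub (contDiff_const.mul hχ1)
  have hηc : Continuous η := hη1.continuous
  set K := tsupport φ ∪ tsupport χ with hK
  have hKc : IsCompact K := IsCompact.union φ.hasCompactSupport hχ2
  have hKT : K ⊆ Ioo 0 T := union_subset φ.tsupport_subset hχ3
  have hηK : ∀ t, t ∉ K → η t = 0 := fun t ht => by
    rw [hK, mem_union, not_or] at ht
    simp only [hη]
    rw [image_eq_zero_of_notMem_tsupport ht.1, image_eq_zero_of_notMem_tsupport ht.2]
    simp
  have hKne : K.Nonempty := by
    refine Nonempty.inr ?_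
    by_contra hne
    rw [not_nonempty_iff_eq_empty, tsupport_eq_empty_iff] at hne
    rw [hne] at hχ4
    simp at hχ4
  have hlo := hKT (hKc.sInf_mem hKne)
  have hhi := hKT (hKc.sSup_mem hKne)
  have hint : ∫ t, η t = 0 := by
    have i1 : Integrable φ := hφ1.continuous.integrable_of_hasCompactSupport φ.hasCompactSupport
    have i2 : Integrable χ := hχ1.continuous.integrable_of_hasCompactSupport hχ2
    simp only [hη]
    rw [integral_sub i1 (i2.const_mul b), integral_const_mul, hχ4, mul_one, sub_self]
  -- Since `η` has mean zero, its primitive is again compactly supported in `(0,T)` and is an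
  -- admissible test function.
  set ψ : ℝ → ℝ := fun t => ∫ s in (0 : ℝ)..t, η s with hψ
  have hψd : ∀ t, HasDerivAt ψ (η t) t := fun t => (hηc.integral_hasStrictDerivAt 0 t).hasDerivAt
  have hψ1 : ContDiff ℝ ∞ ψ := by
    rw [contDiff_infty_iff_deriv]
    refine ⟨fun t => (hψd t).differentiableAt, ?_⟩
    rwa [show deriv ψ = η from funext fun t => (hψd t).deriv]
  have hsupp : Function.support ψ ⊆ Icc (sInf K) (sSup K) := by
    intro t ht
    by_contra hn
    refine ht ?_
    rcases not_and_or.1 hn with h1 | h1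
    · have h1' := not_le.1 h1
      refine intervalIntegral.integral_zero_ae (Eventually.of_forall fun s hs => hηK s fun hsK => ?_)
      have h2 := csInf_le hKc.bddBelow hsK
      have h3 : s ≤ max 0 t := hs.2
      have h4 : max 0 t < sInf K := max_lt hlo.1 h1'
      linarith
    · have h1' := not_le.1 h1
      have h0t : 0 ≤ t := (hhi.1.trans h1').le
      simp only [hψ]
      rw [intervalIntegral.integral_of_le h0t]
      refine (setIntegral_eq_integral_of_forall_compl_eq_zero fun s hs =>
        hηK s fun hsK => hs ?_).trans hint
      exact ⟨(hKT hsK).1, (le_csSup hKc.bddAbove hsK).trans h1'.le⟩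
  have hψ2 : HasCompactSupport ψ := HasCompactSupport.of_support_subset_isCompact isCompact_Icc hsupp
  have hψ3 : tsupport ψ ⊆ Ioo 0 T :=
    (closure_minimal hsupp isClosed_Icc).trans (Icc_subset_Ioo hlo.1 hhi.2)
  have h1 : ∫ t in Ioo 0 T, iteratedDeriv 1 ψ t * f t = 0 :=
    (hf.2.2 (⟨ψ, hψ1, hψ2, hψ3⟩ : TestFunction (timeInterval T) ℝ ⊤)).trans (by simp)
  have h2 : ∀ t, iteratedDeriv 1 ψ t = η t := fun t => by
    rw [iteratedDeriv_one]
    exact (hψd t).deriv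
  simp only [h2, hη, sub_mul] at h1
  have i1 := integrable_test_smul φ 0 hf.1
  have i2 := integrable_test_smul (T := T) ⟨χ, hχ1, hχ2, hχ3⟩ 0 hf.1
  simp only [iteratedDeriv_zero, smul_eq_mul] at i1 i2
  have i2' : IntegrableOn (fun t => χ t * f t) (Ioo 0 T) := i2
  simp only [mul_assoc] at h1
  rw [integral_sub i1 (i2'.const_mul b), integral_const_mul, ← hc, sub_eq_zero] at h1
  simp only [smul_eq_mul]
  rw [h1, integral_mul_const, hb]
  congr 1
  exact (setIntegral_eq_integral_of_forall_compl_eq_zero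
    fun t ht => testFunction_eq_zero φ ht).symm

/-! ### The space `⁰H^α(0,T)` as a range of fractional integrals -/

section TimeNorms

variable {T : ℝ}

theorem fracInt_one_coe (h : BochnerL2 T ℝ) :
    (shiftSemigroup T).fracInt 1 h =ᵐ[volume.restrict (Ioo 0 T)] tailIntegral T h := by
  refine (fracInt_shiftSemigroup_coe one_pos h).trans (Eventually.of_forall fun t => ?_)
  simp [rightRLIntegral, tailIntegral]

theorem isWeakDeriv_fracInt_one (h : BochnerL2 T ℝ) :
    IsWeakDeriv T 1 ((shiftSemigroup T).fracInt 1 h) (-h : BochnerL2 T ℝ) :=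
  (isWeakDeriv_tailIntegral (integrableOn_bochnerL2 h)).congr (fracInt_one_coe h).symm
    (Lp.coeFn_neg h).symm

theorem vanishesAtEnd_fracInt_one (h : BochnerL2 T ℝ) :
    VanishesAtEnd T ((shiftSemigroup T).fracInt 1 h) :=
  ⟨tailIntegral T h, continuousOn_tailIntegral (integrableOn_bochnerL2 h), fracInt_one_coe h,
    tailIntegral_end⟩

/-- `y` and `V(-g)` have the same weak derivative, so they differ by a constant, which is zero by
the value at `T`. -/
theorem eq_neg_fracInt_one (hT : 0 < T) {y g : BochnerL2 T ℝ} (h1 : IsWeakDeriv T 1 y g)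
    (h2 : VanishesAtEnd T y) : y = (shiftSemigroup T).fracInt 1 (-g) := by
  have h3 := h1.add (isWeakDeriv_fracInt_one g)
  have h4 : (g : ℝ → ℝ) + ((-g : BochnerL2 T ℝ) : ℝ → ℝ) =ᵐ[volume.restrict (Ioo 0 T)] 0 := by
    filter_upwards [Lp.coeFn_neg g] with t ht
    rw [Pi.add_apply, ht, Pi.neg_apply, Pi.zero_apply, add_neg_cancel]
  obtain ⟨c, hc⟩ := ae_eq_const_of_isWeakDeriv_zero hT (h3.congr (EventuallyEq.refl _ _) h4)
  obtain ⟨Y, hY, hyY, hYT⟩ := h2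
  have h5 := eqOn_Icc_of_ae_eq hT (f := Y + tailIntegral T g) (g := fun _ => c)
    (hY.add (continuousOn_tailIntegral (integrableOn_bochnerL2 g))) continuousOn_const
    ((hyY.symm.add (fracInt_one_coe g).symm).trans hc) (right_mem_Icc.2 hT.le)
  rw [Pi.add_apply, hYT, tailIntegral_end, add_zero] at h5
  obtain rfl : 0 = c := h5
  refine Lp.ext ?_
  rw [map_neg]
  filter_upwards [hc, Lp.coeFn_neg ((shiftSemigroup T).fracInt 1 g)] with t h6 h7
  rw [h7, Pi.neg_apply]
  exact eq_neg_of_add_eq_zero_left h6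

theorem rightSobolevENorm_one_le (h : BochnerL2 T ℝ) :
    rightSobolevENorm T 1 ((shiftSemigroup T).fracInt 1 h) ≤ ‖h‖ₑ := by
  refine (iInf₂_le (fun k => if k = 0 then (shiftSemigroup T).fracInt 1 h else -h)
    ⟨by simp, fun k hk => ?_⟩).trans (by simp)
  obtain rfl : k = 0 := by omega
  simpa using ⟨isWeakDeriv_fracInt_one h, vanishesAtEnd_fracInt_one h⟩

theorem rightSobolevENorm_two_le (h : BochnerL2 T ℝ) :
    rightSobolevENorm T 2 ((shiftSemigroup T).fracInt 1 ((shiftSemigroup T).fracInt 1 h)) ≤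
      ‖h‖ₑ := by
  set V := (shiftSemigroup T).fracInt 1 with hV
  -- The signs alternate because `V` integrates from the right: the weak derivative of `V h` is
  -- `-h`.
  refine (iInf₂_le (fun k => if k = 0 then V (V h) else if k = 1 then -(V h) else h)
    ⟨by simp, fun k hk => ?_⟩).trans (by simp)
  obtain rfl | rfl : k = 0 ∨ k = 1 := by omega
  · simpa using ⟨isWeakDeriv_fracInt_one (V h), vanishesAtEnd_fracInt_one (V h)⟩
  · have h1 := isWeakDeriv_fracInt_one (-h)
    have h2 := vanishesAtEnd_fracInt_one (-h)
    rw [map_neg, neg_neg] at h1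
    rw [map_neg] at h2
    simpa using ⟨h1, h2⟩

theorem IsRightSobolevChain.eq_one (hT : 0 < T) {w : BochnerL2 T ℝ} {D : ℕ → BochnerL2 T ℝ}
    (h : IsRightSobolevChain T 1 w D) : w = (shiftSemigroup T).fracInt 1 (-(D 1)) := by
  obtain ⟨h1, h2⟩ := h.2 0 one_pos
  rw [← h.1]
  exact eq_neg_fracInt_one hT h1 h2

theorem IsRightSobolevChain.eq_two (hT : 0 < T) {w : BochnerL2 T ℝ} {D : ℕ → BochnerL2 T ℝ}
    (h : IsRightSobolevChain T 2 w D) :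
    w = (shiftSemigroup T).fracInt 1 ((shiftSemigroup T).fracInt 1 (D 2)) := by
  obtain ⟨h1, h2⟩ := h.2 0 two_pos
  obtain ⟨h3, h4⟩ := h.2 1 one_lt_two
  rw [← h.1, eq_neg_fracInt_one hT h1 h2, eq_neg_fracInt_one hT h3 h4, map_neg, map_neg, map_neg, neg_neg]

/-- Split `V g = V Q_t g + V P_t g`. The second term is `V² (t⁻¹ Q_t g)`, so with weight `t` each
term costs at most `‖Q_t g‖`. -/
theorem kFunctional_fracInt_one_le {t : ℝ} (ht : 0 < t) (g : BochnerL2 T ℝ) :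
    kFunctional (rightSobolevENorm T 1) (rightSobolevENorm T 2) t
      ((shiftSemigroup T).fracInt 1 g) ≤ 2 * ‖(shiftSemigroup T).resQ t g‖ₑ := by
  set 𝒮 := shiftSemigroup T with h𝒮
  have h1 : 𝒮.fracInt 1 (𝒮.resP t g) = 𝒮.fracInt 1 (𝒮.fracInt 1 (t⁻¹ • 𝒮.resQ t g)) := by
    rw [map_smul, 𝒮.fracInt_one_resQ ht, smul_smul, inv_mul_cancel₀ ht.ne', one_smul]
  refine (iInf₂_le (𝒮.fracInt 1 (𝒮.resQ t g), 𝒮.fracInt 1 (𝒮.resP t g)) ?_).trans ?_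
  · simp only
    rw [← map_add, 𝒮.resQ_apply, sub_add_cancel]
  · rw [two_mul]
    refine add_le_add (rightSobolevENorm_one_le _) ?_
    simp only
    rw [h1]
    refine (mul_le_mul_right (rightSobolevENorm_two_le _) _).trans ?_
    rw [enorm_smul, ← mul_assoc, Real.enorm_eq_ofReal (by positivity), ← ENNReal.ofReal_mul ht.le,
      mul_inv_cancel₀ ht.ne', ENNReal.ofReal_one, one_mul]

/-- Any splitting of `V g` into `⁰H¹` and `⁰H²` parts reads `g = -a + V b` by injectivity of `V`,
with `a` a first and `b` a second derivative. Then `Q_t g = -Q_t a + t P_t b`, and `P_t`, `Q_t` are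
contractions. -/
theorem enorm_resQ_le_kFunctional (hT : 0 < T) {t : ℝ} (ht : 0 < t) (g : BochnerL2 T ℝ) :
    ‖(shiftSemigroup T).resQ t g‖ₑ ≤
      kFunctional (rightSobolevENorm T 1) (rightSobolevENorm T 2) t
        ((shiftSemigroup T).fracInt 1 g) := by
  have ht' : ENNReal.ofReal t ≠ 0 := by simpa using ht
  unfold kFunctional rightSobolevENorm
  simp only [ENNReal.mul_iInf_of_ne ht' ENNReal.ofReal_ne_top, ENNReal.iInf_add, ENNReal.add_iInf]
  refine le_iInf₂ fun p hp => le_iInf₂ fun F hF => le_iInf₂ fun D hD => ?_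
  set 𝒮 := shiftSemigroup T with h𝒮
  have h1 : g = -(D 1) + 𝒮.fracInt 1 (F 2) := 𝒮.fracInt_one_injective (by
    rw [← hp, hD.eq_one hT, hF.eq_two hT, map_add])
  have h2 : 𝒮.resQ t g = -(𝒮.resQ t (D 1)) + t • 𝒮.resP t (F 2) := by
    rw [h1, map_add, map_neg, 𝒮.resQ_fracInt one_pos, 𝒮.fracInt_one_resQ ht]
  rw [h2]
  refine (enorm_add_le _ _).trans (add_le_add ?_ ?_)
  · rw [enorm_neg]
    exact enorm_le_iff_norm_le.2 (𝒮.norm_resQ_le ht _)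
  · rw [enorm_smul, Real.enorm_eq_ofReal ht.le]
    gcongr
    exact enorm_le_iff_norm_le.2 (𝒮.norm_resP_le ht _)

theorem exists_fracInt_one_eq (hT : 0 < T) {t : ℝ} (ht : 0 < t) {c : BochnerL2 T ℝ}
    (hc : kFunctional (rightSobolevENorm T 1) (rightSobolevENorm T 2) t c < ⊤) :
    ∃ g, c = (shiftSemigroup T).fracInt 1 g := by
  have ht' : ENNReal.ofReal t ≠ 0 := by simpa using ht
  simp only [kFunctional, iInf_lt_iff] at hc
  obtain ⟨p, hp, h1⟩ := hc
  obtain ⟨h2, h3⟩ := ENNReal.add_lt_top.1 h1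
  have h4 := ENNReal.lt_top_of_mul_ne_top_right h3.ne ht'
  simp only [rightSobolevENorm, iInf_lt_iff] at h2 h4
  obtain ⟨D, hD, -⟩ := h2
  obtain ⟨F, hF, -⟩ := h4
  exact ⟨-(D 1) + (shiftSemigroup T).fracInt 1 (F 2), by
    rw [← hp, hD.eq_one hT, hF.eq_two hT, map_add]⟩

theorem sqFun_le_rightFracSobolevENorm (hT : 0 < T) {α : ℝ} (g : BochnerL2 T ℝ) :
    (shiftSemigroup T).sqFun (α - 1) g ≤
      rightFracSobolevENorm T α ((shiftSemigroup T).fracInt 1 g) ^ 2 := by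
  rw [rightFracSobolevENorm, interpENorm, ← ENNReal.rpow_natCast, ← ENNReal.rpow_mul]
  norm_num only [ENNReal.rpow_one]
  refine setLIntegral_mono' measurableSet_Ioi fun t ht => ?_
  rw [ENNReal.rpow_two]
  gcongr
  exact enorm_resQ_le_kFunctional hT ht g

theorem rightFracSobolevENorm_le {α : ℝ} (g : BochnerL2 T ℝ) :
    rightFracSobolevENorm T α ((shiftSemigroup T).fracInt 1 g) ≤
      2 * (shiftSemigroup T).sqFun (α - 1) g ^ (1 / 2 : ℝ) := by
  have h2 : (2 : ℝ≥0∞) = (4 : ℝ≥0∞) ^ (1 / 2 : ℝ) := by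
    rw [show (4 : ℝ≥0∞) = 2 ^ (2 : ℝ) by norm_num, ← ENNReal.rpow_mul]
    norm_num
  rw [rightFracSobolevENorm, interpENorm]
  refine le_trans ?_ (congrArg (· * _) h2).ge
  rw [← ENNReal.mul_rpow_of_nonneg _ _ (by norm_num)]
  gcongr
  rw [NilpotentShift.sqFun, ← lintegral_const_mul' _ _ (by norm_num)]
  refine setLIntegral_mono' measurableSet_Ioi fun t ht => ?_
  rw [ENNReal.rpow_two, ← mul_assoc]
  gcongr
  calc _ ≤ (ENNReal.ofReal (t ^ (-(α - 1))) * (2 * ‖(shiftSemigroup T).resQ t g‖ₑ)) ^ 2 := by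
        gcongr
        exact kFunctional_fracInt_one_le ht g
    _ = _ := by ring

/-- `I^α = V I^{α-1}`, so the direct square function estimate of order `α - 1` applies. -/
theorem rightFracSobolevENorm_fracInt_le {α : ℝ} (hα₁ : 1 < α) (hα₂ : α < 2)
    (h : BochnerL2 T ℝ) :
    rightFracSobolevENorm T α ((shiftSemigroup T).fracInt α h) ≤
      ENNReal.ofReal (2 * √(NilpotentShift.sqFunConst (α - 1)) * ‖h‖) := by
  have h1 : (shiftSemigroup T).fracInt α h =
      (shiftSemigroup T).fracInt 1 ((shiftSemigroup T).fracInt (α - 1) h) := by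
    rw [NilpotentShift.fracInt_fracInt _ one_pos (by linarith), add_sub_cancel]
  rw [h1]
  refine (rightFracSobolevENorm_le _).trans ?_
  have h2 := (shiftSemigroup T).sqFun_fracInt_le (θ := α - 1) (by linarith) (by linarith) h
  have h3 := NilpotentShift.sqFunConst_nonneg (α - 1)
  calc _ ≤ 2 * ENNReal.ofReal (NilpotentShift.sqFunConst (α - 1) * ‖h‖ ^ 2) ^ (1 / 2 : ℝ) := by
        gcongr
    _ = _ := by
        rw [ENNReal.ofReal_rpow_of_nonneg (by positivity) (by norm_num), ← Real.sqrt_eq_rpow,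
          Real.sqrt_mul h3, Real.sqrt_sq (norm_nonneg _), mul_assoc,
          ENNReal.ofReal_mul zero_le_two]
        norm_num

theorem exists_fracInt_eq_of_rightFracSobolevENorm_lt_top (hT : 0 < T) {α : ℝ} (hα₁ : 1 < α)
    (hα₂ : α < 2) {c : BochnerL2 T ℝ} (hc : rightFracSobolevENorm T α c < ⊤) :
    ∃ h, (shiftSemigroup T).fracInt α h = c ∧
      ‖h‖ ≤ 2 * √(NilpotentShift.sqFunConst (2 - α)) * (rightFracSobolevENorm T α c).toReal := by
  obtain ⟨t, ht, hKt⟩ : ∃ t : ℝ, 0 < t ∧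
      kFunctional (rightSobolevENorm T 1) (rightSobolevENorm T 2) t c < ⊤ := by
    -- If `K(t, c)` were infinite for all `t > 0`, so would be the interpolation norm.
    by_contra! hcon
    refine hc.ne ?_
    rw [rightFracSobolevENorm, interpENorm]
    have h1 : ∫⁻ t in Ioi (0 : ℝ), (ENNReal.ofReal (t ^ (-(α - 1))) *
        kFunctional (rightSobolevENorm T 1) (rightSobolevENorm T 2) t c) ^ (2 : ℝ) *
        ENNReal.ofReal t⁻¹ = ∫⁻ t in Ioi (0 : ℝ), ⊤ := by
      refine setLIntegral_congr_fun measurableSet_Ioi fun t (ht : 0 < t) => ?_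
      have h2 : ENNReal.ofReal (t ^ (-(α - 1))) ≠ 0 := by simpa using Real.rpow_pos_of_pos ht _
      have h3 : ENNReal.ofReal t⁻¹ ≠ 0 := by simpa using ht
      rw [top_le_iff.1 (hcon t ht), ENNReal.mul_top h2, ENNReal.top_rpow_of_pos two_pos,
        ENNReal.top_mul h3]
    rw [h1]
    simp
  obtain ⟨g, rfl⟩ := exists_fracInt_one_eq hT ht hKt
  have h1 := sqFun_le_rightFracSobolevENorm hT (α := α) g
  rw [← ENNReal.ofReal_toReal hc.ne, ← ENNReal.ofReal_pow ENNReal.toReal_nonneg] at h1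
  obtain ⟨h, rfl, h2⟩ := (shiftSemigroup T).exists_fracInt_eq_of_sqFun_le
    (θ := α - 1) (by linarith) (by linarith) ENNReal.toReal_nonneg h1
  refine ⟨h, ?_, ?_⟩
  · rw [NilpotentShift.fracInt_fracInt _ one_pos (by linarith), add_sub_cancel]
  · rwa [show 1 - (α - 1) = 2 - α by ring] at h2

end TimeNorms

/-! ### The distributional Laplacian in the eigenbasis -/

section Laplacian

variable {d : ℕ} {Ω : Opens (EuclideanSpace ℝ (Fin d))}

theorem memLp_testFunction (ψ : TestFunction Ω ℝ ⊤) : MemLp ψ 2 (volume.restrict (Ω : Set _)) :=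
  (ψ.contDiff.continuous.memLp_of_hasCompactSupport ψ.hasCompactSupport).restrict _

theorem memLp_laplacian_testFunction (ψ : TestFunction Ω ℝ ⊤) :
    MemLp (Laplacian.laplacian (ψ : EuclideanSpace ℝ (Fin d) → ℝ)) 2
      (volume.restrict (Ω : Set _)) := by
  refine MemLp.restrict _ (Continuous.memLp_of_hasCompactSupport ?_ ?_)
  · rw [InnerProductSpace.laplacian_eq_iteratedFDeriv_stdOrthonormalBasis]
    have h1 : Continuous (iteratedFDeriv ℝ 2 (ψ : EuclideanSpace ℝ (Fin d) → ℝ)) :=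
      ψ.contDiff.continuous_iteratedFDeriv ENat.LEInfty.out
    exact continuous_finsetSum _ fun i _ =>
      (ContinuousMultilinearMap.apply ℝ (fun _ : Fin 2 => EuclideanSpace ℝ (Fin d)) ℝ
        ![stdOrthonormalBasis ℝ _ i, stdOrthonormalBasis ℝ _ i]).continuous.comp h1
  · refine (ψ.hasCompactSupport.iteratedFDeriv (𝕜 := ℝ) 2).mono fun x hx => ?_
    rw [Function.mem_support] at hx ⊢
    intro h0
    refine hx ?_
    rw [InnerProductSpace.laplacian_eq_iteratedFDeriv_stdOrthonormalBasis]
    simp [h0]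

theorem inner_toLp_eq_integral {f : EuclideanSpace ℝ (Fin d) → ℝ} (hf : MemLp f 2 (volume.restrict (Ω : Set _)))
    (u : SpaceL2 Ω) : ⟪u, hf.toLp f⟫ = ∫ x in (Ω : Set _), u x * f x := by
  rw [L2.inner_def]
  refine integral_congr_ae ?_
  filter_upwards [hf.coeFn_toLp] with x hx
  rw [hx]
  exact mul_comm _ _

theorem isWeakLaplacian_iff (u f : SpaceL2 Ω) : IsWeakLaplacian u f ↔ ∀ ψ : TestFunction Ω ℝ ⊤,
    ⟪u, (memLp_laplacian_testFunction ψ).toLp _⟫ = ⟪f, (memLp_testFunction ψ).toLp _⟫ := by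
  simp only [inner_toLp_eq_integral]
  rfl

/-- Parseval for both pairings: a test function and its Laplacian lie in `L²(Ω)`, and term by term
the identity is the eigenvalue equation in distributions. -/
theorem isWeakLaplacian_of_inner_eq (B : DirichletEigenbasis Ω) {u f : SpaceL2 Ω}
    (h : ∀ n, ⟪B.φ n, f⟫ = -(B.eig n) * ⟪B.φ n, u⟫) : IsWeakLaplacian u f := by
  rw [isWeakLaplacian_iff]
  intro ψ
  rw [← B.φ.tsum_inner_mul_inner u, ← B.φ.tsum_inner_mul_inner f]
  refine tsum_congr fun n => ?_
  rw [(isWeakLaplacian_iff _ _).1 (B.eigen n) ψ, real_inner_comm, real_inner_comm _ f, h n,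
    inner_neg_left, inner_smul_left]
  simp only [conj_trivial]
  ring

theorem IsWeakLaplacian.unique {u f g : SpaceL2 Ω} (hf : IsWeakLaplacian u f)
    (hg : IsWeakLaplacian u g) : f = g := by
  have key := Ω.isOpen.ae_eq_zero_of_integral_contDiff_smul_eq_zero
    (μ := volume) (f := (f - g : SpaceL2 Ω)) ?_ fun φ h1 h2 h3 => ?_
  · rw [← sub_eq_zero]
    refine Lp.ext ?_
    filter_upwards [(ae_restrict_iff' Ω.isOpen.measurableSet).2 key,
      Lp.coeFn_zero ℝ 2 (volume.restrict (Ω : Set (EuclideanSpace ℝ (Fin d))))] with x h1 h2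
    rw [h1, h2]
    rfl
  · have h1 : LocallyIntegrable (f - g : SpaceL2 Ω) (volume.restrict (Ω : Set _)) :=
      (Lp.memLp _).locallyIntegrable one_le_two
    exact locallyIntegrableOn_of_locallyIntegrable_restrict h1
  · let ψ : TestFunction Ω ℝ ⊤ := ⟨φ, h1, h2, h3⟩
    have h4 := ((isWeakLaplacian_iff _ _).1 hf ψ).symm.trans ((isWeakLaplacian_iff _ _).1 hg ψ)
    rw [← sub_eq_zero, ← inner_sub_left, inner_toLp_eq_integral] at h4
    rw [← h4, ← setIntegral_eq_integral_of_forall_compl_eq_zero (s := (Ω : Set _))]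
    · refine integral_congr_ae (Eventually.of_forall fun x => ?_)
      exact mul_comm _ _
    · intro x hx
      rw [image_eq_zero_of_notMem_tsupport fun h => hx (h3 h), zero_smul]

theorem IsWeakLaplacian.add {u v f g : SpaceL2 Ω} (hf : IsWeakLaplacian u f)
    (hg : IsWeakLaplacian v g) : IsWeakLaplacian (u + v) (f + g) := by
  rw [isWeakLaplacian_iff] at *
  intro ψ
  rw [inner_add_left, inner_add_left, hf, hg]

theorem IsWeakLaplacian.smul {u f : SpaceL2 Ω} (c : ℝ) (hf : IsWeakLaplacian u f) :
    IsWeakLaplacian (c • u) (c • f) := by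
  rw [isWeakLaplacian_iff] at *
  intro ψ
  rw [inner_smul_left, inner_smul_left, hf]

end Laplacian

/-! ### Expansion in time-dependent coefficients -/

section Coefficients

variable {d : ℕ} {Ω : Opens (EuclideanSpace ℝ (Fin d))} (B : DirichletEigenbasis Ω) {T : ℝ}

theorem coeff_coe (n : ℕ) (v : BochnerL2 T (SpaceL2 Ω)) :
    coeff B T n v =ᵐ[volume.restrict (Ioo 0 T)] fun t => ⟪B.φ n, v t⟫ :=
  (innerSL ℝ (B.φ n)).coeFn_compLpL v

theorem inner_ext {x y : SpaceL2 Ω} (h : ∀ n, ⟪B.φ n, x⟫ = ⟪B.φ n, y⟫) : x = y := by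
  refine B.φ.repr.injective (Subtype.ext (funext fun n => ?_))
  simpa only [HilbertBasis.repr_apply_apply] using h n

/-- There are countably many basis vectors, so the exceptional null sets unite to a null set. -/
theorem ae_eq_of_forall_inner {y z : ℝ → SpaceL2 Ω}
    (h : ∀ n, (fun t => ⟪B.φ n, y t⟫) =ᵐ[volume.restrict (Ioo 0 T)] fun t => ⟪B.φ n, z t⟫) :
    y =ᵐ[volume.restrict (Ioo 0 T)] z := by
  filter_upwards [ae_all_iff.2 h] with t ht
  exact inner_ext B ht

theorem coeff_ext {v w : BochnerL2 T (SpaceL2 Ω)} (h : ∀ n, coeff B T n v = coeff B T n w) :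
    v = w :=
  Lp.ext (ae_eq_of_forall_inner B fun n =>
    ((coeff_coe B n v).symm.trans (by rw [h n])).trans (coeff_coe B n w))

theorem enorm_sq_eq_lintegral {μ : Measure ℝ} {X : Type*} [NormedAddCommGroup X] (v : Lp X 2 μ) :
    ‖v‖ₑ ^ 2 = ∫⁻ t, ‖v t‖ₑ ^ 2 ∂μ := by
  rw [Lp.enorm_def, eLpNorm_eq_lintegral_rpow_enorm_toReal two_ne_zero ENNReal.ofNat_ne_top,
    ← ENNReal.rpow_natCast, ← ENNReal.rpow_mul]
  norm_num

theorem enorm_sq_eq_tsum_inner (x : SpaceL2 Ω) : ‖x‖ₑ ^ 2 = ∑' n, ‖⟪B.φ n, x⟫‖ₑ ^ 2 := by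
  have h1 := B.φ.hasSum_inner_mul_inner x x
  have h2 : ∀ n, ⟪x, B.φ n⟫ * ⟪B.φ n, x⟫ = ‖⟪B.φ n, x⟫‖ ^ 2 := fun n => by
    rw [real_inner_comm, Real.norm_eq_abs, sq_abs, sq]
  simp only [h2, real_inner_self_eq_norm_sq] at h1
  rw [← ofReal_norm, ← ENNReal.ofReal_pow (norm_nonneg _), ← h1.tsum_eq,
    ENNReal.ofReal_tsum_of_nonneg (fun n => by positivity) h1.summable]
  refine tsum_congr fun n => ?_
  rw [ENNReal.ofReal_pow (norm_nonneg _), ofReal_norm]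

theorem enorm_sq_eq_tsum_coeff (v : BochnerL2 T (SpaceL2 Ω)) :
    ‖v‖ₑ ^ 2 = ∑' n, ‖coeff B T n v‖ₑ ^ 2 := by
  simp only [enorm_sq_eq_lintegral]
  rw [← lintegral_tsum fun n => ((Lp.aestronglyMeasurable _).enorm.pow_const 2)]
  refine lintegral_congr_ae ?_
  filter_upwards [ae_all_iff.2 fun n => coeff_coe B n v] with t ht
  rw [enorm_sq_eq_tsum_inner B]
  simp only [ht]

/-- The embedding `c ↦ c φₙ` of `L²(0,T)` in `L²(0,T;L²(Ω))`. -/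
def modeEmbedding (T : ℝ) (n : ℕ) : BochnerL2 T ℝ →L[ℝ] BochnerL2 T (SpaceL2 Ω) :=
  (ContinuousLinearMap.toSpanSingleton ℝ (B.φ n)).compLpL 2 (volume.restrict (Ioo 0 T))

theorem modeEmbedding_coe (n : ℕ) (c : BochnerL2 T ℝ) :
    modeEmbedding B T n c =ᵐ[volume.restrict (Ioo 0 T)] fun t => c t • B.φ n :=
  (ContinuousLinearMap.toSpanSingleton ℝ (B.φ n)).coeFn_compLpL c

theorem coeff_modeEmbedding (m n : ℕ) (c : BochnerL2 T ℝ) :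
    coeff B T m (modeEmbedding B T n c) = if m = n then c else 0 := by
  refine Lp.ext ?_
  filter_upwards [coeff_coe B m (modeEmbedding B T n c), modeEmbedding_coe B n c,
    Lp.coeFn_zero ℝ 2 (volume.restrict (Ioo 0 T))] with t h1 h2 h3
  rw [h1, h2, inner_smul_right, orthonormal_iff_ite.1 B.φ.orthonormal m n]
  split_ifs
  · simp
  · rw [h3]
    simp

theorem inner_modeEmbedding_left (n : ℕ) (c : BochnerL2 T ℝ) (v : BochnerL2 T (SpaceL2 Ω)) :
    ⟪modeEmbedding B T n c, v⟫ = ⟪c, coeff B T n v⟫ := by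
  rw [L2.inner_def, L2.inner_def]
  refine integral_congr_ae ?_
  filter_upwards [coeff_coe B n v, modeEmbedding_coe B n c] with t h1 h2
  rw [h1, h2, inner_smul_left]
  simp [mul_comm]

theorem norm_modeEmbedding (n : ℕ) (c : BochnerL2 T ℝ) : ‖modeEmbedding B T n c‖ = ‖c‖ := by
  rw [← sq_eq_sq₀ (norm_nonneg _) (norm_nonneg _), ← real_inner_self_eq_norm_sq,
    ← real_inner_self_eq_norm_sq, inner_modeEmbedding_left, coeff_modeEmbedding, if_pos rfl]

/-- The embeddings `c ↦ c φₙ` are isometric with mutually orthogonal ranges, so square summability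
of the coefficients gives convergence of the series. -/
theorem exists_coeff_eq (c : ℕ → BochnerL2 T ℝ) (hc : Summable fun n => ‖c n‖ ^ 2) :
    ∃ v : BochnerL2 T (SpaceL2 Ω), ∀ n, coeff B T n v = c n := by
  let V : ∀ _ : ℕ, BochnerL2 T ℝ →ₗᵢ[ℝ] BochnerL2 T (SpaceL2 Ω) := fun n =>
    ⟨(modeEmbedding B T n).toLinearMap, norm_modeEmbedding B n⟩
  have hV : OrthogonalFamily ℝ (fun _ : ℕ => BochnerL2 T ℝ) V := fun m n hmn x y => by
    change ⟪modeEmbedding B T m x, modeEmbedding B T n y⟫ = 0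
    rw [inner_modeEmbedding_left, coeff_modeEmbedding, if_neg hmn, inner_zero_right]
  have hs : Summable fun n => modeEmbedding B T n (c n) :=
    (hV.summable_iff_norm_sq_summable c).2 hc
  refine ⟨∑' n, modeEmbedding B T n (c n), fun m => ?_⟩
  rw [(coeff B T m).map_tsum hs, tsum_eq_single m]
  · rw [coeff_modeEmbedding, if_pos rfl]
  · intro n hn
    rw [coeff_modeEmbedding, if_neg hn.symm]

theorem summable_norm_coeff_sq (v : BochnerL2 T (SpaceL2 Ω)) :
    Summable fun n => ‖coeff B T n v‖ ^ 2 := by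
  have h1 : ∑' n, ENNReal.ofReal (‖coeff B T n v‖ ^ 2) ≠ ⊤ := by
    simp only [ENNReal.ofReal_pow (norm_nonneg _), ofReal_norm]
    rw [← enorm_sq_eq_tsum_coeff B v]
    exact ENNReal.pow_ne_top enorm_ne_top
  have h2 := ENNReal.summable_toReal h1
  simpa only [ENNReal.toReal_ofReal (sq_nonneg _)] using h2

theorem mixedENorm_le {N : BochnerL2 T ℝ → ℝ≥0∞} {β K : ℝ} (hK : 0 ≤ K)
    (v g : BochnerL2 T (SpaceL2 Ω))
    (h : ∀ n, ENNReal.ofReal (B.eig n ^ β) * N (coeff B T n v) ^ 2 ≤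
      ENNReal.ofReal (K * ‖coeff B T n g‖) ^ 2) :
    mixedENorm B T N β v ≤ ENNReal.ofReal (K * ‖g‖) := by
  have h1 : ∑' n, ENNReal.ofReal (B.eig n ^ β) * N (coeff B T n v) ^ (2 : ℝ) ≤
      ENNReal.ofReal (K * ‖g‖) ^ (2 : ℝ) := by
    simp only [ENNReal.rpow_two]
    refine (ENNReal.tsum_le_tsum h).trans_eq ?_
    simp only [ENNReal.ofReal_mul hK, ofReal_norm, mul_pow]
    rw [ENNReal.tsum_mul_left, ← enorm_sq_eq_tsum_coeff]
  refine (ENNReal.rpow_le_rpow h1 (by norm_num)).trans_eq ?_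
  rw [← ENNReal.rpow_mul]
  norm_num

theorem sq_le_of_mixedENorm {N : BochnerL2 T ℝ → ℝ≥0∞} {β : ℝ} (v : BochnerL2 T (SpaceL2 Ω)) :
    ∑' n, ENNReal.ofReal (B.eig n ^ β) * N (coeff B T n v) ^ 2 = mixedENorm B T N β v ^ 2 := by
  rw [mixedENorm, ← ENNReal.rpow_natCast _ 2, ← ENNReal.rpow_mul]
  norm_num

end Coefficients

theorem inner_tailIntegral {X : Type*} [NormedAddCommGroup X] [InnerProductSpace ℝ X]
    [CompleteSpace X] {T t : ℝ} {y : ℝ → X} (hy : IntegrableOn y (Ioo 0 T)) (ht : 0 ≤ t) (x : X) :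
    ⟪x, tailIntegral T y t⟫ = tailIntegral T (fun s => ⟪x, y s⟫) t :=
  (integral_inner (hy.mono_set (Ioo_subset_Ioo_left ht)) x).symm

theorem IsRightRL.congr_right {X : Type*} [NormedAddCommGroup X] [NormedSpace ℝ X] {T γ : ℝ}
    {y g h : ℝ → X} (hg : IsRightRL T γ y g) (hgh : g =ᵐ[volume.restrict (Ioo 0 T)] h) :
    IsRightRL T γ y h := by
  unfold IsRightRL at hg ⊢
  split_ifs at hg ⊢
  · exact hgh.symm.trans hg
  · exact hg.congr (EventuallyEq.refl _ _) (hgh.fun_comp fun x => (-1 : ℝ) ^ ⌈γ⌉₊ • x)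

/-! ### Fractional derivatives and traces of elements of `G` -/

section Derivatives

variable {d : ℕ} {Ω : Opens (EuclideanSpace ℝ (Fin d))} (B : DirichletEigenbasis Ω) {T α : ℝ}

theorem inner_rightRLIntegral {γ : ℝ} (hγ : 0 < γ) (n : ℕ) (v : BochnerL2 T (SpaceL2 Ω)) :
    (fun t => ⟪B.φ n, rightRLIntegral T γ v t⟫) =ᵐ[volume.restrict (Ioo 0 T)]
      (shiftSemigroup T).fracInt γ (coeff B T n v) := by
  refine EventuallyEq.trans ?_ (((rightRLIntegral_congr γ (coeff_coe B n v)).symm).trans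
    (fracInt_shiftSemigroup_coe hγ _).symm)
  filter_upwards [rightRLIntegral_integrand hγ (integrableOn_bochnerL2 v)] with t ht
  simp only [rightRLIntegral, hγ.ne', if_false]
  rw [inner_smul_right, ← integral_inner ht]
  simp only [inner_smul_right, smul_eq_mul]

/-- In each coefficient `I^{2-α} I^α = I^2 = V V`. One identity thus yields `D_{T-}^α v = w` and,
after one or no differentiation, continuous representatives for both traces. -/
theorem rightRLIntegral_ae_eq_tailIntegral (hα₁ : 1 < α) (hα₂ : α < 2)
    {v w : BochnerL2 T (SpaceL2 Ω)}
    (h : ∀ n, coeff B T n v = (shiftSemigroup T).fracInt α (coeff B T n w)) :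
    rightRLIntegral T (2 - α) v =ᵐ[volume.restrict (Ioo 0 T)]
      tailIntegral T (tailIntegral T w) := by
  refine ae_eq_of_forall_inner B fun n => (inner_rightRLIntegral B (by linarith) n v).trans ?_
  have hw := integrableOn_bochnerL2 w
  rw [h n, NilpotentShift.fracInt_fracInt _ (by linarith) (by linarith), sub_add_cancel,
    show (2 : ℝ) = 1 + 1 by norm_num, ← NilpotentShift.fracInt_fracInt _ one_pos one_pos]
  refine (fracInt_one_coe _).trans ?_
  filter_upwards [ae_restrict_mem measurableSet_Ioo] with t ht
  rw [inner_tailIntegral (integrableOn_tailIntegral hw) ht.1.le]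
  refine tailIntegral_congr ((fracInt_one_coe _).trans ?_) ht.1.le
  filter_upwards [ae_restrict_mem measurableSet_Ioo] with s hs
  rw [inner_tailIntegral hw hs.1.le]
  exact tailIntegral_congr (coeff_coe B n w) hs.1.le

theorem isRightRL_of_coeff (hα₁ : 1 < α) (hα₂ : α < 2) {v w : BochnerL2 T (SpaceL2 Ω)}
    (h : ∀ n, coeff B T n v = (shiftSemigroup T).fracInt α (coeff B T n w)) :
    IsRightRL T α v w := by
  have hc : ⌈α⌉₊ = 2 := (Nat.ceil_eq_iff two_ne_zero).2 ⟨by norm_num [hα₁], by norm_num [hα₂.le]⟩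
  rw [IsRightRL, if_neg (by linarith), hc]
  refine (isWeakDeriv_two_tailIntegral (integrableOn_bochnerL2 w)).congr
    (rightRLIntegral_ae_eq_tailIntegral B hα₁ hα₂ h).symm (Eventually.of_forall fun t => ?_)
  simp

theorem hasRightRLTrace_sub_one_of_coeff (hα₁ : 1 < α) (hα₂ : α < 2)
    {v w : BochnerL2 T (SpaceL2 Ω)}
    (h : ∀ n, coeff B T n v = (shiftSemigroup T).fracInt α (coeff B T n w)) :
    HasRightRLTrace T (α - 1) v (tailIntegral T w 0) := by
  have hw := integrableOn_bochnerL2 w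
  refine ⟨tailIntegral T w, continuousOn_tailIntegral hw, ?_, rfl⟩
  have hc : ⌈α - 1⌉₊ = 1 := (Nat.ceil_eq_iff one_ne_zero).2
    ⟨by norm_num [hα₁], by norm_num; linarith⟩
  rw [IsRightRL, if_neg (by linarith), hc,
    show (((1 : ℕ) : ℝ) - (α - 1)) = 2 - α by push_cast; ring]
  refine (isWeakDeriv_tailIntegral (integrableOn_tailIntegral hw)).congr
    (rightRLIntegral_ae_eq_tailIntegral B hα₁ hα₂ h).symm (Eventually.of_forall fun t => ?_)
  simp

theorem hasRightRLTrace_sub_two_of_coeff (hα₁ : 1 < α) (hα₂ : α < 2)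
    {v w : BochnerL2 T (SpaceL2 Ω)}
    (h : ∀ n, coeff B T n v = (shiftSemigroup T).fracInt α (coeff B T n w)) :
    HasRightRLTrace T (α - 2) v (tailIntegral T (tailIntegral T w) 0) := by
  refine ⟨tailIntegral T (tailIntegral T w), continuousOn_tailIntegral
    (integrableOn_tailIntegral (integrableOn_bochnerL2 w)), ?_, rfl⟩
  rw [IsRightRL, if_pos (by linarith), neg_sub]
  exact (rightRLIntegral_ae_eq_tailIntegral B hα₁ hα₂ h).symm

theorem IsRightRL.unique (hα : 0 < α) {v w w' : BochnerL2 T (SpaceL2 Ω)}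
    (h : IsRightRL T α v w) (h' : IsRightRL T α v w') : w = w' := by
  rw [IsRightRL, if_neg hα.not_ge] at h h'
  refine Lp.ext ?_
  filter_upwards [h.unique h'] with t ht
  exact smul_right_injective _ (pow_ne_zero _ (by norm_num : (-1 : ℝ) ≠ 0)) ht

end Derivatives

/-! ### The data attached to a test function -/

section WeakData

variable {d : ℕ} {Ω : Opens (EuclideanSpace ℝ (Fin d))} {B : DirichletEigenbasis Ω} {T α : ℝ}

/-- `w = D_{T-}^α v`, `z = Δ v`, `x₀ = (D_{T-}^{α-1} v)(0)` and `x₁ = (D_{T-}^{α-2} v)(0)`. -/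
structure HasWeakData (v : GSpace B T α) (w z : BochnerL2 T (SpaceL2 Ω)) (x₀ : G0Space B T α)
    (x₁ : G1Space B T α) : Prop where
  deriv : IsRightRL T α v.toL2 w
  laplacian : ∀ᵐ t ∂(volume.restrict (Ioo 0 T)), IsWeakLaplacian (v.toL2 t) (z t)
  trace₀ : HasRightRLTrace T (α - 1) v.toL2 x₀.toL2
  trace₁ : HasRightRLTrace T (α - 2) v.toL2 x₁.toL2

namespace HasWeakData

variable {v v' : GSpace B T α} {w z w' z' : BochnerL2 T (SpaceL2 Ω)} {x₀ x₀' : G0Space B T α}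
  {x₁ x₁' : G1Space B T α}

theorem add (h : HasWeakData v w z x₀ x₁) (h' : HasWeakData v' w' z' x₀' x₁') :
    HasWeakData (v + v') (w + w') (z + z') (x₀ + x₀') (x₁ + x₁') where
  deriv := by
    rw [map_add]
    exact ((h.deriv.add (integrableOn_bochnerL2 _) (integrableOn_bochnerL2 _) h'.deriv).congr
      (Lp.coeFn_add _ _).symm).congr_right (Lp.coeFn_add _ _).symm
  laplacian := by
    rw [map_add]
    filter_upwards [h.laplacian, h'.laplacian, Lp.coeFn_add v.toL2 v'.toL2, Lp.coeFn_add z z']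
      with t h1 h2 h3 h4
    rw [h3, h4]
    exact h1.add h2
  trace₀ := by
    rw [map_add, map_add]
    exact h.trace₀.add h'.trace₀
  trace₁ := by
    rw [map_add, map_add]
    exact h.trace₁.add h'.trace₁

theorem smul (c : ℝ) (h : HasWeakData v w z x₀ x₁) :
    HasWeakData (c • v) (c • w) (c • z) (c • x₀) (c • x₁) where
  deriv := by
    rw [map_smul]
    exact ((h.deriv.smul c).congr (Lp.coeFn_smul _ _).symm).congr_right (Lp.coeFn_smul _ _).symm
  laplacian := by
    rw [map_smul]
    filter_upwards [h.laplacian, Lp.coeFn_smul c v.toL2, Lp.coeFn_smul c z] with t h1 h3 h4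
    rw [h3, h4]
    exact h1.smul c
  trace₀ := by
    rw [map_smul, map_smul]
    exact h.trace₀.smul c
  trace₁ := by
    rw [map_smul, map_smul]
    exact h.trace₁.smul c

theorem norm_trace₀_le (h : HasWeakData v w z x₀ x₁) : ‖x₀‖ ≤ ‖v‖ := TraceSpace.norm_le h.trace₀

theorem norm_trace₁_le (h : HasWeakData v w z x₀ x₁) : ‖x₁‖ ≤ ‖v‖ := TraceSpace.norm_le h.trace₁

/-- Only these two components are needed: the bound by `‖w - z‖` later shows that the value of the
functional does not depend on the choice of traces. -/
theorem unique (hα : 0 < α) (h : HasWeakData v w z x₀ x₁) (h' : HasWeakData v w' z' x₀' x₁') :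
    w = w' ∧ z = z' := by
  refine ⟨h.deriv.unique hα h'.deriv, Lp.ext ?_⟩
  filter_upwards [h.laplacian, h'.laplacian] with t h1 h2
  exact h1.unique h2

end HasWeakData

theorem exists_hasWeakData_of_coeff (hα₁ : 1 < α) (hα₂ : α < 2) (v : GSpace B T α)
    {w z : BochnerL2 T (SpaceL2 Ω)}
    (hw : ∀ n, coeff B T n v.toL2 = (shiftSemigroup T).fracInt α (coeff B T n w))
    (hz : ∀ n, coeff B T n z = -(B.eig n) • coeff B T n v.toL2) :
    ∃ x₀ x₁, HasWeakData v w z x₀ x₁ := by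
  have h0 := hasRightRLTrace_sub_one_of_coeff B hα₁ hα₂ hw
  have h1 := hasRightRLTrace_sub_two_of_coeff B hα₁ hα₂ hw
  refine ⟨⟨_, v, h0⟩, ⟨_, v, h1⟩, isRightRL_of_coeff B hα₁ hα₂ hw, ?_, h0, h1⟩
  filter_upwards [ae_all_iff.2 fun n => coeff_coe B n v.toL2, ae_all_iff.2 fun n => coeff_coe B n z,
    ae_all_iff.2 fun n => Lp.coeFn_smul (-(B.eig n)) (coeff B T n v.toL2)] with t h2 h3 h4
  refine isWeakLaplacian_of_inner_eq B fun n => ?_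
  rw [← h2, ← h3, hz, h4]
  rfl

end WeakData

/-! ### Stability, solvability and the weak solution -/

/-- A bounded linear relation with values in the scalars is represented by a vector. -/
theorem exists_inner_eq_of_relation {E : Type*} [NormedAddCommGroup E] [InnerProductSpace ℝ E]
    [CompleteSpace E] {P : E → ℝ → Prop} {K : ℝ} (hK : 0 ≤ K) (total : ∀ g, ∃ r, P g r)
    (add : ∀ g r g' r', P g r → P g' r' → P (g + g') (r + r'))
    (smul : ∀ (c : ℝ) g r, P g r → P (c • g) (c * r)) (bound : ∀ g r, P g r → |r| ≤ K * ‖g‖) :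
    ∃ u : E, ‖u‖ ≤ K ∧ ∀ g r, P g r → r = ⟪u, g⟫ := by
  -- The difference of two values is related to the zero vector, so the bound forces it to vanish.
  have uniq : ∀ g r r', P g r → P g r' → r = r' := fun g r r' h h' => by
    have h1 := bound _ _ (add _ _ _ _ h (smul (-1) _ _ h'))
    rw [neg_one_smul, add_neg_cancel, norm_zero, mul_zero, abs_nonpos_iff] at h1
    linarith
  choose ℓ hℓ using total
  let L : StrongDual ℝ E := LinearMap.mkContinuous
    { toFun := ℓ
      map_add' := fun g g' => uniq _ _ _ (hℓ _) (add _ _ _ _ (hℓ g) (hℓ g'))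
      map_smul' := fun c g => uniq _ _ _ (hℓ _) (smul c _ _ (hℓ g)) } K fun g => bound _ _ (hℓ g)
  refine ⟨(InnerProductSpace.toDual ℝ E).symm L, ?_, fun g r hr => ?_⟩
  · rw [LinearIsometryEquiv.norm_map]
    exact LinearMap.mkContinuous_norm_le _ hK _
  · rw [InnerProductSpace.toDual_symm_apply]
    exact uniq _ _ _ hr (hℓ g)

/-- The stability constant of the transposed problem. -/
def stabilityConst (α : ℝ) : ℝ :=
  max (2 * √(NilpotentShift.sqFunConst (α - 1)) * NilpotentShift.resolventConst (α / 2))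
    (1 + NilpotentShift.resolventConst (α / 2))

theorem stabilityConst_pos {α : ℝ} (hα₁ : 1 < α) (hα₂ : α < 2) : 0 < stabilityConst α := by
  have := NilpotentShift.resolventConst_nonneg (β := α / 2) (by linarith) (by linarith)
  exact lt_max_of_lt_right (by linarith)

section Stability

variable {d : ℕ} {Ω : Opens (EuclideanSpace ℝ (Fin d))} {B : DirichletEigenbasis Ω} {T α : ℝ}

/-- Mode by mode, the resolvent estimate with `β = α/2` bounds `h n` uniformly in the eigenvalue.
The time norm then follows from the bound of `I^α` into `⁰H^α`, and the space norm from `λₙ cₙ = gₙ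
- hₙ`. -/
theorem gENorm_le_of_coeff (hα₁ : 1 < α) (hα₂ : α < 2) {v g : BochnerL2 T (SpaceL2 Ω)}
    {h : ℕ → BochnerL2 T ℝ} (hv : ∀ n, coeff B T n v = (shiftSemigroup T).fracInt α (h n))
    (hg : ∀ n, coeff B T n g = h n + B.eig n • coeff B T n v) :
    gENorm B T α v ≤ ENNReal.ofReal (stabilityConst α * ‖g‖) := by
  set R := NilpotentShift.resolventConst (α / 2) with hR
  have hR0 : 0 ≤ R := NilpotentShift.resolventConst_nonneg (by linarith) (by linarith)
  have h1 : ∀ n, ‖h n‖ ≤ R * ‖coeff B T n g‖ := fun n => by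
    have := (shiftSemigroup T).norm_le_norm_add_fracInt (β := α / 2) (by linarith) (by linarith)
      (B.eig_pos n).le (h n)
    rwa [mul_div_cancel₀ _ two_ne_zero, ← hv, ← hg] at this
  have h2 : ∀ n, B.eig n * ‖coeff B T n v‖ ≤ (1 + R) * ‖coeff B T n g‖ := fun n => by
    rw [← abs_of_pos (B.eig_pos n), ← Real.norm_eq_abs, ← norm_smul,
      show B.eig n • coeff B T n v = coeff B T n g - h n by rw [hg n]; abel]
    refine (norm_sub_le _ _).trans ?_
    linarith [h1 n]
  refine max_le ((mixedENorm_le B (K := 2 * √(NilpotentShift.sqFunConst (α - 1)) * R)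
    (by positivity) v g fun n => ?_).trans ?_) ((mixedENorm_le B (K := 1 + R)
    (by positivity) v g fun n => ?_).trans ?_)
  · rw [Real.rpow_zero, ENNReal.ofReal_one, one_mul, hv]
    gcongr
    refine (rightFracSobolevENorm_fracInt_le hα₁ hα₂ (h n)).trans (ENNReal.ofReal_le_ofReal ?_)
    rw [mul_assoc _ R]
    gcongr
    exact h1 n
  · gcongr
    exact le_max_left _ _
  · rw [Real.rpow_two, ENNReal.ofReal_pow (B.eig_pos n).le, ← mul_pow, ← ofReal_norm,
      ← ENNReal.ofReal_mul (B.eig_pos n).le]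
    exact pow_le_pow_left' (ENNReal.ofReal_le_ofReal (h2 n)) 2
  · gcongr
    exact le_max_right _ _

theorem summable_toReal_sq {ι : Type*} {a : ι → ℝ≥0∞} (h : ∑' n, a n ^ 2 ≠ ⊤) :
    Summable fun n => (a n).toReal ^ 2 := by
  simpa only [ENNReal.toReal_pow] using ENNReal.summable_toReal h

/-- Each coefficient lies in `⁰H^α`, hence is some `I^α (h n)`, with the norm of `h n` controlled by
its norm there. Summability of these norms assembles the `h n` into one function, which is `D_{T-}^α
v`. -/
theorem exists_coeff_eq_fracInt (hT : 0 < T) (hα₁ : 1 < α) (hα₂ : α < 2) (v : GSpace B T α) :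
    ∃ w, ∀ n, coeff B T n v.toL2 = (shiftSemigroup T).fracInt α (coeff B T n w) := by
  have h1 : ∑' n, rightFracSobolevENorm T α (coeff B T n v.toL2) ^ 2 ≠ ⊤ := by
    have h2 := sq_le_of_mixedENorm B (N := rightFracSobolevENorm T α) (β := 0) v.toL2
    simp only [Real.rpow_zero, ENNReal.ofReal_one, one_mul] at h2
    rw [h2]
    exact ENNReal.pow_ne_top ((le_max_left _ _).trans_lt v.gENorm_toL2_lt_top).ne
  have h2 : ∀ n, rightFracSobolevENorm T α (coeff B T n v.toL2) < ⊤ := fun n => by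
    have := ne_top_of_le_ne_top h1 (ENNReal.le_tsum n)
    exact lt_top_iff_ne_top.2 fun h => this (by simp [h])
  choose h hv hh using fun n => exists_fracInt_eq_of_rightFracSobolevENorm_lt_top hT hα₁ hα₂ (h2 n)
  obtain ⟨w, hw⟩ := exists_coeff_eq B h (((summable_toReal_sq h1).mul_left
    ((2 * √(NilpotentShift.sqFunConst (2 - α))) ^ 2)).of_nonneg_of_le (fun n => sq_nonneg _)
    fun n => by
      rw [← mul_pow]
      exact pow_le_pow_left₀ (norm_nonneg _) (hh n) 2)
  exact ⟨w, fun n => by rw [hw, hv]⟩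

theorem exists_coeff_eq_eig_smul (v : GSpace B T α) :
    ∃ z, ∀ n, coeff B T n z = -(B.eig n) • coeff B T n v.toL2 := by
  refine exists_coeff_eq B _ ?_
  have h1 : ∑' n, (ENNReal.ofReal (B.eig n) * ‖coeff B T n v.toL2‖ₑ) ^ 2 ≠ ⊤ := by
    have h2 := sq_le_of_mixedENorm B (N := fun w => ‖w‖ₑ) (β := 2) v.toL2
    simp only [Real.rpow_two, ENNReal.ofReal_pow (B.eig_pos _).le, ← mul_pow] at h2
    rw [h2]
    exact ENNReal.pow_ne_top ((le_max_right _ _).trans_lt v.gENorm_toL2_lt_top).ne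
  refine (summable_toReal_sq h1).congr fun n => ?_
  rw [ENNReal.toReal_mul, ENNReal.toReal_ofReal (B.eig_pos n).le, toReal_enorm, neg_smul,
    norm_neg, norm_smul, Real.norm_eq_abs, abs_of_pos (B.eig_pos n)]

theorem exists_hasWeakData (hT : 0 < T) (hα₁ : 1 < α) (hα₂ : α < 2) (v : GSpace B T α) :
    ∃ w z x₀ x₁, HasWeakData v w z x₀ x₁ ∧ ‖v‖ ≤ stabilityConst α * ‖w - z‖ := by
  obtain ⟨w, hw⟩ := exists_coeff_eq_fracInt hT hα₁ hα₂ v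
  obtain ⟨z, hz⟩ := exists_coeff_eq_eig_smul v
  obtain ⟨x₀, x₁, h⟩ := exists_hasWeakData_of_coeff hα₁ hα₂ v hw hz
  refine ⟨w, z, x₀, x₁, h, ?_⟩
  refine ENNReal.toReal_le_of_le_ofReal
    (mul_nonneg (stabilityConst_pos hα₁ hα₂).le (norm_nonneg _))
    (gENorm_le_of_coeff hα₁ hα₂ hw fun n => ?_)
  rw [map_sub, hz, neg_smul, sub_neg_eq_add]

/-- By uniqueness of `w` and `z` it suffices to have the bound for the data constructed from the
coefficients. -/
theorem HasWeakData.norm_le (hT : 0 < T) (hα₁ : 1 < α) (hα₂ : α < 2) {v : GSpace B T α}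
    {w z : BochnerL2 T (SpaceL2 Ω)} {x₀ : G0Space B T α} {x₁ : G1Space B T α}
    (h : HasWeakData v w z x₀ x₁) : ‖v‖ ≤ stabilityConst α * ‖w - z‖ := by
  obtain ⟨w', z', x₀', x₁', h', h1⟩ := exists_hasWeakData hT hα₁ hα₂ v
  obtain ⟨rfl, rfl⟩ := h.unique (by linarith) h'
  exact h1

/-- Solve `hₙ + λₙ I^α hₙ = gₙ` in each mode and set `cₙ = I^α hₙ`; the uniform resolvent bound
makes everything summable, and the stability bound puts the sum in `G`. -/
theorem exists_hasWeakData_sub_eq (hα₁ : 1 < α) (hα₂ : α < 2) (g : BochnerL2 T (SpaceL2 Ω)) :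
    ∃ (v : GSpace B T α) (w z : _) (x₀ : _) (x₁ : _), HasWeakData v w z x₀ x₁ ∧ w - z = g := by
  have h1 : ∀ n, ∃ h, h + B.eig n • (shiftSemigroup T).fracInt α h = coeff B T n g ∧
      ‖h‖ ≤ NilpotentShift.resolventConst (α / 2) * ‖coeff B T n g‖ := fun n => by
    have := (shiftSemigroup T).exists_add_fracInt_eq (β := α / 2) (by linarith) (by linarith)
      (B.eig_pos n).le (coeff B T n g)
    rwa [mul_div_cancel₀ _ two_ne_zero] at this
  choose h hg hh using h1
  have h2 : ∀ n, ‖h n‖ ^ 2 ≤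
      NilpotentShift.resolventConst (α / 2) ^ 2 * ‖coeff B T n g‖ ^ 2 := fun n => by
    rw [← mul_pow]
    exact pow_le_pow_left₀ (norm_nonneg _) (hh n) 2
  have h3 : Summable fun n => ‖h n‖ ^ 2 :=
    ((summable_norm_coeff_sq B g).mul_left _).of_nonneg_of_le (fun n => sq_nonneg _) h2
  obtain ⟨w, hw⟩ := exists_coeff_eq B h h3
  obtain ⟨v, hv⟩ := exists_coeff_eq B (fun n => (shiftSemigroup T).fracInt α (h n))
    ((h3.mul_left (‖(shiftSemigroup T).fracInt α‖ ^ 2)).of_nonneg_of_le (fun n => sq_nonneg _)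
      fun n => by
        rw [← mul_pow]
        exact pow_le_pow_left₀ (norm_nonneg _) (ContinuousLinearMap.le_opNorm _ _) 2)
  have hvG : gENorm B T α v < ⊤ :=
    (gENorm_le_of_coeff (g := g) hα₁ hα₂ hv fun n => by rw [hv, hg]).trans_lt ENNReal.ofReal_lt_top
  let V : GSpace B T α := ⟨v, hvG⟩
  obtain ⟨z, hz⟩ := exists_coeff_eq_eig_smul V
  have hvw : ∀ n, coeff B T n V.toL2 = (shiftSemigroup T).fracInt α (coeff B T n w) :=
    fun n => by
      rw [hw]
      exact hv n
  obtain ⟨x₀, x₁, hd⟩ := exists_hasWeakData_of_coeff hα₁ hα₂ V hvw hz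
  refine ⟨V, w, z, x₀, x₁, hd, coeff_ext B fun n => ?_⟩
  rw [map_sub, hz, neg_smul, sub_neg_eq_add, hvw, hw, hg]

theorem integral_integral_eq_inner (u w z : BochnerL2 T (SpaceL2 Ω)) :
    ∫ t in Ioo 0 T, (∫ x in (Ω : Set (EuclideanSpace ℝ (Fin d))), u t x * (w t x - z t x)) =
      ⟪u, w - z⟫ := by
  rw [L2.inner_def]
  refine integral_congr_ae ?_
  filter_upwards [Lp.coeFn_sub w z] with t ht
  rw [ht, Pi.sub_apply, L2.inner_def]
  refine integral_congr_ae ?_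
  filter_upwards [Lp.coeFn_sub (w t) (z t)] with x hx
  rw [hx]
  exact mul_comm _ _

theorem isWeakSolution_iff (f : StrongDual ℝ (GSpace B T α)) (u₀ : StrongDual ℝ (G0Space B T α))
    (u₁ : StrongDual ℝ (G1Space B T α)) (u : BochnerL2 T (SpaceL2 Ω)) :
    IsWeakSolution f u₀ u₁ u ↔ ∀ v, ∃ w z x₀ x₁, HasWeakData v w z x₀ x₁ ∧
      ⟪u, w - z⟫ = f v + u₀ x₀ + u₁ x₁ := by
  simp only [← integral_integral_eq_inner]
  exact forall_congr' fun v =>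
    ⟨fun ⟨w, z, x₀, x₁, h1, h2, h3, h4, h5⟩ => ⟨w, z, x₀, x₁, ⟨h1, h2, h3, h4⟩, h5⟩,
      fun ⟨w, z, x₀, x₁, h, h5⟩ => ⟨w, z, x₀, x₁, h.1, h.2, h.3, h.4, h5⟩⟩

theorem exists_isWeakSolution (hT : 0 < T) (hα₁ : 1 < α) (hα₂ : α < 2)
    (f : StrongDual ℝ (GSpace B T α)) (u₀ : StrongDual ℝ (G0Space B T α))
    (u₁ : StrongDual ℝ (G1Space B T α)) :
    ∃ u, IsWeakSolution f u₀ u₁ u ∧ (∀ u', IsWeakSolution f u₀ u₁ u' → u' = u) ∧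
      ‖u‖ ≤ stabilityConst α * (‖f‖ + ‖u₀‖ + ‖u₁‖) := by
  obtain ⟨u, hu, hP⟩ := exists_inner_eq_of_relation
    -- A relation in place of a function of `g`: it quantifies over all admissible test functions
    -- and traces, and so avoids choosing them linearly.
    (P := fun (g : BochnerL2 T (SpaceL2 Ω)) r => ∃ (v : GSpace B T α) (w z : _) (x₀ : _) (x₁ : _),
      HasWeakData v w z x₀ x₁ ∧ w - z = g ∧ f v + u₀ x₀ + u₁ x₁ = r)
    (K := stabilityConst α * (‖f‖ + ‖u₀‖ + ‖u₁‖))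
    (mul_nonneg (stabilityConst_pos hα₁ hα₂).le (by positivity))
    (fun g => by
      obtain ⟨v, w, z, x₀, x₁, h, hg⟩ := exists_hasWeakData_sub_eq (B := B) hα₁ hα₂ g
      exact ⟨_, v, w, z, x₀, x₁, h, hg, rfl⟩)
    (by
      rintro _ _ _ _ ⟨v, w, z, x₀, x₁, h, rfl, rfl⟩ ⟨v', w', z', x₀', x₁', h', rfl, rfl⟩
      refine ⟨_, _, _, _, _, h.add h', by abel, ?_⟩
      rw [map_add, map_add, map_add]
      ring)
    (by
      rintro c _ _ ⟨v, w, z, x₀, x₁, h, rfl, rfl⟩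
      refine ⟨_, _, _, _, _, h.smul c, (smul_sub _ _ _).symm, ?_⟩
      rw [map_smul, map_smul, map_smul]
      simp only [smul_eq_mul]
      ring)
    (by
      rintro _ _ ⟨v, w, z, x₀, x₁, h, rfl, rfl⟩
      have h1 : |f v + u₀ x₀ + u₁ x₁| ≤ (‖f‖ + ‖u₀‖ + ‖u₁‖) * ‖v‖ := by
        rw [add_mul, add_mul]
        refine (abs_add_three _ _ _).trans (add_le_add_three (f.le_opNorm v) ?_ ?_)
        · exact (u₀.le_opNorm x₀).trans (by gcongr; exact h.norm_trace₀_le)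
        · exact (u₁.le_opNorm x₁).trans (by gcongr; exact h.norm_trace₁_le)
      calc _ ≤ (‖f‖ + ‖u₀‖ + ‖u₁‖) * ‖v‖ := h1
        _ ≤ (‖f‖ + ‖u₀‖ + ‖u₁‖) * (stabilityConst α * ‖w - z‖) := by
          gcongr
          exact h.norm_le hT hα₁ hα₂
        _ = _ := by ring)
  refine ⟨u, ?_, fun u' hu' => ?_, hu⟩
  · rw [isWeakSolution_iff]
    intro v
    obtain ⟨w, z, x₀, x₁, h, -⟩ := exists_hasWeakData hT hα₁ hα₂ v
    exact ⟨w, z, x₀, x₁, h, (hP _ _ ⟨v, w, z, x₀, x₁, h, rfl, rfl⟩).symm⟩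
  · rw [isWeakSolution_iff] at hu'
    refine ext_inner_right ℝ fun g => ?_
    obtain ⟨v, w, z, x₀, x₁, h, rfl⟩ := exists_hasWeakData_sub_eq (B := B) hα₁ hα₂ g
    obtain ⟨w', z', x₀', x₁', h', h1⟩ := hu' v
    obtain ⟨rfl, rfl⟩ := h.unique (by linarith) h'
    rw [h1]
    -- The representation holds for whichever traces come with `u'`, so they need not agree with
    -- those of the constructed `v`.
    exact hP _ _ ⟨v, w, z, x₀', x₁', h', rfl, rfl⟩

end Stability

end FracWave

end

theorem mainTheorem6 (α : ℝ) (hα₁ : 1 < α) (hα₂ : α < 2) :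
    ∃ C : ℝ, 0 < C ∧
      ∀ (d : ℕ) (_ : 1 ≤ d) (_ : d ≤ 3) (Ω : Opens (EuclideanSpace ℝ (Fin d)))
        (_ : FracWave.IsConvexPolytope (Ω : Set (EuclideanSpace ℝ (Fin d))))
        (B : FracWave.DirichletEigenbasis Ω) (T : ℝ) (_ : 0 < T)
        (f : StrongDual ℝ (FracWave.GSpace B T α)) (u₀ : StrongDual ℝ (FracWave.G0Space B T α))
        (u₁ : StrongDual ℝ (FracWave.G1Space B T α)),
        (∃! u : FracWave.BochnerL2 T (FracWave.SpaceL2 Ω), FracWave.IsWeakSolution f u₀ u₁ u) ∧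
        ∀ u : FracWave.BochnerL2 T (FracWave.SpaceL2 Ω), FracWave.IsWeakSolution f u₀ u₁ u →
          ‖u‖ ≤ C * (‖f‖ + ‖u₀‖ + ‖u₁‖) := by
  refine ⟨FracWave.stabilityConst α, FracWave.stabilityConst_pos hα₁ hα₂, ?_⟩
  intro d _ _ Ω _ B T hT f u₀ u₁
  obtain ⟨u, h1, h2, h3⟩ := FracWave.exists_isWeakSolution hT hα₁ hα₂ f u₀ u₁
  exact ⟨⟨u, h1, h2⟩, fun u' hu' => (h2 u' hu').symm ▸ h3⟩
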